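/- All schemes are arbitrary. A $2$-torsion line bundle on a scheme $Y$ is a pair $(L,i_L)$ of a line bundle $L$ on $Y$ and an isomorphism $i_L:L^{\otimes 2}\xrightarrow{\sim}\mathcal{O}_Y$, which is part of the data; an isomorphism $(L,i_L)\cong(L',i_{L'})$ is an isomorphism $\iota:L\xrightarrow{\sim}L'$ with $i_{L'}\circ(\iota\otimes\iota)=i_L$. A Galois cover of $Y$ is a finite étale surjective morphism $f:X\to Y$ such that $X\times_YX$ is, as a scheme over $X$ via the first projection, isomorphic to a finite disjoint union of copies of $X$ ($X$ may be disconnected); isomorphisms of covers are isomorphisms of $Y$-schemes. Lemma 3.7. Let $Y$ be a connected scheme on which $2$ is invertible. There is a bijection $\Phi_Y$ from the set of isomorphism classes of $2$-torsion line bundles on $Y$ to the set of isomorphism classes of Galois covers $f:X\to Y$ of degree $2$. It is natural in the following sense: the class of $(L,i_L)$ corresponds to the class of $f:X\to Y$ if and only if $X$ is isomorphic over $Y$ to the relative spectrum of the $\mathcal{O}_Y$-algebra $\mathcal{O}_Y\oplus L$ with unit $(1,0)$ and multiplication $(a,s)(b,t)=(ab+i_L(s\otimes t),\,at+bs)$.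 The correspondence is compatible with base change. Let $g:Y'\to Y$ be any morphism of schemes. Pullback $(L,i_L)\mapsto(g^*L,g^*i_L)$ is well defined on isomorphism classes of $2$-torsion line bundles. If $Y'$ is connected, then for every $2$-torsion line bundle $(L,i_L)$ on $Y$ the class $\Phi_{Y'}(g^*L,g^*i_L)$ is the class of $X\times_YY'\to Y'$, where $X\to Y$ represents $\Phi_Y(L,i_L)$. For arbitrary $Y'$, if $X\to Y$ represents $\Phi_Y(L,i_L)$, then $X\times_YY'$ is the relative spectrum of the algebra $\mathcal{O}_{Y'}\oplus g^*L$ on $Y'$. -/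

import Mathlib

universe u

open CategoryTheory Limits AlgebraicGeometry

noncomputable section

namespace DoubleCover

/-! ### Structure sheaf and tensor products of sheaves of modules -/

/-- The structure sheaf `𝒪_X`, as a sheaf of modules over itself. -/
abbrev structureSheaf (X : Scheme.{u}) : X.Modules := SheafOfModules.unit X.ringCatSheaf

/-- A section of `𝒪_X` regarded as an element of the ring `Γ(X, U)`. -/
def toRing {X : Scheme.{u}} {U : X.Opens} (a : Γ(structureSheaf X, U)) : Γ(X, U) := a

/-- An element of the ring `Γ(X, U)` regarded as a section of the module `𝒪_X`. -/
def ofRing {X : Scheme.{u}} {U : X.Opens} (a : Γ(X, U)) : Γ(structureSheaf X, U) := a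

/-- The presheaf of modules underlying a sheaf of modules. -/
def toPre {X : Scheme.{u}} (M : X.Modules) :
    _root_.PresheafOfModules.{u} (X.presheaf ⋙ forget₂ CommRingCat RingCat) := M.val

/-- The presheaf `U ↦ M(U) ⊗_{𝒪(U)} N(U)`. -/
def preTensor {X : Scheme.{u}} (M N : X.Modules) : X.PresheafOfModules :=
  PresheafOfModules.Monoidal.tensorObj (R := X.presheaf) (toPre M) (toPre N)

/-- Sheafification of presheaves of `𝒪_X`-modules. -/
def sheafify (X : Scheme.{u}) : X.PresheafOfModules ⥤ X.Modules :=
  PresheafOfModules.sheafification (𝟙 X.ringCatSheaf.obj)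

/-- The tensor product `M ⊗ N` of sheaves of `𝒪_X`-modules: the sheaf associated with
`U ↦ M(U) ⊗_{𝒪(U)} N(U)`. -/
def tensor {X : Scheme.{u}} (M N : X.Modules) : X.Modules := (sheafify X).obj (preTensor M N)

/-- The morphism of presheaves `φ ⊗ ψ`. -/
def preTensorMap {X : Scheme.{u}} {M M' N N' : X.Modules} (φ : M ⟶ M') (ψ : N ⟶ N') :
    preTensor M N ⟶ preTensor M' N' :=
  PresheafOfModules.Monoidal.tensorHom (R := X.presheaf)
    (M₁ := toPre M) (M₂ := toPre M') (M₃ := toPre N) (M₄ := toPre N') φ.val ψ.val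

/-- The morphism `φ ⊗ ψ : M ⊗ N ⟶ M' ⊗ N'`. -/
def tensorMap {X : Scheme.{u}} {M M' N N' : X.Modules} (φ : M ⟶ M') (ψ : N ⟶ N') :
    tensor M N ⟶ tensor M' N' := (sheafify X).map (preTensorMap φ ψ)

lemma tensorMap_id {X : Scheme.{u}} (M N : X.Modules) :
    tensorMap (𝟙 M) (𝟙 N) = 𝟙 (tensor M N) := by
  have : preTensorMap (𝟙 M) (𝟙 N) = 𝟙 (preTensor M N) :=
    MonoidalCategory.id_tensorHom_id
      (C := _root_.PresheafOfModules.{u} (X.presheaf ⋙ forget₂ CommRingCat RingCat))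
      (toPre M) (toPre N)
  rw [tensorMap, this]
  exact (sheafify X).map_id _

lemma tensorMap_comp {X : Scheme.{u}} {M M' M'' N N' N'' : X.Modules}
    (φ : M ⟶ M') (ψ : N ⟶ N') (φ' : M' ⟶ M'') (ψ' : N' ⟶ N'') :
    tensorMap (φ ≫ φ') (ψ ≫ ψ') = tensorMap φ ψ ≫ tensorMap φ' ψ' := by
  have : preTensorMap (φ ≫ φ') (ψ ≫ ψ') = preTensorMap φ ψ ≫ preTensorMap φ' ψ' :=
    (MonoidalCategory.tensorHom_comp_tensorHom
      (C := _root_.PresheafOfModules.{u} (X.presheaf ⋙ forget₂ CommRingCat RingCat))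
      (X₁ := toPre M) (Y₁ := toPre M') (Z₁ := toPre M'')
      (X₂ := toPre N) (Y₂ := toPre N') (Z₂ := toPre N'')
      φ.val ψ.val φ'.val ψ'.val).symm
  rw [tensorMap, this]
  exact (sheafify X).map_comp _ _

/-- The section `s ⊗ t` of `M ⊗ N` over `U` defined by sections `s` of `M` and `t` of `N`:
the image of the elementary tensor `s ⊗ t ∈ M(U) ⊗_{𝒪(U)} N(U)` under the canonical map
to the associated sheaf. -/
def tmul {X : Scheme.{u}} {M N : X.Modules} {U : X.Opens} (s : Γ(M, U)) (t : Γ(N, U)) :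
    Γ(tensor M N, U) :=
  ((PresheafOfModules.sheafificationAdjunction (𝟙 X.ringCatSheaf.obj)).unit.app
    (preTensor M N)).app (.op U)
      (TensorProduct.tmul (X.presheaf.obj (.op U)) (M := Γ(M, U)) (N := Γ(N, U)) s t)

/-! ### `2`-torsion line bundles -/

/-- A line bundle on `X`: a sheaf of modules that is locally isomorphic to `𝒪`. -/
def IsLineBundle {X : Scheme.{u}} (L : X.Modules) : Prop :=
  ∀ x : X, ∃ U : X.Opens, x ∈ U ∧ Nonempty (L.restrict U.ι ≅ structureSheaf U)

/-- A `2`-torsion line bundle on `Y`: a line bundle `L` together with an isomorphism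
`i : L ⊗ L ≅ 𝒪_Y`, which is part of the data. -/
structure TorsionBundle (Y : Scheme.{u}) where
  /-- the underlying sheaf of modules -/
  L : Y.Modules
  isLineBundle : IsLineBundle L
  /-- the trivialization of the square -/
  i : tensor L L ≅ structureSheaf Y

namespace TorsionBundle

variable {Y : Scheme.{u}}

/-- Two `2`-torsion line bundles are isomorphic if there is an isomorphism of line bundles that
is compatible with the given trivializations of the squares. -/
def IsIsomorphic (L L' : TorsionBundle Y) : Prop :=
  ∃ ι : L.L ≅ L'.L, tensorMap ι.hom ι.hom ≫ L'.i.hom = L.i.hom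

lemma isIsomorphic_equivalence : Equivalence (IsIsomorphic (Y := Y)) where
  refl L := ⟨Iso.refl _, by
    rw [Iso.refl_hom, tensorMap_id, Category.id_comp]⟩
  symm := by
    rintro L L' ⟨ι, h⟩
    refine ⟨ι.symm, ?_⟩
    rw [← h, ← Category.assoc, ← tensorMap_comp, Iso.symm_hom, Iso.inv_hom_id, tensorMap_id,
      Category.id_comp]
  trans := by
    rintro L L' L'' ⟨ι, h⟩ ⟨κ, h'⟩
    refine ⟨ι ≪≫ κ, ?_⟩
    rw [Iso.trans_hom, tensorMap_comp, Category.assoc, h', h]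

instance setoid (Y : Scheme.{u}) : Setoid (TorsionBundle Y) :=
  ⟨IsIsomorphic, isIsomorphic_equivalence⟩

/-- Isomorphism classes of `2`-torsion line bundles on `Y`. -/
abbrev IsoClass (Y : Scheme.{u}) := Quotient (setoid Y)

/-- The function `i_L(s ⊗ t) ∈ Γ(Y, U)` for sections `s, t` of `L` over `U`. -/
def pair (L : TorsionBundle Y) {U : Y.Opens} (s t : Γ(L.L, U)) : Γ(Y, U) :=
  toRing (L.i.hom.app U (tmul s t))

/-- For `g : Y' ⟶ Y`, the section `g^* s` of `g^* M` over `g⁻¹ U` defined by a section `s`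
of `M` over `U`. -/
def pullbackSection {Y' : Scheme.{u}} (g : Y' ⟶ Y) {M : Y.Modules} {U : Y.Opens} (s : Γ(M, U)) :
    Γ((Scheme.Modules.pullback g).obj M, g ⁻¹ᵁ U) :=
  ((Scheme.Modules.pullbackPushforwardAdjunction g).unit.app M).app U s

/-- `L'` is the base change of the `2`-torsion line bundle `L` along `g : Y' ⟶ Y`: there is an
isomorphism `e : g^* L ≅ L'` that takes the isomorphism `g^* L ⊗ g^* L ≅ 𝒪_{Y'}` induced
by `i_L` to `i_{L'}`. The induced isomorphism is the one with `g^* s ⊗ g^* t ↦ g^* (i_L (s ⊗ t))`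
on pullbacks of local sections. -/
def IsBaseChange {Y' : Scheme.{u}} (g : Y' ⟶ Y) (L : TorsionBundle Y) (L' : TorsionBundle Y') :
    Prop :=
  ∃ e : (Scheme.Modules.pullback g).obj L.L ≅ L'.L, ∀ (U : Y.Opens) (s t : Γ(L.L, U)),
    L'.pair (e.hom.app (g ⁻¹ᵁ U) (pullbackSection g s)) (e.hom.app (g ⁻¹ᵁ U) (pullbackSection g t)) =
      g.app U (L.pair s t)

end TorsionBundle

/-! ### Galois covers of degree `2` -/

/-- A trivial cover: over the base `X` it is isomorphic to a finite disjoint union of copies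
of `X`. -/
def IsTrivialCover {Z X : Scheme.{u}} (p : Z ⟶ X) : Prop :=
  ∃ (n : ℕ) (e : Z ≅ ∐ fun _ : Fin n => X), e.hom ≫ Sigma.desc (fun _ => 𝟙 X) = p

/-- A Galois cover: a finite étale cover `f : X ⟶ Y` whose self-product `X ×_Y X ⟶ X` is a
trivial cover. Here `X` is allowed to be disconnected. -/
structure IsGaloisCover {X Y : Scheme.{u}} (f : X ⟶ Y) : Prop where
  isFinite : IsFinite f
  etale : Etale f
  surjective : Surjective f
  splits : IsTrivialCover (pullback.fst f f)

lemma IsTrivialCover.of_isPullback {Z X Z' X' : Scheme.{u}} {p : Z ⟶ X} {p' : Z' ⟶ X'}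
    {k : Z' ⟶ Z} {g : X' ⟶ X} (h : IsPullback k p' p g) (hp : IsTrivialCover p) :
    IsTrivialCover p' := by
  obtain ⟨n, e, he⟩ := hp
  have hι (i : Fin n) : (Sigma.ι (fun _ : Fin n => X) i ≫ e.inv) ≫ p = 𝟙 X := by
    rw [← he]; simp
  have hw (i : Fin n) :
      (g ≫ Sigma.ι (fun _ : Fin n => X) i ≫ e.inv) ≫ p = 𝟙 X' ≫ g := by
    rw [Category.assoc, hι, Category.comp_id, Category.id_comp]
  have hsq (i : Fin n) : IsPullback (h.lift _ _ (hw i)) g k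
      (Sigma.ι (fun _ : Fin n => X) i ≫ e.inv) := by
    refine (IsPullback.of_right (h₁₂ := p') (h₂₂ := p) (v₁₃ := g) ?_ (h.lift_fst _ _ _)
      h.flip).flip.flip
    rw [h.lift_snd, hι]
    exact IsPullback.of_horiz_isIso ⟨by simp⟩
  let c : Cofan (fun _ : Fin n => X) :=
    Cofan.mk Z (fun i => Sigma.ι (fun _ : Fin n => X) i ≫ e.inv)
  let c' : Cofan (fun _ : Fin n => X') := Cofan.mk Z' (fun i => h.lift _ _ (hw i))
  have hc : IsColimit c :=
    IsColimit.ofIsoColimit (coproductIsCoproduct (fun _ : Fin n => X))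
      (Cofan.ext e.symm (fun i => rfl))
  obtain ⟨hc'⟩ := FinitaryPreExtensive.isUniversal_finiteCoproducts hc c'
    (Discrete.natTrans (fun _ => g)) k
    (by ext ⟨i⟩; exact (hsq i).w.symm)
    (NatTrans.Equifibered.of_discrete _)
    (fun ⟨i⟩ => hsq i)
  refine ⟨n, hc'.coconePointUniqueUpToIso (coproductIsCoproduct (fun _ : Fin n => X')), ?_⟩
  refine Cofan.IsColimit.hom_ext hc' _ _ (fun i => ?_)
  have h1 : c'.inj i ≫ (hc'.coconePointUniqueUpToIso
      (coproductIsCoproduct (fun _ : Fin n => X'))).hom = Sigma.ι (fun _ : Fin n => X') i :=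
    hc'.comp_coconePointUniqueUpToIso_hom _ ⟨i⟩
  rw [reassoc_of% h1, Sigma.ι_desc]
  exact (h.lift_snd _ _ (hw i)).symm

/-- Galois covers are stable under base change. -/
lemma IsGaloisCover.baseChange {X Y Y' : Scheme.{u}} {f : X ⟶ Y} (hf : IsGaloisCover f)
    (g : Y' ⟶ Y) : IsGaloisCover (pullback.snd f g) where
  isFinite := by have := hf.isFinite; infer_instance
  etale := by have := hf.etale; infer_instance
  surjective := by have := hf.surjective; infer_instance
  splits := by
    refine hf.splits.of_isPullback (k := pullback.map _ _ _ _ (pullback.fst f g)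
      (pullback.fst f g) g pullback.condition.symm pullback.condition.symm)
      (g := pullback.fst f g) ?_
    have h1 := (IsPullback.of_hasPullback (pullback.snd f g) (pullback.snd f g)).flip.paste_horiz
      (IsPullback.of_hasPullback f g)
    rw [← pullback.condition] at h1
    refine IsPullback.of_right (h₁₂ := pullback.snd f f) (h₂₂ := f) (v₁₃ := f) ?_ ?_
      (IsPullback.of_hasPullback f f).flip
    · rw [pullback.lift_snd]
      exact h1
    · exact pullback.lift_fst _ _ _

/-- A Galois cover of `Y` of degree `2`. -/
structure GaloisDoubleCover (Y : Scheme.{u}) where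
  /-- the total space -/
  X : Scheme.{u}
  /-- the structure morphism -/
  f : X ⟶ Y
  isGalois : IsGaloisCover f
  degree_eq : ∀ y : Y, f.finrank y = 2

namespace GaloisDoubleCover

variable {Y : Scheme.{u}}

/-- Isomorphism of covers, i.e. of schemes over `Y`. -/
def IsIsomorphic (X X' : GaloisDoubleCover Y) : Prop :=
  ∃ e : X.X ≅ X'.X, e.hom ≫ X'.f = X.f

lemma isIsomorphic_equivalence : Equivalence (IsIsomorphic (Y := Y)) where
  refl X := ⟨Iso.refl _, by simp⟩
  symm := by
    rintro X X' ⟨e, h⟩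
    exact ⟨e.symm, by simp [← h]⟩
  trans := by
    rintro X X' X'' ⟨e, h⟩ ⟨e', h'⟩
    exact ⟨e ≪≫ e', by simp [h, h']⟩

instance setoid (Y : Scheme.{u}) : Setoid (GaloisDoubleCover Y) :=
  ⟨IsIsomorphic, isIsomorphic_equivalence⟩

/-- Isomorphism classes of Galois covers of `Y` of degree `2`. -/
abbrev IsoClass (Y : Scheme.{u}) := Quotient (setoid Y)

/-- The base change `X ×_Y Y' ⟶ Y'` of a Galois cover `X ⟶ Y` of degree `2`. -/
def baseChange {Y' : Scheme.{u}} (g : Y' ⟶ Y) (X : GaloisDoubleCover Y) :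
    GaloisDoubleCover Y' where
  X := pullback X.f g
  f := pullback.snd X.f g
  isGalois := X.isGalois.baseChange g
  degree_eq y := by
    have := X.isGalois.isFinite
    have := X.isGalois.etale
    rw [Scheme.Hom.finrank_pullback_snd, X.degree_eq]

/-- Base change on isomorphism classes of Galois covers of degree `2`. -/
def classBaseChange {Y' : Scheme.{u}} (g : Y' ⟶ Y) :
    IsoClass Y → IsoClass Y' :=
  Quotient.map (baseChange g) (by
    rintro X X' ⟨e, h⟩
    have h1 : X.f ≫ 𝟙 Y = e.hom ≫ X'.f := by rw [Category.comp_id, h]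
    have h2 : g ≫ 𝟙 Y = 𝟙 Y' ≫ g := by rw [Category.comp_id, Category.id_comp]
    have := pullback.map_isIso X.f g X'.f g e.hom (𝟙 Y') (𝟙 Y) h1 h2
    let i : pullback X.f g ≅ pullback X'.f g :=
      asIso (pullback.map X.f g X'.f g e.hom (𝟙 Y') (𝟙 Y) h1 h2)
    refine ⟨i, ?_⟩
    exact (pullback.lift_snd _ _ _).trans (Category.comp_id _))

end GaloisDoubleCover

/-! ### The algebra `𝒪_Y ⊕ L` and its relative spectrum -/

section Algebra

variable {Y : Scheme.{u}}

/-- The sheaf of modules `𝒪_Y ⊕ L` underlying the algebra `𝒜_L`. -/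
def algebraSheaf (L : TorsionBundle Y) : Y.Modules := structureSheaf Y ⊞ L.L

/-- The section `(a, s)` of `𝒪_Y ⊕ L`. -/
def algebraSection (L : TorsionBundle Y) {U : Y.Opens} (a : Γ(Y, U)) (s : Γ(L.L, U)) :
    Γ(algebraSheaf L, U) :=
  (biprod.inl : structureSheaf Y ⟶ structureSheaf Y ⊞ L.L).app U (ofRing a) +
    (biprod.inr : L.L ⟶ structureSheaf Y ⊞ L.L).app U s

/-- The sheaf of modules `f_* 𝒪_X` on `Y`. -/
def pushforwardStructureSheaf {X : Scheme.{u}} (f : X ⟶ Y) : Y.Modules :=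
  (Scheme.Modules.pushforward f).obj (structureSheaf X)

/-- A section of `f_* 𝒪_X` over `U`, as an element of the ring `Γ(X, f⁻¹ U)`. -/
def pushforwardToRing {X : Scheme.{u}} (f : X ⟶ Y) {U : Y.Opens}
    (a : Γ(pushforwardStructureSheaf f, U)) : Γ(X, f ⁻¹ᵁ U) := a

/-- `f : X ⟶ Y` is the relative spectrum of the `𝒪_Y`-algebra `𝒜_L = 𝒪_Y ⊕ L` with unit `(1, 0)`
and multiplication `(a, s) * (b, t) = (a b + i_L (s ⊗ t), a t + b s)`: the morphism `f` is affine
and `𝒜_L` is isomorphic to `f_* 𝒪_X` as an `𝒪_Y`-algebra. -/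
def IsRelSpec (L : TorsionBundle Y) {X : Scheme.{u}} (f : X ⟶ Y) : Prop :=
  IsAffineHom f ∧ ∃ e : algebraSheaf L ≅ pushforwardStructureSheaf f,
    (∀ U : Y.Opens, pushforwardToRing f (e.hom.app U (algebraSection L (1 : Γ(Y, U)) 0)) = 1) ∧
    ∀ (U : Y.Opens) (a b : Γ(Y, U)) (s t : Γ(L.L, U)),
      pushforwardToRing f (e.hom.app U (algebraSection L (a * b + L.pair s t) (a • t + b • s))) =
        pushforwardToRing f (e.hom.app U (algebraSection L a s)) *
          pushforwardToRing f (e.hom.app U (algebraSection L b t))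

end Algebra

end DoubleCover

end

/-!
A `2`-torsion line bundle `L` gives the double cover `Spec (𝒪_Y ⊕ L)`; conversely, a double cover
`f : X ⟶ Y` splits as `f_* 𝒪_X = 𝒪_Y ⊕ L`, where `L` is the part on which the involution of the
cover acts by `-1`, and the multiplication of `f_* 𝒪_X` restricts to `L ⊗ L ≅ 𝒪_Y`.

All morphisms of sheaves are handled through local sections. That `f` is a relative spectrum of
`𝒪_Y ⊕ L` means that `f` is affine and that there is a map `L ⟶ f_* 𝒪_X`, multiplicative for the
pairing `i_L`, which together with the structure map is an isomorphism `𝒪_Y ⊕ L ≅ f_* 𝒪_X`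
(`IsTwistedSum`, `isRelSpec_iff`). The image of a local generator of `L` is a function `s` on the
cover such that `s²` is a unit of the base and `1, s` is a basis: a *special* function
(`IsSpecial`). As `2` is invertible, two special functions differ by a unit of the base
(`IsSpecial.exists_unit`). Thus the submodule of `f_* 𝒪_X` generated by special functions depends
only on the cover, and this is how `L` is recovered, with no mention of an involution or a trace.

* From covers to line bundles: the algebra of a finite étale cover of degree `2` is locally free
  with basis `1, e`; completing the square in the equation of `e` gives `s` with `s² = d`, and `d`
  is a unit as the cover is unramified. So special functions exist locally (`isBasisOf_isSpecial`),
  and the line bundle that they generate has the given cover as its relative spectrum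
  (`exists_isTwistedSum`).
* From line bundles to covers: the affine schemes `Spec (𝒪_Y ⊕ L)(U)` are glued to a relative
  spectrum (`exists_isTwistedSum_twistedCoverMap`), for which one has to know that `𝒪_Y ⊕ L` is
  compatible with localization. Any relative spectrum of `𝒪_Y ⊕ L` is finite étale of degree `2`,
  since it is locally `A[s]` with `s²` and `2` invertible. Its self-product is the disjoint union
  of the diagonal and the graph of the involution `(a, s) ↦ (a, -s)`
  (`IsTwistedSum.isTrivialCover`).
* Uniqueness and base change: a relative spectrum is determined by its universal property
  (`exists_iso_of_isTwistedSum`). Special functions are stable under base change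
  (`IsSpecial.pullFun`); hence, if `L` and `L'` are the line bundles of a cover and of its base
  change along `g`, pullback of functions is a map `L ⟶ g_* L'` that preserves generators, and
  `L'` is the base change of `L` (`isBaseChange_of_isPullback`). The case `g = 𝟙 Y` says that the
  cover determines `L`.
-/

noncomputable section

namespace DoubleCover

/-! ### Sections of sheaves of modules -/

section Sections

variable {X : Scheme.{u}}

/-- Restriction of sections of a sheaf of modules. -/
def rs (M : X.Modules) {V U : X.Opens} (h : V ≤ U) : Γ(M, U) →+ Γ(M, V) :=
  (M.presheaf.map (homOfLE h).op).hom

/-- Restriction of regular functions. -/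
def ro (X : Scheme.{u}) {V U : X.Opens} (h : V ≤ U) : Γ(X, U) →+* Γ(X, V) :=
  (X.presheaf.map (homOfLE h).op).hom

@[simp] lemma rs_self (M : X.Modules) {U : X.Opens} (h : U ≤ U) (x : Γ(M, U)) :
    rs M h x = x := by
  simp [rs]

@[simp] lemma ro_self {U : X.Opens} (h : U ≤ U) (x : Γ(X, U)) : ro X h x = x := by
  simp [ro]

@[simp] lemma rs_rs (M : X.Modules) {W V U : X.Opens} (h : V ≤ U) (h' : W ≤ V) (x : Γ(M, U)) :
    rs M h' (rs M h x) = rs M (h'.trans h) x := by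
  have : (homOfLE (h'.trans h)).op = (homOfLE h).op ≫ (homOfLE h').op := rfl
  simp [rs, this]

@[simp] lemma ro_ro {W V U : X.Opens} (h : V ≤ U) (h' : W ≤ V) (x : Γ(X, U)) :
    ro X h' (ro X h x) = ro X (h'.trans h) x := by
  have : (homOfLE (h'.trans h)).op = (homOfLE h).op ≫ (homOfLE h').op := rfl
  simp [ro, this]

@[simp] lemma rs_smul (M : X.Modules) {V U : X.Opens} (h : V ≤ U) (a : Γ(X, U)) (x : Γ(M, U)) :
    rs M h (a • x) = ro X h a • rs M h x :=
  Scheme.Modules.map_smul M (homOfLE h) a x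

lemma app_rs {M N : X.Modules} (φ : M ⟶ N) {V U : X.Opens} (h : V ≤ U) (x : Γ(M, U)) :
    φ.app V (rs M h x) = rs N h (φ.app U x) :=
  ConcreteCategory.congr_hom (φ.mapPresheaf.naturality (homOfLE h).op) x

lemma modules_hom_ext {M N : X.Modules} {φ ψ : M ⟶ N}
    (h : ∀ (U : X.Opens) (x : Γ(M, U)), φ.app U x = ψ.app U x) : φ = ψ :=
  Scheme.Modules.hom_ext _ _ fun U => by ext x; exact h U x

/-- A family of open sets that is a basis of the topology. -/
def IsBasisOf (P : X.Opens → Prop) : Prop :=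
  ∀ (U : X.Opens), ∀ x ∈ U, ∃ V, V ≤ U ∧ x ∈ V ∧ P V

lemma section_ext {M : X.Modules} {U : X.Opens} {s t : Γ(M, U)}
    (h : ∀ x ∈ U, ∃ (V : X.Opens) (hV : V ≤ U), x ∈ V ∧ rs M hV s = rs M hV t) : s = t := by
  choose V hV hx hst using fun x : U => h x.1 x.2
  refine TopCat.Sheaf.eq_of_locally_eq' ⟨M.presheaf, M.isSheaf⟩ V U (fun x => homOfLE (hV x)) ?_
    s t hst
  intro x hxU
  exact TopologicalSpace.Opens.mem_iSup.mpr ⟨⟨x, hxU⟩, hx _⟩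

lemma function_ext {U : X.Opens} {s t : Γ(X, U)}
    (h : ∀ x ∈ U, ∃ (V : X.Opens) (hV : V ≤ U), x ∈ V ∧ ro X hV s = ro X hV t) : s = t :=
  section_ext (M := structureSheaf X) (s := ofRing s) (t := ofRing t) h

/-- Sections given compatibly on the members of a basis contained in `U` glue. -/
lemma section_glue {M : X.Modules} {U : X.Opens} {P : X.Opens → Prop}
    (hP : ∀ x ∈ U, ∀ W : X.Opens, x ∈ W → ∃ V ≤ W, x ∈ V ∧ V ≤ U ∧ P V)
    (s : ∀ V, V ≤ U → P V → Γ(M, V))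
    (hs : ∀ V W (hV : V ≤ U) (hW : W ≤ U) (pV : P V) (pW : P W) (h : W ≤ V),
      rs M h (s V hV pV) = s W hW pW) :
    ∃ t : Γ(M, U), ∀ V (hV : V ≤ U) (pV : P V), rs M hV t = s V hV pV := by
  let ι := {V : X.Opens // V ≤ U ∧ P V}
  obtain ⟨t, ht, -⟩ := TopCat.Sheaf.existsUnique_gluing' ⟨M.presheaf, M.isSheaf⟩
    (fun V : ι => V.1) U (fun V => homOfLE V.2.1) (fun x hx => by
      obtain ⟨V, -, hxV, hV, pV⟩ := hP x hx U hx
      exact TopologicalSpace.Opens.mem_iSup.mpr ⟨⟨V, hV, pV⟩, hxV⟩)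
    (fun V => s V.1 V.2.1 V.2.2) (fun V W => by
      change rs M inf_le_left _ = rs M inf_le_right _
      refine section_ext fun x hx => ?_
      obtain ⟨K, hK, hxK, hKU, pK⟩ := hP x (V.2.1 hx.1) _ hx
      refine ⟨K, hK, hxK, ?_⟩
      rw [rs_rs, rs_rs, hs _ _ _ hKU V.2.2 pK, hs _ _ _ hKU W.2.2 pK])
  exact ⟨t, fun V hV pV => ht ⟨V, hV, pV⟩⟩

lemma isUnit_of_locally {U : X.Opens} {a : Γ(X, U)}
    (h : ∀ x ∈ U, ∃ (V : X.Opens) (hV : V ≤ U), x ∈ V ∧ IsUnit (ro X hV a)) : IsUnit a := by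
  refine X.toRingedSpace.isUnit_of_isUnit_germ U a fun x hx => ?_
  obtain ⟨V, hV, hxV, hu⟩ := h x hx
  have := hu.map (X.presheaf.germ V x hxV).hom
  rwa [ro, TopCat.Presheaf.germ_res_apply] at this

/-- The morphism of sheaves of modules given by compatible linear maps on sections. -/
def mkHom {M N : X.Modules} (φ : ∀ U : X.Opens, Γ(M, U) →ₗ[Γ(X, U)] Γ(N, U))
    (hφ : ∀ (U V : X.Opens) (h : V ≤ U) (x : Γ(M, U)), φ V (rs M h x) = rs N h (φ U x)) :
    M ⟶ N :=
  ⟨{ app := fun U => ModuleCat.ofHom (φ U.unop)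
     naturality := fun {U V} i => by
      ext x
      exact hφ U.unop V.unop i.unop.le x }⟩

/-- Linear maps given compatibly on a basis of the topology extend to a morphism of sheaves. -/
lemma exists_hom_of_basis {M N : X.Modules} {P : X.Opens → Prop} (hP : IsBasisOf P)
    (φ : ∀ U : X.Opens, P U → Γ(M, U) →ₗ[Γ(X, U)] Γ(N, U))
    (hφ : ∀ (U V : X.Opens) (hU : P U) (hV : P V) (h : V ≤ U) (x : Γ(M, U)),
      φ V hV (rs M h x) = rs N h (φ U hU x)) :
    ∃ ψ : M ⟶ N, ∀ U hU x, ψ.app U x = φ U hU x := by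
  have key : ∀ (U : X.Opens) (x : Γ(M, U)), ∃ t : Γ(N, U),
      ∀ V (hV : V ≤ U) (pV : P V), rs N hV t = φ V pV (rs M hV x) := fun U x =>
    section_glue (fun p hp W hW => by
      obtain ⟨V, hV, hpV, pV⟩ := hP (U ⊓ W) p ⟨hp, hW⟩
      exact ⟨V, hV.trans inf_le_right, hpV, hV.trans inf_le_left, pV⟩) _
      (fun V W hV hW pV pW h => by rw [← hφ, rs_rs])
  have ext : ∀ (U : X.Opens) (s t : Γ(N, U)),
      (∀ V (hV : V ≤ U), P V → rs N hV s = rs N hV t) → s = t := fun U s t h =>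
    section_ext fun p hp => by
      obtain ⟨V, hV, hpV, pV⟩ := hP U p hp
      exact ⟨V, hV, hpV, h V hV pV⟩
  choose t ht using key
  refine ⟨mkHom (fun U => { toFun := t U, map_add' := fun x y => ?_, map_smul' := fun a x => ?_ })
    (fun U V h x => ?_), fun U hU x => ?_⟩
  · refine ext _ _ _ fun V hV pV => ?_
    rw [map_add, ht _ _ _ _ pV, ht _ _ _ _ pV, ht _ _ _ _ pV, map_add, map_add]
  · refine ext _ _ _ fun V hV pV => ?_
    rw [RingHom.id_apply, rs_smul, ht _ _ _ _ pV, ht _ _ _ _ pV, rs_smul, map_smul]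
  · refine ext _ _ _ fun W hW pW => ?_
    change rs N hW (t V _) = rs N hW (rs N h (t U x))
    rw [rs_rs, ht _ _ _ _ pW, ht _ _ _ _ pW, rs_rs]
  · change t U x = _
    have := ht U x U le_rfl hU
    rwa [rs_self, rs_self] at this

/-- Bijectivity of a map of sheaves over an open set may be checked on a basis. -/
lemma bijective_of_basis {M N : X.Modules} {U : X.Opens} {P : X.Opens → Prop}
    (hP : ∀ x ∈ U, ∀ W : X.Opens, x ∈ W → ∃ V ≤ W, x ∈ V ∧ V ≤ U ∧ P V)
    (φ : ∀ V : X.Opens, V ≤ U → Γ(M, V) → Γ(N, V))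
    (hφ : ∀ (V W : X.Opens) (hV : V ≤ U) (h : W ≤ V) (x : Γ(M, V)),
      φ W (h.trans hV) (rs M h x) = rs N h (φ V hV x))
    (hb : ∀ V hV, P V → Function.Bijective (φ V hV)) (V : X.Opens) (hV : V ≤ U) :
    Function.Bijective (φ V hV) := by
  constructor
  · intro x y hxy
    refine section_ext fun p hp => ?_
    obtain ⟨W, hW, hpW, hWU, pW⟩ := hP p (hV hp) V hp
    refine ⟨W, hW, hpW, (hb W hWU pW).1 ?_⟩
    rw [hφ V W hV hW, hφ V W hV hW, hxy]
  · intro y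
    choose s hs using fun W hWU pW => (hb W hWU pW).2
    obtain ⟨t, ht⟩ := section_glue (M := M) (U := V) (P := P) (fun p hp W hW => by
      obtain ⟨K, hK, hpK, -, pK⟩ := hP p (hV hp) (V ⊓ W) ⟨hp, hW⟩
      exact ⟨K, hK.trans inf_le_right, hpK, hK.trans inf_le_left, pK⟩)
      (fun W hW pW => s W (hW.trans hV) pW (rs N hW y)) (fun W K hW hK pW pK h => by
        refine (hb K (hK.trans hV) pK).1 ?_
        rw [hφ W K (hW.trans hV) h, hs, hs, rs_rs])
    refine ⟨t, section_ext fun p hp => ?_⟩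
    obtain ⟨W, hW, hpW, hWU, pW⟩ := hP p (hV hp) V hp
    refine ⟨W, hW, hpW, ?_⟩
    rw [← hφ V W hV hW, ht W hW pW, hs]

lemma IsBasisOf.le {P : X.Opens → Prop} (hP : IsBasisOf P) (U : X.Opens) :
    ∀ x ∈ U, ∀ W : X.Opens, x ∈ W → ∃ V ≤ W, x ∈ V ∧ V ≤ U ∧ P V := fun x hx W hW => by
  obtain ⟨V, hV, hxV, pV⟩ := hP (U ⊓ W) x ⟨hx, hW⟩
  exact ⟨V, hV.trans inf_le_right, hxV, hV.trans inf_le_left, pV⟩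

lemma isIso_of_bijective {M N : X.Modules} (φ : M ⟶ N)
    (h : ∀ U, Function.Bijective (φ.app U)) : IsIso φ := by
  rw [Scheme.Modules.Hom.isIso_iff_isIso_app]
  intro U
  rw [ConcreteCategory.isIso_iff_bijective]
  exact h U

lemma bijective_of_isIso {M N : X.Modules} (φ : M ⟶ N) [IsIso φ] (U : X.Opens) :
    Function.Bijective (φ.app U) :=
  (ConcreteCategory.isIso_iff_bijective _).mp inferInstance

lemma isIso_of_basis {M N : X.Modules} (φ : M ⟶ N) {P : X.Opens → Prop} (hP : IsBasisOf P)
    (h : ∀ U, P U → Function.Bijective (φ.app U)) : IsIso φ :=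
  isIso_of_bijective φ fun U => bijective_of_basis (U := U) (hP.le U) (fun V _ => φ.app V)
    (fun _ _ _ h x => app_rs φ h x) (fun V _ pV => h V pV) U le_rfl

end Sections

/-! ### Tensor products through local sections -/

section Tensor

variable {X : Scheme.{u}}

open scoped TensorProduct

/-- The canonical map from the tensor product of modules of sections to the sections of the
tensor product of sheaves. -/
def tensorSections (M N : X.Modules) (U : X.Opens) :
    Γ(M, U) ⊗[Γ(X, U)] Γ(N, U) →ₗ[Γ(X, U)] Γ(tensor M N, U) :=
  (((PresheafOfModules.sheafificationAdjunction (𝟙 X.ringCatSheaf.obj)).unit.app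
    (preTensor M N)).app (.op U)).hom

lemma tensorSections_tmul {M N : X.Modules} {U : X.Opens} (s : Γ(M, U)) (t : Γ(N, U)) :
    tensorSections M N U (s ⊗ₜ t) = tmul s t := rfl

lemma tmul_add_left {M N : X.Modules} {U : X.Opens} (s s' : Γ(M, U)) (t : Γ(N, U)) :
    tmul (s + s') t = tmul s t + tmul s' t := by
  simp only [← tensorSections_tmul, TensorProduct.add_tmul, map_add]

lemma tmul_add_right {M N : X.Modules} {U : X.Opens} (s : Γ(M, U)) (t t' : Γ(N, U)) :
    tmul s (t + t') = tmul s t + tmul s t' := by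
  simp only [← tensorSections_tmul, TensorProduct.tmul_add, map_add]

lemma tmul_smul_left {M N : X.Modules} {U : X.Opens} (a : Γ(X, U)) (s : Γ(M, U)) (t : Γ(N, U)) :
    tmul (a • s) t = a • tmul s t := by
  simp only [← tensorSections_tmul, ← TensorProduct.smul_tmul', map_smul]

lemma tmul_smul_right {M N : X.Modules} {U : X.Opens} (a : Γ(X, U)) (s : Γ(M, U)) (t : Γ(N, U)) :
    tmul s (a • t) = a • tmul s t := by
  simp only [← tensorSections_tmul, TensorProduct.tmul_smul, map_smul]

lemma rs_tmul {M N : X.Modules} {V U : X.Opens} (h : V ≤ U) (s : Γ(M, U)) (t : Γ(N, U)) :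
    rs (tensor M N) h (tmul s t) = tmul (rs M h s) (rs N h t) :=
  (PresheafOfModules.naturality_apply
    ((PresheafOfModules.sheafificationAdjunction (𝟙 X.ringCatSheaf.obj)).unit.app
      (preTensor M N)) (homOfLE h).op (s ⊗ₜ[Γ(X, U)] t : Γ(M, U) ⊗[Γ(X, U)] Γ(N, U))).symm

/-- Every section of the sheaf `M ⊗ N` comes locally from the presheaf tensor product. -/
lemma tensor_locally {M N : X.Modules} {U : X.Opens} (w : Γ(tensor M N, U)) :
    ∀ x ∈ U, ∃ (V : X.Opens) (hV : V ≤ U), x ∈ V ∧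
      ∃ z : Γ(M, V) ⊗[Γ(X, V)] Γ(N, V), rs _ hV w = tensorSections M N V z := by
  intro x hx
  obtain ⟨V, i, ⟨z, hz⟩, hxV⟩ := Presheaf.imageSieve_mem (Opens.grothendieckTopology X)
    (CategoryTheory.toSheafify (Opens.grothendieckTopology X) (preTensor M N).presheaf)
    (U := .op U) w x hx
  exact ⟨V, i.le, hxV, z, hz.symm⟩

/-- A bilinear map on local sections, compatible with restriction, induces a morphism out of the
tensor product. -/
lemma exists_tensor_desc {M N K : X.Modules}
    (β : ∀ U : X.Opens, Γ(M, U) →ₗ[Γ(X, U)] Γ(N, U) →ₗ[Γ(X, U)] Γ(K, U))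
    (hβ : ∀ (U V : X.Opens) (h : V ≤ U) (s : Γ(M, U)) (t : Γ(N, U)),
      β V (rs M h s) (rs N h t) = rs K h (β U s t)) :
    ∃ φ : tensor M N ⟶ K, ∀ (U : X.Opens) (s : Γ(M, U)) (t : Γ(N, U)),
      φ.app U (tmul s t) = β U s t := by
  let K' := (PresheafOfModules.restrictScalars (𝟙 X.ringCatSheaf.obj)).obj
    ((SheafOfModules.forget _).obj K)
  let γ (U : X.Opensᵒᵖ) : (preTensor M N).obj U ⟶ K'.obj U := by
    exact ModuleCat.ofHom (R := Γ(X, U.unop)) (X := Γ(M, U.unop) ⊗[Γ(X, U.unop)] Γ(N, U.unop))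
      (Y := Γ(K, U.unop)) (TensorProduct.lift (β U.unop))
  let ψ : preTensor M N ⟶ K' :=
    { app := γ
      naturality := fun {U V} i => ModuleCat.MonoidalCategory.tensor_ext (fun s t =>
        hβ U.unop V.unop i.unop.le s t) }
  let adj := PresheafOfModules.sheafificationAdjunction (𝟙 X.ringCatSheaf.obj)
  let φ : tensor M N ⟶ K := (adj.homEquiv _ _).symm ψ
  refine ⟨φ, fun U s t => ?_⟩
  have h1 := (adj.homEquiv_unit _ _ φ).symm.trans (Equiv.apply_symm_apply _ ψ)
  have h2 := congr(($h1).app (.op U))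
  exact ConcreteCategory.congr_hom h2 (s ⊗ₜ[Γ(X, U)] t : Γ(M, U) ⊗[Γ(X, U)] Γ(N, U))

lemma tensor_hom_ext {M N K : X.Modules} {φ ψ : tensor M N ⟶ K}
    (h : ∀ (U : X.Opens) (s : Γ(M, U)) (t : Γ(N, U)),
      φ.app U (tmul s t) = ψ.app U (tmul s t)) : φ = ψ := by
  refine modules_hom_ext fun U w => section_ext fun x hx => ?_
  obtain ⟨V, hV, hxV, z, hz⟩ := tensor_locally w x hx
  refine ⟨V, hV, hxV, ?_⟩
  rw [← app_rs, ← app_rs, hz]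
  clear hz
  induction z with
  | zero => simp
  | tmul s t => exact h V s t
  | add a b ha hb => simp only [map_add, ha, hb]

lemma tensorMap_tmul {M M' N N' : X.Modules} (φ : M ⟶ M') (ψ : N ⟶ N') {U : X.Opens}
    (s : Γ(M, U)) (t : Γ(N, U)) :
    (tensorMap φ ψ).app U (tmul s t) = tmul (φ.app U s) (ψ.app U t) := by
  have h1 := (PresheafOfModules.sheafificationAdjunction
    (𝟙 X.ringCatSheaf.obj)).unit.naturality (preTensorMap φ ψ)
  have h2 := congr(($h1).app (.op U))
  exact (ConcreteCategory.congr_hom h2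
    (s ⊗ₜ[Γ(X, U)] t : Γ(M, U) ⊗[Γ(X, U)] Γ(N, U))).symm

end Tensor

/-! ### Generators of line bundles -/

section Generators

variable {X : Scheme.{u}}

lemma toRing_rs {V U : X.Opens} (h : V ≤ U) (a : Γ(structureSheaf X, U)) :
    toRing (rs _ h a) = ro X h (toRing a) := rfl

lemma toRing_smul {U : X.Opens} (a : Γ(X, U)) (b : Γ(structureSheaf X, U)) :
    toRing (a • b) = a * toRing b := rfl

lemma toRing_add {U : X.Opens} (a b : Γ(structureSheaf X, U)) :
    toRing (a + b) = toRing a + toRing b := rfl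

/-- `s` is a nowhere vanishing section generating the sheaf of modules `L` over `U`: the map
`𝒪|_U ⟶ L|_U` given by `s` is bijective on sections. -/
def IsGen {L : X.Modules} {U : X.Opens} (s : Γ(L, U)) : Prop :=
  ∀ V (h : V ≤ U), Function.Bijective fun a : Γ(X, V) => a • rs L h s

lemma IsGen.rs {L : X.Modules} {U V : X.Opens} {s : Γ(L, U)} (hs : IsGen s) (h : V ≤ U) :
    IsGen (rs L h s) := fun W hW => by
  simpa only [rs_rs] using hs W (hW.trans h)

lemma IsGen.exists_eq {L : X.Modules} {U : X.Opens} {s : Γ(L, U)} (hs : IsGen s)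
    (t : Γ(L, U)) : ∃ a : Γ(X, U), t = a • s := by
  obtain ⟨a, ha⟩ := (hs U le_rfl).2 t
  exact ⟨a, by simpa using ha.symm⟩

lemma IsGen.inj {L : X.Modules} {U : X.Opens} {s : Γ(L, U)} (hs : IsGen s)
    {a b : Γ(X, U)} (h : a • s = b • s) : a = b :=
  (hs U le_rfl).1 (by simpa using h)

lemma isUnit_ro {U V : X.Opens} (h : V ≤ U) {a : Γ(X, U)} (ha : IsUnit a) : IsUnit (ro X h a) :=
  ha.map (ro X h)

lemma IsGen.smul {L : X.Modules} {U : X.Opens} {s : Γ(L, U)} (hs : IsGen s)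
    {c : Γ(X, U)} (hc : IsUnit c) : IsGen (c • s) := fun V h => by
  have h1 : (fun a : Γ(X, V) => a • DoubleCover.rs L h (c • s)) =
      (fun a => a • DoubleCover.rs L h s) ∘ fun a => a * ro X h c := by
    ext a; simp [mul_smul]
  rw [h1]
  exact (hs V h).comp (isUnit_ro h hc).unit.mulRight_bijective

lemma IsGen.exists_unit {L : X.Modules} {U : X.Opens} {s t : Γ(L, U)} (hs : IsGen s)
    (ht : IsGen t) : ∃ a : Γ(X, U), IsUnit a ∧ t = a • s := by
  obtain ⟨a, ha⟩ := hs.exists_eq t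
  obtain ⟨b, hb⟩ := ht.exists_eq s
  refine ⟨a, IsUnit.of_mul_eq_one b (hs.inj (b := 1) ?_), ha⟩
  rw [mul_comm, mul_smul, ← ha, ← hb, one_smul]

/-- Generators can be recognized locally. -/
lemma isGen_of_locally {L : X.Modules} {U : X.Opens} (s : Γ(L, U))
    (h : ∀ x ∈ U, ∃ (V : X.Opens) (hV : V ≤ U), x ∈ V ∧ IsGen (rs L hV s)) : IsGen s := by
  intro V hV
  refine bijective_of_basis (M := structureSheaf X) (N := L) (U := U)
    (P := fun V => ∀ h : V ≤ U, IsGen (rs L h s)) ?_ (fun V hV a => toRing a • rs L hV s)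
    ?_ ?_ V hV
  · intro x hx W hW
    obtain ⟨V, hV, hxV, hs⟩ := h x hx
    refine ⟨V ⊓ W, inf_le_right, ⟨hxV, hW⟩, inf_le_left.trans hV, fun h => ?_⟩
    have := hs.rs (V := V ⊓ W) inf_le_left
    rwa [rs_rs] at this
  · intro V W hV h a
    simp [toRing_rs]
  · intro V hV pV
    have := pV hV V le_rfl
    simp only [rs_rs] at this
    exact this

/-- Scalar multiplication on `L|_U` is the one on `L`, with the sections of `𝒪_U` over `V` read as
sections of `𝒪_X` over the image of `V`; all identifications are definitional. -/
lemma restrict_smul (L : X.Modules) (U : X.Opens) {V : U.toScheme.Opens}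
    (a : Γ(U.toScheme, V)) (x : Γ(L.restrict U.ι, V)) :
    a • x = ((show Γ(X, U.ι ''ᵁ V) from a) • (show Γ(L, U.ι ''ᵁ V) from x) : Γ(L, U.ι ''ᵁ V)) := by
  have h : a • x = (((U.ι.appIso V).inv a : Γ(X, U.ι ''ᵁ V)) •
    (show Γ(L, U.ι ''ᵁ V) from x) : Γ(L, U.ι ''ᵁ V)) := rfl
  rw [h, Scheme.Opens.ι_appIso]
  rfl

/-- The image of `1` under a local trivialization is a generator, and stays one on smaller open
sets. -/
lemma IsLineBundle.isBasisOf {L : X.Modules} (hL : IsLineBundle L) :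
    IsBasisOf fun V : X.Opens => ∃ s : Γ(L, V), IsGen s := by
  intro U x hx
  obtain ⟨W, hxW, ⟨e⟩⟩ := hL x
  let W' : X.Opens := W.ι ''ᵁ ⊤
  have hW' : x ∈ W' := ⟨⟨x, hxW⟩, trivial, rfl⟩
  let s : Γ(L, W') := (L.restrictAppIso W.ι ⊤).hom (e.inv.app ⊤ (ofRing 1))
  have hs : IsGen s := by
    intro V hV
    obtain ⟨V', rfl⟩ : ∃ V' : W.toScheme.Opens, V = W.ι ''ᵁ V' := by
      refine ⟨W.ι ⁻¹ᵁ V, ?_⟩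
      rw [Scheme.Hom.image_preimage_eq_opensRange_inf, inf_eq_right.mpr]
      exact hV.trans (W.ι.image_le_opensRange ⊤)
    have h1 := bijective_of_isIso e.inv V'
    have h2 : rs L hV s = e.inv.app V' (ofRing 1) :=
      (app_rs e.inv (le_top : V' ≤ ⊤) (ofRing 1)).symm.trans
        (congrArg (e.inv.app V') (map_one (ro W.toScheme (le_top : V' ≤ ⊤))))
    have h3 (a : Γ(W.toScheme, V')) : e.inv.app V' (ofRing a) =
        (show Γ(X, W.ι ''ᵁ V') from a) • rs L hV s := by
      rw [h2]
      refine Eq.trans ?_ ((e.inv.app_smul (U := V') a (ofRing 1)).trans (restrict_smul L W a _))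
      exact congrArg (e.inv.app V') (mul_one a).symm
    have h4 : (fun a : Γ(X, W.ι ''ᵁ V') => a • rs L hV s) = e.inv.app V' :=
      funext fun a => (h3 a).symm
    rw [h4]
    exact h1
  exact ⟨U ⊓ W', inf_le_left, ⟨hx, hW'⟩, _, hs.rs inf_le_right⟩

/-- A sheaf of modules with generators locally is a line bundle. -/
lemma isLineBundle_of_isGen {L : X.Modules}
    (h : ∀ x : X, ∃ (V : X.Opens), x ∈ V ∧ ∃ s : Γ(L, V), IsGen s) : IsLineBundle L := by
  intro x
  obtain ⟨U, hx, s, hs⟩ := h x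
  have hle (V : U.toScheme.Opens) : U.ι ''ᵁ V ≤ U :=
    (U.ι.image_le_opensRange V).trans U.opensRange_ι.le
  let φ : structureSheaf U ⟶ L.restrict U.ι := mkHom
    (fun V =>
      { toFun := fun a => (show Γ(X, U.ι ''ᵁ V) from a) • rs L (hle V) s
        map_add' := fun a b => by
          exact add_smul (show Γ(X, U.ι ''ᵁ V) from a) (show Γ(X, U.ι ''ᵁ V) from b)
            (rs L (hle V) s)
        map_smul' := fun a b => (mul_smul (show Γ(X, U.ι ''ᵁ V) from a)
          (show Γ(X, U.ι ''ᵁ V) from b) (rs L (hle V) s)).trans (restrict_smul L U a _).symm })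
    (fun V W h a => by
      have := rs_smul L (U.ι.image_mono h) (show Γ(X, U.ι ''ᵁ V) from a) (rs L (hle V) s)
      rw [rs_rs] at this
      exact this.symm)
  have : IsIso φ := isIso_of_bijective φ fun V => hs _ (hle V)
  exact ⟨U, hx, ⟨(asIso φ).symm⟩⟩

end Generators

/-! ### The pairing of a `2`-torsion line bundle -/

namespace TorsionBundle

variable {Y : Scheme.{u}} (L : TorsionBundle Y)

lemma pair_add_left {U : Y.Opens} (s s' t : Γ(L.L, U)) :
    L.pair (s + s') t = L.pair s t + L.pair s' t := by
  rw [pair, tmul_add_left, map_add]; rfl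

lemma pair_add_right {U : Y.Opens} (s t t' : Γ(L.L, U)) :
    L.pair s (t + t') = L.pair s t + L.pair s t' := by
  rw [pair, tmul_add_right, map_add]; rfl

lemma pair_smul_left {U : Y.Opens} (a : Γ(Y, U)) (s t : Γ(L.L, U)) :
    L.pair (a • s) t = a * L.pair s t := by
  rw [pair, tmul_smul_left, Scheme.Modules.Hom.app_smul]; rfl

lemma pair_smul_right {U : Y.Opens} (a : Γ(Y, U)) (s t : Γ(L.L, U)) :
    L.pair s (a • t) = a * L.pair s t := by
  rw [pair, tmul_smul_right, Scheme.Modules.Hom.app_smul]; rfl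

lemma pair_rs {V U : Y.Opens} (h : V ≤ U) (s t : Γ(L.L, U)) :
    L.pair (rs _ h s) (rs _ h t) = ro Y h (L.pair s t) := by
  rw [pair, ← rs_tmul, app_rs]; rfl

lemma exists_isGen (x : Y) (U : Y.Opens) (hx : x ∈ U) :
    ∃ V ≤ U, x ∈ V ∧ ∃ s : Γ(L.L, V), IsGen s :=
  L.isLineBundle.isBasisOf U x hx

/-- Elementary tensors of a generator generate the tensor square, which `i` identifies with
`𝒪`. -/
lemma isUnit_pair {U : Y.Opens} {s : Γ(L.L, U)} (hs : IsGen s) : IsUnit (L.pair s s) := by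
  refine isUnit_of_locally fun x hx => ?_
  let w : Γ(tensor L.L L.L, U) := L.i.inv.app U (ofRing 1)
  have hw : toRing (L.i.hom.app U w) = 1 := by
    have : L.i.hom.app U (L.i.inv.app U (ofRing 1)) = (L.i.inv ≫ L.i.hom).app U (ofRing 1) := rfl
    rw [this, Iso.inv_hom_id]; rfl
  obtain ⟨V, hV, hxV, z, hz⟩ := tensor_locally w x hx
  refine ⟨V, hV, hxV, ?_⟩
  have key : ∀ z, L.pair (rs _ hV s) (rs _ hV s) ∣
      toRing (L.i.hom.app V (tensorSections L.L L.L V z)) := by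
    intro z
    induction z with
    | zero => simp only [map_zero]; exact dvd_zero _
    | tmul a b =>
      obtain ⟨a, rfl⟩ := (hs.rs hV).exists_eq a
      obtain ⟨b, rfl⟩ := (hs.rs hV).exists_eq b
      change _ ∣ L.pair _ _
      rw [pair_smul_left, pair_smul_right]
      exact ⟨a * b, by ring⟩
    | add a b ha hb =>
      rw [map_add, map_add, toRing_add]
      exact dvd_add ha hb
  have := key z
  rw [← hz, app_rs, toRing_rs, hw, map_one, pair_rs] at this
  exact isUnit_of_dvd_one this

/-- Locally `t = c s` with `s` a generator, and `⟨t, t⟩ = c² ⟨s, s⟩` is a unit only if `c` is. -/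
lemma isGen_of_isUnit_pair {U : Y.Opens} {t : Γ(L.L, U)} (ht : IsUnit (L.pair t t)) :
    IsGen t := by
  refine isGen_of_locally t fun x hx => ?_
  obtain ⟨V, hV, hxV, s, hs⟩ := L.exists_isGen x U hx
  refine ⟨V, hV, hxV, ?_⟩
  obtain ⟨c, hc⟩ := hs.exists_eq (rs _ hV t)
  have h1 := isUnit_ro hV ht
  rw [← pair_rs, hc, pair_smul_left] at h1
  rw [hc]
  exact hs.smul (isUnit_of_mul_isUnit_left h1)

lemma pair_comm {U : Y.Opens} (s t : Γ(L.L, U)) : L.pair s t = L.pair t s := by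
  refine function_ext fun x hx => ?_
  obtain ⟨V, hV, hxV, r, hr⟩ := L.exists_isGen x U hx
  refine ⟨V, hV, hxV, ?_⟩
  obtain ⟨a, ha⟩ := hr.exists_eq (rs _ hV s)
  obtain ⟨b, hb⟩ := hr.exists_eq (rs _ hV t)
  rw [← pair_rs, ← pair_rs, ha, hb]
  simp only [pair_smul_left, pair_smul_right]
  ring

/-- Associativity of the multiplication of `𝒪 ⊕ L`, which holds since `L` has rank one. -/
lemma pair_smul_comm {U : Y.Opens} (r s t : Γ(L.L, U)) : L.pair r s • t = L.pair s t • r := by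
  refine section_ext fun x hx => ?_
  obtain ⟨V, hV, hxV, g, hg⟩ := L.exists_isGen x U hx
  refine ⟨V, hV, hxV, ?_⟩
  obtain ⟨a, ha⟩ := hg.exists_eq (rs _ hV r)
  obtain ⟨b, hb⟩ := hg.exists_eq (rs _ hV s)
  obtain ⟨c, hc⟩ := hg.exists_eq (rs _ hV t)
  rw [rs_smul, rs_smul, ← pair_rs, ← pair_rs, ha, hb, hc]
  simp only [pair_smul_left, pair_smul_right, smul_smul]
  congr 1
  ring

/-- An isomorphism of line bundles is an isomorphism of `2`-torsion line bundles if it preserves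
the pairings. -/
lemma isIsomorphic_of_pair {L L' : TorsionBundle Y} (ι : L.L ≅ L'.L)
    (h : ∀ (U : Y.Opens) (s t : Γ(L.L, U)),
      L'.pair (ι.hom.app U s) (ι.hom.app U t) = L.pair s t) : L.IsIsomorphic L' :=
  ⟨ι, tensor_hom_ext fun U s t => by
    rw [Scheme.Modules.Hom.comp_app, ConcreteCategory.comp_apply, tensorMap_tmul]
    exact h U s t⟩

lemma IsIsomorphic.exists_pair {L L' : TorsionBundle Y} (h : L.IsIsomorphic L') :
    ∃ ι : L.L ≅ L'.L, ∀ (U : Y.Opens) (s t : Γ(L.L, U)),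
      L'.pair (ι.hom.app U s) (ι.hom.app U t) = L.pair s t := by
  obtain ⟨ι, h⟩ := h
  refine ⟨ι, fun U s t => ?_⟩
  rw [pair, pair, ← h, Scheme.Modules.Hom.comp_app, ConcreteCategory.comp_apply, tensorMap_tmul]

/-- A line bundle with a bilinear pairing to `𝒪` that is invertible on local generators underlies
a `2`-torsion line bundle. -/
lemma exists_of_pairing {M : Y.Modules} (hM : IsLineBundle M)
    (β : ∀ U : Y.Opens, Γ(M, U) →ₗ[Γ(Y, U)] Γ(M, U) →ₗ[Γ(Y, U)] Γ(structureSheaf Y, U))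
    (hβ : ∀ (U V : Y.Opens) (h : V ≤ U) (s : Γ(M, U)) (t : Γ(M, U)),
      β V (rs M h s) (rs M h t) = rs _ h (β U s t))
    (hu : ∀ (U : Y.Opens) (s : Γ(M, U)), IsGen s → IsUnit (toRing (β U s s))) :
    ∃ i : tensor M M ≅ structureSheaf Y, ∀ (U : Y.Opens) (s t : Γ(M, U)),
      (TorsionBundle.mk M hM i).pair s t = toRing (β U s t) := by
  obtain ⟨φ, hφ⟩ := exists_tensor_desc β hβ
  -- over an open set with a generator `s`, tensors are locally multiples of `s ⊗ s`
  have loc : ∀ (U : Y.Opens) (s : Γ(M, U)), IsGen s → ∀ z, ∃ c : Γ(Y, U),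
      tensorSections M M U z = c • tmul s s := by
    intro U s hs z
    induction z with
    | zero => exact ⟨0, by simp⟩
    | tmul a b =>
      obtain ⟨a, rfl⟩ := hs.exists_eq a
      obtain ⟨b, rfl⟩ := hs.exists_eq b
      exact ⟨a * b, by rw [tensorSections_tmul, tmul_smul_left, tmul_smul_right, smul_smul]⟩
    | add a b ha hb =>
      obtain ⟨c, hc⟩ := ha
      obtain ⟨d, hd⟩ := hb
      exact ⟨c + d, by rw [map_add, hc, hd, add_smul]⟩
  have : IsIso φ := by
    refine isIso_of_basis φ hM.isBasisOf fun U ⟨s, hs⟩ => ⟨?_, fun b => ?_⟩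
    · refine (injective_iff_map_eq_zero (φ.app U).hom).mpr fun w hw => ?_
      refine section_ext fun x hx => ?_
      obtain ⟨V, hV, hxV, z, hz⟩ := tensor_locally w x hx
      refine ⟨V, hV, hxV, ?_⟩
      obtain ⟨c, hc⟩ := loc V _ (hs.rs hV) z
      have h1 : φ.app V (rs _ hV w) = 0 := by
        rw [app_rs]
        exact (congrArg _ hw).trans (map_zero _)
      rw [hz, hc, Scheme.Modules.Hom.app_smul, hφ] at h1
      have h2 : c * toRing (β V (rs M hV s) (rs M hV s)) = 0 := h1
      rw [(hu V _ (hs.rs hV)).mul_left_eq_zero] at h2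
      rw [hz, hc, h2, zero_smul, map_zero]
    · obtain ⟨d, hd⟩ := (hu U s hs).exists_left_inv
      refine ⟨(toRing b * d) • tmul s s, ?_⟩
      rw [Scheme.Modules.Hom.app_smul, hφ]
      change toRing b * d * toRing (β U s s) = toRing b
      rw [mul_assoc, hd, mul_one]
  refine ⟨asIso φ, fun U s t => ?_⟩
  exact congrArg toRing (hφ U s t)

end TorsionBundle

/-! ### Morphisms into an affine `Y`-scheme -/

section AffineHom

variable {X Y T : Scheme.{u}}

/-- Morphisms on the members of an open cover glue if they agree on a cover of each intersection
by members of the cover. -/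
lemma exists_glue_of_opens {ι : Type u} (V : ι → T.Opens) (hV : ∀ x : T, ∃ i, x ∈ V i)
    (k : ∀ i, (V i).toScheme ⟶ X)
    (hk : ∀ i j (x : T), x ∈ V i → x ∈ V j → ∃ l, x ∈ V l ∧ ∃ (hi : V l ≤ V i) (hj : V l ≤ V j),
      T.homOfLE hi ≫ k i = T.homOfLE hj ≫ k j) :
    ∃ h : T ⟶ X, ∀ i, (V i).ι ≫ h = k i := by
  have hcov : TopologicalSpace.IsOpenCover V :=
    top_unique fun x _ => TopologicalSpace.Opens.mem_iSup.mpr (hV x)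
  have compat (i j : ι) :
      pullback.fst (V i).ι (V j).ι ≫ k i = pullback.snd (V i).ι (V j).ι ≫ k j := by
    let p := pullback.fst (V i).ι (V j).ι ≫ (V i).ι
    have hp (z : ↑(pullback (V i).ι (V j).ι)) : ∃ l, p z ∈ V l ∧
        ∃ (hi : V l ≤ V i) (hj : V l ≤ V j), T.homOfLE hi ≫ k i = T.homOfLE hj ≫ k j := by
      refine hk i j (p z) ?_ ?_
      · exact (pullback.fst (V i).ι (V j).ι z).2
      · dsimp only [p]
        rw [pullback.condition]
        exact (pullback.snd (V i).ι (V j).ι z).2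
    choose l hl hi hj hij using hp
    refine Scheme.Cover.hom_ext ((pullback (V i).ι (V j).ι).openCoverOfIsOpenCover
      (fun z => p ⁻¹ᵁ V (l z)) ?_) _ _ fun z => ?_
    · exact top_unique fun z _ => TopologicalSpace.Opens.mem_iSup.mpr ⟨z, hl z⟩
    · have key (z : ↑(pullback (V i).ι (V j).ι)) :
          (p ⁻¹ᵁ V (l z)).ι ≫ pullback.fst (V i).ι (V j).ι ≫ k i =
            (p ⁻¹ᵁ V (l z)).ι ≫ pullback.snd (V i).ι (V j).ι ≫ k j := by
        have h1 : (p ⁻¹ᵁ V (l z)).ι ≫ pullback.fst (V i).ι (V j).ι =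
            (p ∣_ V (l z)) ≫ T.homOfLE (hi z) := by
          rw [← cancel_mono (V i).ι, Category.assoc, Category.assoc, Scheme.homOfLE_ι,
            morphismRestrict_ι]
        have h2 : (p ⁻¹ᵁ V (l z)).ι ≫ pullback.snd (V i).ι (V j).ι =
            (p ∣_ V (l z)) ≫ T.homOfLE (hj z) := by
          rw [← cancel_mono (V j).ι, Category.assoc, Category.assoc, Scheme.homOfLE_ι,
            morphismRestrict_ι, ← pullback.condition]
        rw [reassoc_of% h1, reassoc_of% h2, hij]
      exact key z
  exact ⟨(T.openCoverOfIsOpenCover V hcov).glueMorphisms k compat,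
    fun i => (T.openCoverOfIsOpenCover V hcov).ι_glueMorphisms k compat i⟩

lemma toSpecΓ_map_injective (U : T.Opens) {R : CommRingCat.{u}} {a b : R ⟶ Γ(T, U)}
    (h : U.toSpecΓ ≫ Spec.map a = U.toSpecΓ ≫ Spec.map b) : a = b := by
  have h1 := congr($(h).appTop)
  simp only [Scheme.Hom.comp_appTop, Scheme.Opens.toSpecΓ_appTop, ← Category.assoc,
    cancel_mono] at h1
  exact Spec.map_injective (ext_of_isAffine h1)

/-- A morphism mapping `V` into the affine open set `U` is recovered on `V` from its effect on
functions on `U`. -/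
lemma toSpecΓ_map_appLE_fromSpec (h : T ⟶ X) {U : X.Opens} (hU : IsAffineOpen U) (V : T.Opens)
    (e : V ≤ h ⁻¹ᵁ U) :
    V.toSpecΓ ≫ Spec.map (h.appLE U V e) ≫ hU.fromSpec = V.ι ≫ h := by
  rw [Scheme.Opens.toSpecΓ_SpecMap_appLE_assoc, hU.toSpecΓ_fromSpec, Scheme.Hom.resLE_comp_ι]

/-- Morphisms over `Y` to a scheme affine over `Y` agree if they agree on the functions on the
preimages of sufficiently many affine open sets. -/
lemma hom_ext_of_affine {f : X ⟶ Y} [IsAffineHom f] {g : T ⟶ Y} {h h' : T ⟶ X}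
    (H : ∀ x : T, ∃ (U : Y.Opens) (e : g ⁻¹ᵁ U ≤ h ⁻¹ᵁ f ⁻¹ᵁ U) (e' : g ⁻¹ᵁ U ≤ h' ⁻¹ᵁ f ⁻¹ᵁ U),
      IsAffineOpen U ∧ g x ∈ U ∧
      h.appLE (f ⁻¹ᵁ U) (g ⁻¹ᵁ U) e = h'.appLE (f ⁻¹ᵁ U) (g ⁻¹ᵁ U) e') : h = h' := by
  choose U e e' hU hx he using H
  refine Scheme.Cover.hom_ext (T.openCoverOfIsOpenCover (fun x => g ⁻¹ᵁ U x) ?_) _ _ fun x => ?_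
  · exact top_unique fun x _ => TopologicalSpace.Opens.mem_iSup.mpr ⟨x, hx x⟩
  · have key (x : T) : (g ⁻¹ᵁ U x).ι ≫ h = (g ⁻¹ᵁ U x).ι ≫ h' := by
      rw [← toSpecΓ_map_appLE_fromSpec h ((hU x).preimage f) _ (e x), he,
        toSpecΓ_map_appLE_fromSpec]
    exact key x

/-- Compatible ring homomorphisms `Γ(X, f⁻¹ U) ⟶ Γ(T, g⁻¹ U)` under `Γ(Y, U)` come from a
morphism `T ⟶ X` over `Y` if `f : X ⟶ Y` is affine. -/
lemma exists_hom_of_affine (f : X ⟶ Y) [IsAffineHom f] (g : T ⟶ Y)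
    (ρ : ∀ U : Y.Opens, IsAffineOpen U → (Γ(X, f ⁻¹ᵁ U) ⟶ Γ(T, g ⁻¹ᵁ U)))
    (hρ : ∀ (U V : Y.Opens) (hU : IsAffineOpen U) (hV : IsAffineOpen V) (i : U ⟶ V),
      X.presheaf.map ((TopologicalSpace.Opens.map f.base).map i).op ≫ ρ U hU =
        ρ V hV ≫ T.presheaf.map ((TopologicalSpace.Opens.map g.base).map i).op)
    (hf : ∀ U hU, f.app U ≫ ρ U hU = g.app U) :
    ∃ h : T ⟶ X, h ≫ f = g ∧ ∀ (U : Y.Opens) (hU : IsAffineOpen U)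
      (e : g ⁻¹ᵁ U ≤ h ⁻¹ᵁ f ⁻¹ᵁ U), h.appLE (f ⁻¹ᵁ U) (g ⁻¹ᵁ U) e = ρ U hU := by
  let k (U : Y.Opens) (hU : IsAffineOpen U) : (g ⁻¹ᵁ U).toScheme ⟶ X :=
    (g ⁻¹ᵁ U).toSpecΓ ≫ Spec.map (ρ U hU) ≫ (hU.preimage f).fromSpec
  have hk {U V : Y.Opens} (hU : IsAffineOpen U) (hV : IsAffineOpen V) (i : U ≤ V) :
      T.homOfLE (g.preimage_mono i) ≫ k V hV = k U hU := by
    have h1 := (hV.preimage f).map_fromSpec (hU.preimage f)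
      ((TopologicalSpace.Opens.map f.base).map (homOfLE i)).op
    have h2 := hρ U V hU hV (homOfLE i)
    have h3 := Scheme.Opens.toSpecΓ_SpecMap_presheaf_map (g ⁻¹ᵁ U) (g ⁻¹ᵁ V) (g.preimage_mono i)
    dsimp only [k]
    rw [← reassoc_of% h3, ← h1, ← Spec.map_comp_assoc, ← Spec.map_comp_assoc]
    exact congr(_ ≫ Spec.map $(h2.symm) ≫ _)
  have hcov (x : T) : ∃ U : Y.affineOpens, g x ∈ U.1 := by
    obtain ⟨U, hU⟩ := TopologicalSpace.Opens.mem_iSup.mp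
      ((iSup_affineOpens_eq_top Y).ge (Set.mem_univ (g x)))
    exact ⟨U, hU⟩
  obtain ⟨h, hh'⟩ := exists_glue_of_opens (fun U : Y.affineOpens => g ⁻¹ᵁ U.1) hcov
    (fun U => k U.1 U.2) (fun U V x hU hV => by
      obtain ⟨_, ⟨W, hW, rfl⟩, hxW, hWU⟩ := Y.isBasis_affineOpens.exists_subset_of_mem_open
        (show g x ∈ U.1 ⊓ V.1 from ⟨hU, hV⟩) (U.1 ⊓ V.1).2
      have hWU' : W ≤ U.1 := fun y hy => (hWU hy).1
      have hWV' : W ≤ V.1 := fun y hy => (hWU hy).2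
      exact ⟨⟨W, hW⟩, hxW, g.preimage_mono hWU', g.preimage_mono hWV',
        (hk hW U.2 hWU').trans (hk hW V.2 hWV').symm⟩)
  have hh (U : Y.Opens) (hU : IsAffineOpen U) : (g ⁻¹ᵁ U).ι ≫ h = k U hU := hh' ⟨U, hU⟩
  refine ⟨h, ?_, fun U hU e => ?_⟩
  · refine Scheme.Cover.hom_ext (T.openCoverOfIsOpenCover (fun U : Y.affineOpens => g ⁻¹ᵁ U.1) ?_)
      _ _ fun U => ?_
    · exact top_unique fun x _ => TopologicalSpace.Opens.mem_iSup.mpr (hcov x)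
    · have key (U : Y.Opens) (hU : IsAffineOpen U) :
          (g ⁻¹ᵁ U).ι ≫ h ≫ f = (g ⁻¹ᵁ U).ι ≫ g := by
        have h1 := hU.SpecMap_appLE_fromSpec f (hU.preimage f) le_rfl
        have h2 := toSpecΓ_map_appLE_fromSpec g hU (g ⁻¹ᵁ U) le_rfl
        rw [← Category.assoc, hh U hU, ← h2, Category.assoc, Category.assoc, ← h1,
          ← Spec.map_comp_assoc, ← Scheme.Hom.app_eq_appLE, ← Scheme.Hom.app_eq_appLE, hf]
      exact key U.1 U.2
  · apply toSpecΓ_map_injective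
    rw [← cancel_mono (hU.preimage f).fromSpec, Category.assoc, Category.assoc,
      toSpecΓ_map_appLE_fromSpec, hh U hU]

end AffineHom

/-! ### The relative spectrum in terms of a map `L ⟶ f_* 𝒪_X` -/

section Value

variable {X Y : Scheme.{u}} {f : X ⟶ Y} {M : Y.Modules}

/-- The function on `f⁻¹ U` that a morphism `M ⟶ f_* 𝒪_X` assigns to a section of `M` over `U`. -/
def value (μ : M ⟶ pushforwardStructureSheaf f) {U : Y.Opens} (s : Γ(M, U)) : Γ(X, f ⁻¹ᵁ U) :=
  pushforwardToRing f (μ.app U s)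

variable (μ : M ⟶ pushforwardStructureSheaf f)

@[simp] lemma value_add {U : Y.Opens} (s t : Γ(M, U)) : value μ (s + t) = value μ s + value μ t :=
  congrArg (pushforwardToRing f) (map_add (μ.app U).hom s t)

@[simp] lemma value_zero {U : Y.Opens} : value μ (0 : Γ(M, U)) = 0 :=
  congrArg (pushforwardToRing f) (map_zero (μ.app U).hom)

@[simp] lemma value_smul {U : Y.Opens} (a : Γ(Y, U)) (s : Γ(M, U)) :
    value μ (a • s) = f.app U a * value μ s :=
  congrArg (pushforwardToRing f) (μ.app_smul a s)

lemma app_ro (f : X ⟶ Y) {V U : Y.Opens} (h : V ≤ U) (a : Γ(Y, U)) :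
    f.app V (ro Y h a) = ro X (f.preimage_mono h) (f.app U a) :=
  ConcreteCategory.congr_hom (f.naturality (homOfLE h).op) a

lemma value_rs {V U : Y.Opens} (h : V ≤ U) (s : Γ(M, U)) :
    value μ (rs M h s) = ro X (f.preimage_mono h) (value μ s) :=
  congrArg (pushforwardToRing f) (app_rs μ h s)

lemma value_comp {N : Y.Modules} (φ : N ⟶ M) {U : Y.Opens} (s : Γ(N, U)) :
    value (φ ≫ μ) s = value μ (φ.app U s) := rfl

/-- A morphism `M ⟶ f_* 𝒪_X` given by compatible semilinear maps to functions. -/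
lemma exists_value {P : Y.Opens → Prop} (hP : IsBasisOf P) (f : X ⟶ Y)
    (φ : ∀ U : Y.Opens, P U → Γ(M, U) → Γ(X, f ⁻¹ᵁ U))
    (hadd : ∀ U hU s t, φ U hU (s + t) = φ U hU s + φ U hU t)
    (hsmul : ∀ U hU (a : Γ(Y, U)) s, φ U hU (a • s) = f.app U a * φ U hU s)
    (hrs : ∀ (U V : Y.Opens) (hU : P U) (hV : P V) (h : V ≤ U) s,
      φ V hV (rs M h s) = ro X (f.preimage_mono h) (φ U hU s)) :
    ∃ μ : M ⟶ pushforwardStructureSheaf f, ∀ U hU s, value μ s = φ U hU s :=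
  exists_hom_of_basis (N := pushforwardStructureSheaf f) hP (fun U hU =>
    { toFun := φ U hU, map_add' := hadd U hU, map_smul' := hsmul U hU }) hrs

/-- The structure map `𝒪_Y ⟶ f_* 𝒪_X`. -/
def unitHom (f : X ⟶ Y) : structureSheaf Y ⟶ pushforwardStructureSheaf f :=
  mkHom (N := pushforwardStructureSheaf f) (fun U =>
    { toFun := fun a => f.app U (toRing a)
      map_add' := fun a b => map_add (f.app U).hom (toRing a) (toRing b)
      map_smul' := fun a b => map_mul (f.app U).hom a (toRing b) })
    fun _ _ h a => app_ro f h (toRing a)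

lemma value_unitHom {U : Y.Opens} (a : Γ(Y, U)) : value (unitHom f) (ofRing a) = f.app U a := rfl

end Value

section TwistedSum

variable {X Y : Scheme.{u}} {f : X ⟶ Y} {L : TorsionBundle Y}

/-- A morphism `lam : L ⟶ f_* 𝒪_X` exhibits `f_* 𝒪_X` as the `𝒪_Y`-algebra `𝒪_Y ⊕ L`: it is
multiplicative for the pairing of `L`, and together with the structure map it is an isomorphism. -/
structure IsTwistedSum (lam : L.L ⟶ pushforwardStructureSheaf f) : Prop where
  mul : ∀ (U : Y.Opens) (s t : Γ(L.L, U)), value lam s * value lam t = f.app U (L.pair s t)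
  bij : ∀ U : Y.Opens, Function.Bijective
    fun p : Γ(Y, U) × Γ(L.L, U) => f.app U p.1 + value lam p.2

/-- `(a, s)` runs through the sections of the biproduct `𝒪_Y ⊕ L`, which is only given by its
universal property. -/
lemma algebraSection_bijective (L : TorsionBundle Y) (U : Y.Opens) :
    Function.Bijective fun p : Γ(Y, U) × Γ(L.L, U) => algebraSection L p.1 p.2 := by
  have fst (p : Γ(Y, U) × Γ(L.L, U)) :
      (biprod.fst : structureSheaf Y ⊞ L.L ⟶ _).app U (algebraSection L p.1 p.2) = ofRing p.1 := by
    have h1 : (biprod.inl ≫ (biprod.fst : structureSheaf Y ⊞ L.L ⟶ _)).app U (ofRing p.1) =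
        ofRing p.1 := by
      rw [BinaryBicone.inl_fst]; rfl
    have h2 : (biprod.inr ≫ biprod.fst : L.L ⟶ structureSheaf Y).app U p.2 = 0 := by
      rw [BinaryBicone.inr_fst]; rfl
    rw [algebraSection, map_add]
    exact (congrArg₂ (· + ·) h1 h2).trans (add_zero _)
  have snd (p : Γ(Y, U) × Γ(L.L, U)) :
      (biprod.snd : structureSheaf Y ⊞ L.L ⟶ _).app U (algebraSection L p.1 p.2) = p.2 := by
    have h1 : (biprod.inl ≫ biprod.snd : structureSheaf Y ⟶ L.L).app U (ofRing p.1) = 0 := by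
      rw [BinaryBicone.inl_snd]; rfl
    have h2 : (biprod.inr ≫ (biprod.snd : structureSheaf Y ⊞ L.L ⟶ _) : L.L ⟶ L.L).app U p.2 =
        p.2 := by
      rw [BinaryBicone.inr_snd]; rfl
    rw [algebraSection, map_add]
    exact (congrArg₂ (· + ·) h1 h2).trans (zero_add _)
  constructor
  · intro p q h
    exact Prod.ext ((fst p).symm.trans ((congrArg _ h).trans (fst q)))
      ((snd p).symm.trans ((congrArg _ h).trans (snd q)))
  · intro z
    refine ⟨(toRing ((biprod.fst : structureSheaf Y ⊞ L.L ⟶ _).app U z),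
      (biprod.snd : structureSheaf Y ⊞ L.L ⟶ _).app U z), ?_⟩
    have := biprod.total (X := structureSheaf Y) (Y := L.L)
    exact ConcreteCategory.congr_hom congr(($this).app U) z

lemma value_algebraSection (e : algebraSheaf L ⟶ pushforwardStructureSheaf f) {U : Y.Opens}
    (a : Γ(Y, U)) (s : Γ(L.L, U)) :
    value e (algebraSection L a s) =
      value (biprod.inl ≫ e) (ofRing a) + value (biprod.inr ≫ e) s := by
  exact value_add e ((biprod.inl : structureSheaf Y ⟶ structureSheaf Y ⊞ L.L).app U (ofRing a))
    ((biprod.inr : L.L ⟶ structureSheaf Y ⊞ L.L).app U s)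

/-- An isomorphism of algebras `𝒪_Y ⊕ L ≅ f_* 𝒪_X` amounts to its restriction to `L`: on `𝒪_Y` it
is forced to be the structure map. -/
lemma isRelSpec_iff : IsRelSpec L f ↔
    IsAffineHom f ∧ ∃ lam : L.L ⟶ pushforwardStructureSheaf f, IsTwistedSum lam := by
  refine and_congr_right fun _ => ⟨fun ⟨e, h1, hm⟩ => ?_, fun ⟨lam, h⟩ => ?_⟩
  · have hinl (U : Y.Opens) (a : Γ(Y, U)) : value (biprod.inl ≫ e.hom) (ofRing a) = f.app U a := by
      have h2 : value e.hom (algebraSection L (1 : Γ(Y, U)) 0) = 1 := h1 U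
      rw [value_algebraSection, value_zero, add_zero] at h2
      have h3 := value_smul (biprod.inl ≫ e.hom : structureSheaf Y ⟶ _) a (ofRing 1)
      rw [h2, mul_one] at h3
      rw [← h3]
      exact congrArg _ (mul_one a).symm
    have hval (U : Y.Opens) (a : Γ(Y, U)) (s : Γ(L.L, U)) :
        value e.hom (algebraSection L a s) = f.app U a + value (biprod.inr ≫ e.hom) s := by
      rw [value_algebraSection, hinl]
    refine ⟨biprod.inr ≫ e.hom, fun U s t => ?_, fun U => ?_⟩
    · have h2 : value e.hom (algebraSection L (0 * 0 + L.pair s t)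
          ((0 : Γ(Y, U)) • t + (0 : Γ(Y, U)) • s)) =
        value e.hom (algebraSection L 0 s) * value e.hom (algebraSection L 0 t) := hm U 0 0 s t
      simpa [hval] using h2.symm
    · have h2 := (bijective_of_isIso e.hom U).comp (algebraSection_bijective L U)
      have h3 : (fun p : Γ(Y, U) × Γ(L.L, U) => f.app U p.1 + value (biprod.inr ≫ e.hom) p.2) =
          (e.hom.app U ∘ fun p => algebraSection L p.1 p.2) := funext fun p => (hval U p.1 p.2).symm
      rw [h3]
      exact h2
  · let e : algebraSheaf L ⟶ pushforwardStructureSheaf f := biprod.desc (unitHom f) lam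
    have hval (U : Y.Opens) (a : Γ(Y, U)) (s : Γ(L.L, U)) :
        value e (algebraSection L a s) = f.app U a + value lam s := by
      rw [value_algebraSection, biprod.inl_desc, biprod.inr_desc, value_unitHom]
    have : IsIso e := isIso_of_bijective e fun U => by
      have h2 := h.bij U
      have h3 : (fun p : Γ(Y, U) × Γ(L.L, U) => f.app U p.1 + value lam p.2) =
          (e.app U ∘ fun p => algebraSection L p.1 p.2) := funext fun p => (hval U p.1 p.2).symm
      rw [h3] at h2
      exact (Function.Bijective.of_comp_iff _ (algebraSection_bijective L U)).mp h2
    refine ⟨asIso e, fun U => ?_, fun U a b s t => ?_⟩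
    · change value e _ = 1
      rw [hval, value_zero, add_zero, map_one]
    · change value e _ = value e _ * value e _
      rw [hval, hval, hval, map_add, ← h.mul, map_mul, value_add, value_smul, value_smul]
      ring

/-- A multiplicative map out of `L` is a twisted sum as soon as it is so over a basis. -/
lemma IsTwistedSum.of_basis {lam : L.L ⟶ pushforwardStructureSheaf f} {P : Y.Opens → Prop}
    (hP : IsBasisOf P)
    (mul : ∀ (U : Y.Opens), P U → ∀ s t : Γ(L.L, U),
      value lam s * value lam t = f.app U (L.pair s t))
    (bij : ∀ U : Y.Opens, P U → Function.Bijective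
      fun p : Γ(Y, U) × Γ(L.L, U) => f.app U p.1 + value lam p.2) : IsTwistedSum lam where
  mul U s t := by
    refine section_ext (M := pushforwardStructureSheaf f) (s := value lam s * value lam t)
      (t := f.app U (L.pair s t)) fun x hx => ?_
    obtain ⟨V, hV, hxV, pV⟩ := hP U x hx
    refine ⟨V, hV, hxV, ?_⟩
    have := mul V pV (rs _ hV s) (rs _ hV t)
    rw [TorsionBundle.pair_rs, value_rs, value_rs, app_ro, ← map_mul] at this
    exact this
  bij U := by
    let e : algebraSheaf L ⟶ pushforwardStructureSheaf f := biprod.desc (unitHom f) lam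
    have hval (U : Y.Opens) : (fun p : Γ(Y, U) × Γ(L.L, U) => f.app U p.1 + value lam p.2) =
        (e.app U ∘ fun p => algebraSection L p.1 p.2) := funext fun p => by
      refine Eq.trans ?_ (value_algebraSection e p.1 p.2).symm
      rw [biprod.inl_desc, biprod.inr_desc, value_unitHom]
    rw [hval]
    refine Function.Bijective.comp ?_ (algebraSection_bijective L U)
    refine bijective_of_basis (U := U) (hP.le U) (fun V _ => e.app V)
      (fun V W _ h x => app_rs _ h x)
      (fun V _ pV => ?_) U le_rfl
    have h2 := bij V pV
    rw [hval] at h2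
    exact (Function.Bijective.of_comp_iff _ (algebraSection_bijective L V)).mp h2

end TwistedSum

/-! ### The universal property of the relative spectrum -/

section Universal

variable {X Y T : Scheme.{u}} {f : X ⟶ Y} {L : TorsionBundle Y}
  {lam : L.L ⟶ pushforwardStructureSheaf f}

lemma le_preimage {k : T ⟶ X} {g : T ⟶ Y} (hk : k ≫ f = g) (U : Y.Opens) :
    g ⁻¹ᵁ U ≤ k ⁻¹ᵁ f ⁻¹ᵁ U := by
  rw [← hk]
  exact le_rfl

lemma appLE_app {k : T ⟶ X} {g : T ⟶ Y} (hk : k ≫ f = g) {U : Y.Opens}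
    (e : g ⁻¹ᵁ U ≤ k ⁻¹ᵁ f ⁻¹ᵁ U) (a : Γ(Y, U)) :
    k.appLE (f ⁻¹ᵁ U) (g ⁻¹ᵁ U) e (f.app U a) = g.app U a := by
  subst hk
  have := ConcreteCategory.congr_hom (Scheme.Hom.comp_app k f U) a
  rw [this, Scheme.Hom.app_eq_appLE k]
  rfl

lemma id_appLE_apply {U : X.Opens} (e : U ≤ 𝟙 X ⁻¹ᵁ U) (x : Γ(X, U)) :
    (𝟙 X : X ⟶ X).appLE U U e x = x := by
  have : (𝟙 X : X ⟶ X).appLE U U e = 𝟙 _ := by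
    rw [← Scheme.Hom.id_app, Scheme.Hom.app_eq_appLE]; rfl
  rw [this]; rfl

lemma appLE_comp_apply {X₁ X₂ X₃ : Scheme.{u}} (a : X₁ ⟶ X₂) (b : X₂ ⟶ X₃) {U V W} (e1 e2 e3)
    (x : Γ(X₃, U)) : (a ≫ b).appLE U W e3 x = a.appLE V W e1 (b.appLE U V e2 x) := by
  rw [← Scheme.Hom.appLE_comp_appLE _ _ _ _ _ e2 e1]; rfl

/-- A multiplicative map from `L` to functions on `T` extends to `𝒪 ⊕ L`. -/
lemma IsTwistedSum.exists_ringHom (hl : IsTwistedSum lam) {g : T ⟶ Y}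
    {μ : L.L ⟶ pushforwardStructureSheaf g}
    (hμ : ∀ (U : Y.Opens) (s t : Γ(L.L, U)), value μ s * value μ t = g.app U (L.pair s t))
    (U : Y.Opens) : ∃ ρ : Γ(X, f ⁻¹ᵁ U) →+* Γ(T, g ⁻¹ᵁ U), ∀ (a : Γ(Y, U)) (s : Γ(L.L, U)),
      ρ (f.app U a + value lam s) = g.app U a + value μ s := by
  let E := Equiv.ofBijective _ (hl.bij U)
  have hE (p : Γ(Y, U) × Γ(L.L, U)) : E p = f.app U p.1 + value lam p.2 := rfl
  let ρ : Γ(X, f ⁻¹ᵁ U) → Γ(T, g ⁻¹ᵁ U) := fun x => g.app U (E.symm x).1 + value μ (E.symm x).2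
  have hρ (a : Γ(Y, U)) (s : Γ(L.L, U)) : ρ (f.app U a + value lam s) = g.app U a + value μ s := by
    have h1 : E.symm (f.app U a + value lam s) = (a, s) :=
      (Equiv.symm_apply_eq E).mpr (hE (a, s)).symm
    simp only [ρ, h1]
  have hsurj (x : Γ(X, f ⁻¹ᵁ U)) :
      ∃ (a : Γ(Y, U)) (s : Γ(L.L, U)), x = f.app U a + value lam s := by
    obtain ⟨p, hp⟩ := (hl.bij U).2 x
    exact ⟨p.1, p.2, hp.symm⟩
  refine ⟨{ toFun := ρ, map_one' := ?_, map_mul' := ?_, map_zero' := ?_, map_add' := ?_ }, hρ⟩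
  · simpa using hρ 1 0
  · intro x y
    obtain ⟨a, s, rfl⟩ := hsurj x
    obtain ⟨b, t, rfl⟩ := hsurj y
    have h1 : (f.app U a + value lam s) * (f.app U b + value lam t) =
        f.app U (a * b + L.pair s t) + value lam (a • t + b • s) := by
      rw [map_add, ← hl.mul, map_mul, value_add, value_smul, value_smul]
      ring
    rw [h1, hρ, hρ, hρ, map_add, ← hμ, map_mul, value_add, value_smul, value_smul]
    ring
  · simpa using hρ 0 0
  · intro x y
    obtain ⟨a, s, rfl⟩ := hsurj x
    obtain ⟨b, t, rfl⟩ := hsurj y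
    have h1 : (f.app U a + value lam s) + (f.app U b + value lam t) =
        f.app U (a + b) + value lam (s + t) := by
      rw [map_add, value_add]
      ring
    rw [h1, hρ, hρ, hρ, map_add, value_add]
    ring

/-- Morphisms over `Y` to the relative spectrum of `𝒪 ⊕ L` are given by multiplicative maps
out of `L`. -/
lemma IsTwistedSum.exists_hom [IsAffineHom f] (hl : IsTwistedSum lam) {g : T ⟶ Y}
    {μ : L.L ⟶ pushforwardStructureSheaf g}
    (hμ : ∀ (U : Y.Opens) (s t : Γ(L.L, U)), value μ s * value μ t = g.app U (L.pair s t)) :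
    ∃ k : T ⟶ X, k ≫ f = g ∧ ∀ (U : Y.Opens) (_ : IsAffineOpen U)
      (e : g ⁻¹ᵁ U ≤ k ⁻¹ᵁ f ⁻¹ᵁ U) (s : Γ(L.L, U)),
      k.appLE (f ⁻¹ᵁ U) (g ⁻¹ᵁ U) e (value lam s) = value μ s := by
  choose ρ hρ using hl.exists_ringHom hμ
  obtain ⟨k, hk, hk'⟩ := exists_hom_of_affine f g (fun U _ => CommRingCat.ofHom (ρ U))
    (fun U V hU hV i => by
      ext x
      obtain ⟨⟨a, s⟩, rfl⟩ := (hl.bij V).2 x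
      change ρ U (ro X (f.preimage_mono i.le) (f.app V a + value lam s)) =
        ro T (g.preimage_mono i.le) (ρ V (f.app V a + value lam s))
      rw [hρ, map_add (ro X _), map_add (ro T _), ← app_ro f i.le, ← app_ro g i.le,
        ← value_rs lam i.le, ← value_rs μ i.le, hρ])
    (fun U hU => by
      ext a
      change ρ U (f.app U a) = _
      simpa using hρ U a 0)
  refine ⟨k, hk, fun U hU e s => ?_⟩
  rw [hk' U hU e]
  change ρ U (value lam s) = _
  simpa using hρ U 0 s

/-- Morphisms over `Y` to the relative spectrum of `𝒪 ⊕ L` are determined by the functions that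
correspond to local generators of `L`. -/
lemma IsTwistedSum.hom_ext [IsAffineHom f] (hl : IsTwistedSum lam) {g : T ⟶ Y} {k k' : T ⟶ X}
    (hk : k ≫ f = g) (hk' : k' ≫ f = g)
    (H : ∀ x : T, ∃ (U : Y.Opens) (s : Γ(L.L, U)), IsAffineOpen U ∧ g x ∈ U ∧ IsGen s ∧
      k.appLE (f ⁻¹ᵁ U) (g ⁻¹ᵁ U) (le_preimage hk U) (value lam s) =
        k'.appLE (f ⁻¹ᵁ U) (g ⁻¹ᵁ U) (le_preimage hk' U) (value lam s)) : k = k' := by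
  refine hom_ext_of_affine (f := f) (g := g) fun x => ?_
  obtain ⟨U, s, hU, hx, hs, he⟩ := H x
  refine ⟨U, le_preimage hk U, le_preimage hk' U, hU, hx, ?_⟩
  ext y
  obtain ⟨⟨a, t⟩, rfl⟩ := (hl.bij U).2 y
  obtain ⟨b, rfl⟩ := hs.exists_eq t
  simp only [value_smul]
  rw [map_add, map_add, map_mul, map_mul, he, appLE_app hk, appLE_app hk', appLE_app hk,
    appLE_app hk']

/-- Every point has arbitrarily small affine neighbourhoods over which `L` has a generator. -/
lemma exists_affine_isGen (L : TorsionBundle Y) (y : Y) (W : Y.Opens) (hy : y ∈ W) :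
    ∃ (U : Y.Opens) (s : Γ(L.L, U)), U ≤ W ∧ IsAffineOpen U ∧ y ∈ U ∧ IsGen s := by
  obtain ⟨V, hV, hyV, s, hs⟩ := L.exists_isGen y W hy
  obtain ⟨_, ⟨U, hU, rfl⟩, hyU, hUV⟩ := Y.isBasis_affineOpens.exists_subset_of_mem_open hyV V.2
  exact ⟨U, rs _ hUV s, le_trans hUV hV, hU, hyU, hs.rs hUV⟩

/-- The relative spectrum of `𝒪 ⊕ L` is unique. -/
lemma exists_iso_of_isTwistedSum {X' : Scheme.{u}} {f' : X' ⟶ Y} [IsAffineHom f] [IsAffineHom f']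
    {lam' : L.L ⟶ pushforwardStructureSheaf f'} (hl : IsTwistedSum lam)
    (hl' : IsTwistedSum lam') : ∃ e : X ≅ X', e.hom ≫ f' = f := by
  obtain ⟨k, hk, hkl⟩ := hl'.exists_hom hl.mul
  obtain ⟨k', hk', hkl'⟩ := hl.exists_hom hl'.mul
  refine ⟨⟨k, k', ?_, ?_⟩, hk⟩
  · refine hl.hom_ext (g := f) (by rw [Category.assoc, hk', hk]) (Category.id_comp f) fun x => ?_
    obtain ⟨U, s, -, hU, hx, hs⟩ := exists_affine_isGen L (f x) ⊤ trivial
    refine ⟨U, s, hU, hx, hs, ?_⟩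
    rw [appLE_comp_apply k k' (V := f' ⁻¹ᵁ U) (le_preimage hk U) (le_preimage hk' U),
      hkl' U hU, hkl U hU,
      id_appLE_apply]
  · refine hl'.hom_ext (g := f') (by rw [Category.assoc, hk, hk']) (Category.id_comp f') fun x => ?_
    obtain ⟨U, s, -, hU, hx, hs⟩ := exists_affine_isGen L (f' x) ⊤ trivial
    refine ⟨U, s, hU, hx, hs, ?_⟩
    rw [appLE_comp_apply k' k (V := f ⁻¹ᵁ U) (le_preimage hk' U) (le_preimage hk U),
      hkl U hU, hkl' U hU,
      id_appLE_apply]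

/-- The covering involution `(a, s) ↦ (a, -s)`. -/
lemma IsTwistedSum.exists_involution [IsAffineHom f] (hl : IsTwistedSum lam) :
    ∃ σ : X ⟶ X, ∃ hσ : σ ≫ f = f, ∀ (U : Y.Opens) (_ : IsAffineOpen U) (s : Γ(L.L, U)),
      σ.appLE (f ⁻¹ᵁ U) (f ⁻¹ᵁ U) (le_preimage hσ U) (value lam s) = -value lam s := by
  have hneg (U : Y.Opens) (s : Γ(L.L, U)) : value (-lam) s = -value lam s := rfl
  obtain ⟨σ, hσ, h⟩ := hl.exists_hom (g := f) (μ := -lam) (fun U s t => by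
    rw [hneg, hneg, neg_mul_neg, hl.mul])
  exact ⟨σ, hσ, fun U hU s => (h U hU _ s).trans (hneg U s)⟩

end Universal

/-! ### Square roots of units that generate a double cover -/

section Special

variable {X Y : Scheme.{u}} {f : X ⟶ Y}

/-- A function `s` on `f⁻¹ U` that is the square root of an invertible function on `U` and that
together with `1` forms a basis of `f_* 𝒪_X` over every open subset of `U`. -/
structure IsSpecial (f : X ⟶ Y) {U : Y.Opens} (s : Γ(X, f ⁻¹ᵁ U)) : Prop where
  sq : ∃ d : Γ(Y, U), IsUnit d ∧ s * s = f.app U d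
  bij : ∀ (V : Y.Opens) (h : V ≤ U), Function.Bijective
    fun p : Γ(Y, V) × Γ(Y, V) => f.app V p.1 + f.app V p.2 * ro X (f.preimage_mono h) s

namespace IsSpecial

variable {U V : Y.Opens} {s s' : Γ(X, f ⁻¹ᵁ U)}

lemma restrict (hs : IsSpecial f s) (h : V ≤ U) :
    IsSpecial f (U := V) (ro X (f.preimage_mono h) s) where
  sq := by
    obtain ⟨d, hd, hsd⟩ := hs.sq
    exact ⟨ro Y h d, isUnit_ro h hd, by rw [← map_mul, hsd, ← app_ro]⟩
  bij W hW := by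
    have := hs.bij W (hW.trans h)
    simpa only [ro_ro] using this

lemma exists_eq (hs : IsSpecial f s) (x : Γ(X, f ⁻¹ᵁ U)) :
    ∃ a b : Γ(Y, U), x = f.app U a + f.app U b * s := by
  obtain ⟨⟨a, b⟩, h⟩ := (hs.bij U le_rfl).2 x
  exact ⟨a, b, by simpa using h.symm⟩

lemma inj (hs : IsSpecial f s) {a b a' b' : Γ(Y, U)}
    (h : f.app U a + f.app U b * s = f.app U a' + f.app U b' * s) : a = a' ∧ b = b' := by
  have := (hs.bij U le_rfl).1 (a₁ := (a, b)) (a₂ := (a', b')) (by simpa using h)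
  simpa using this

lemma app_injective (hs : IsSpecial f s) {a a' : Γ(Y, U)} (h : f.app U a = f.app U a') : a = a' :=
  (hs.inj (b := 0) (b' := 0) (by rw [h])).1

/-- If `s' = a + b s` has a square without `s`-component, then `2ab = 0`; as `b` is a unit and `2`
is invertible, this forces `a = 0`. -/
lemma exists_unit (h2 : IsUnit (2 : Γ(Y, U))) (hs : IsSpecial f s) (hs' : IsSpecial f s') :
    ∃ b : Γ(Y, U), IsUnit b ∧ s' = f.app U b * s := by
  obtain ⟨d, -, hd⟩ := hs.sq
  obtain ⟨d', -, hd'⟩ := hs'.sq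
  obtain ⟨a, b, hab⟩ := hs.exists_eq s'
  obtain ⟨a', b', hab'⟩ := hs'.exists_eq s
  have hb : b' * b = 1 := by
    refine (hs.inj (a := a' + b' * a) (a' := 0) ?_).2
    rw [map_zero, map_one, zero_add, one_mul, map_add, map_mul, map_mul]
    conv_rhs => rw [hab', hab]
    ring
  have hbu : IsUnit b := IsUnit.of_mul_eq_one b' (by rw [mul_comm, hb])
  have h0 : 2 * a * b = 0 := by
    refine (hs.inj (a := a * a + b * b * d) (a' := d') ?_).2
    rw [map_zero, zero_mul, add_zero, ← hd', hab]
    simp only [map_add, map_mul, map_ofNat, ← hd]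
    ring
  have ha : a = 0 := by
    rw [hbu.mul_left_eq_zero, h2.mul_right_eq_zero] at h0
    exact h0
  exact ⟨b, hbu, by rw [hab, ha, map_zero, zero_add]⟩

/-- The component along `1` of a function does not depend on the choice of `s`. -/
lemma fst_eq (h2 : IsUnit (2 : Γ(Y, U))) (hs : IsSpecial f s) (hs' : IsSpecial f s')
    {a b a' b' : Γ(Y, U)} (h : f.app U a + f.app U b * s = f.app U a' + f.app U b' * s') :
    a = a' := by
  obtain ⟨c, -, rfl⟩ := exists_unit h2 hs hs'
  refine (hs.inj (b := b) (b' := b' * c) ?_).1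
  rw [h, map_mul, mul_assoc]

end IsSpecial

variable {L : TorsionBundle Y} {lam : L.L ⟶ pushforwardStructureSheaf f}

/-- Generators of `L` give square roots of units in `𝒪 ⊕ L`. -/
lemma IsTwistedSum.isSpecial (hl : IsTwistedSum lam) {U : Y.Opens} {s : Γ(L.L, U)}
    (hs : IsGen s) : IsSpecial f (value lam s) where
  sq := ⟨L.pair s s, L.isUnit_pair hs, hl.mul U s s⟩
  bij V h := by
    have h1 : (fun p : Γ(Y, V) × Γ(Y, V) =>
        f.app V p.1 + f.app V p.2 * ro X (f.preimage_mono h) (value lam s)) =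
        (fun p : Γ(Y, V) × Γ(L.L, V) => f.app V p.1 + value lam p.2) ∘
          Prod.map id fun a => a • rs L.L h s := by
      funext p
      simp [value_rs]
    rw [h1]
    exact (hl.bij V).comp (Function.bijective_id.prodMap (hs V h))

lemma IsTwistedSum.isGen_of_isSpecial (hl : IsTwistedSum lam) {U : Y.Opens} {s : Γ(L.L, U)}
    (hs : IsSpecial f (value lam s)) : IsGen s := by
  obtain ⟨d, hd, h⟩ := hs.sq
  refine L.isGen_of_isUnit_pair ?_
  rw [hl.mul] at h
  rwa [hs.app_injective h]

lemma IsTwistedSum.value_injective (hl : IsTwistedSum lam) {U : Y.Opens} {s t : Γ(L.L, U)}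
    (h : value lam s = value lam t) : s = t := by
  have := (hl.bij U).1 (a₁ := (0, s)) (a₂ := (0, t)) (by simpa using h)
  simpa using this

lemma IsTwistedSum.app_injective (hl : IsTwistedSum lam) {U : Y.Opens} {a b : Γ(Y, U)}
    (h : f.app U a = f.app U b) : a = b := by
  have := (hl.bij U).1 (a₁ := (a, 0)) (a₂ := (b, 0)) (by simpa using h)
  simpa using this

/-- Over an open set where `L` has a generator, special functions lie in the image of `L`. -/
lemma IsTwistedSum.exists_value_eq (hl : IsTwistedSum lam) {U : Y.Opens}
    (h2 : IsUnit (2 : Γ(Y, U))) {r : Γ(X, f ⁻¹ᵁ U)} (hr : IsSpecial f r) {g : Γ(L.L, U)}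
    (hg : IsGen g) : ∃ t : Γ(L.L, U), value lam t = r := by
  obtain ⟨b, -, rfl⟩ := IsSpecial.exists_unit h2 (hl.isSpecial hg) hr
  exact ⟨b • g, value_smul _ _ _⟩

lemma isUnit_two (h2 : IsUnit (2 : Γ(Y, ⊤))) (U : Y.Opens) : IsUnit (2 : Γ(Y, U)) := by
  have h : ro Y (le_top : U ≤ ⊤) 2 = 2 := map_ofNat _ 2
  exact h ▸ isUnit_ro (le_top : U ≤ ⊤) h2

/-- The projection of `f_* 𝒪_X` to `𝒪_Y`, half the trace. -/
lemma exists_projection (h2 : IsUnit (2 : Γ(Y, ⊤)))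
    (hP : IsBasisOf fun U : Y.Opens => ∃ s : Γ(X, f ⁻¹ᵁ U), IsSpecial f s) :
    ∃ t : pushforwardStructureSheaf f ⟶ structureSheaf Y,
      (∀ (U : Y.Opens) (s : Γ(X, f ⁻¹ᵁ U)), IsSpecial f s → ∀ a b : Γ(Y, U),
        toRing (t.app U (f.app U a + f.app U b * s : Γ(X, f ⁻¹ᵁ U))) = a) ∧
      unitHom f ≫ t = 𝟙 _ := by
  have key (U : Y.Opens) (hU : ∃ s : Γ(X, f ⁻¹ᵁ U), IsSpecial f s) :
      ∃ φ : Γ(pushforwardStructureSheaf f, U) →ₗ[Γ(Y, U)] Γ(structureSheaf Y, U),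
        ∀ s : Γ(X, f ⁻¹ᵁ U), IsSpecial f s → ∀ a b : Γ(Y, U),
          toRing (φ (f.app U a + f.app U b * s : Γ(X, f ⁻¹ᵁ U))) = a := by
    obtain ⟨s, hs⟩ := hU
    choose a b hab using hs.exists_eq
    have ha {s' : Γ(X, f ⁻¹ᵁ U)} (hs' : IsSpecial f s') (a' b' : Γ(Y, U)) :
        a (f.app U a' + f.app U b' * s') = a' :=
      hs.fst_eq (isUnit_two h2 U) hs' (hab _).symm
    refine ⟨{ toFun := fun x => ofRing (a x), map_add' := fun x y => ?_,
              map_smul' := fun c x => ?_ },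
      fun s' hs' a' b' => ha hs' a' b'⟩
    · change a (pushforwardToRing f x + pushforwardToRing f y) =
        a (pushforwardToRing f x) + a (pushforwardToRing f y)
      generalize pushforwardToRing f x = x
      generalize pushforwardToRing f y = y
      rw [← ha hs (a x + a y) (b x + b y)]
      congr 1
      conv_lhs => rw [hab x, hab y]
      rw [map_add, map_add]
      ring
    · change a (f.app U c * pushforwardToRing f x) = c * a (pushforwardToRing f x)
      generalize pushforwardToRing f x = x
      rw [← ha hs (c * a x) (c * b x)]
      congr 1
      conv_lhs => rw [hab x]
      rw [map_mul, map_mul]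
      ring
  choose φ hφ using key
  obtain ⟨t, ht⟩ := exists_hom_of_basis (M := pushforwardStructureSheaf f)
    (N := structureSheaf Y) hP φ (fun U V hU hV h x => by
      obtain ⟨s, hs⟩ := hU
      obtain ⟨a, b, hab⟩ := hs.exists_eq (pushforwardToRing f x)
      have h1 : rs (pushforwardStructureSheaf f) h x = (f.app V (ro Y h a) + f.app V (ro Y h b) *
          ro X (f.preimage_mono h) s : Γ(X, f ⁻¹ᵁ V)) := by
        rw [app_ro, app_ro, ← map_mul, ← map_add, ← hab]; rfl
      have h2 : toRing (φ U ⟨s, hs⟩ x) = a := by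
        have := hφ U ⟨s, hs⟩ s hs a b
        rw [← hab] at this
        exact this
      change toRing (φ V hV _) = ro Y h (toRing (φ U ⟨s, hs⟩ x))
      rw [h2, h1, hφ V hV _ (hs.restrict h)])
  have ht' (U : Y.Opens) (s : Γ(X, f ⁻¹ᵁ U)) (hs : IsSpecial f s) (a b : Γ(Y, U)) :
      toRing (t.app U (f.app U a + f.app U b * s : Γ(X, f ⁻¹ᵁ U))) = a := by
    exact (congrArg toRing (ht U ⟨s, hs⟩ _)).trans (hφ U ⟨s, hs⟩ s hs a b)
  refine ⟨t, ht', modules_hom_ext fun U a => section_ext fun y hy => ?_⟩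
  obtain ⟨V, hV, hyV, s, hs⟩ := hP U y hy
  refine ⟨V, hV, hyV, ?_⟩
  rw [← app_rs, ← app_rs]
  have h1 := ht' V s hs (toRing (rs _ hV a)) 0
  rw [map_zero, zero_mul, add_zero] at h1
  exact h1

/-- A double cover that is locally generated by square roots of units is the relative spectrum
of `𝒪 ⊕ L`, where `L` is the kernel of the projection of `f_* 𝒪_X` to `𝒪_Y`. -/
lemma exists_isTwistedSum (h2 : IsUnit (2 : Γ(Y, ⊤)))
    (hP : IsBasisOf fun U : Y.Opens => ∃ s : Γ(X, f ⁻¹ᵁ U), IsSpecial f s) :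
    ∃ (L : TorsionBundle Y) (lam : L.L ⟶ pushforwardStructureSheaf f), IsTwistedSum lam := by
  obtain ⟨t, ht, hut⟩ := exists_projection h2 hP
  let M := kernel t
  let ι : M ⟶ pushforwardStructureSheaf f := kernel.ι t
  let q : pushforwardStructureSheaf f ⟶ M := kernel.lift t (𝟙 _ - t ≫ unitHom f) (by
    rw [Preadditive.sub_comp, Category.assoc, hut, Category.id_comp, Category.comp_id, sub_self])
  have hι : ι ≫ q = 𝟙 M := by
    rw [← cancel_mono ι, Category.assoc, kernel.lift_ι, Preadditive.comp_sub, Category.comp_id,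
      ← Category.assoc, kernel.condition, zero_comp, sub_zero, Category.id_comp]
  have inj {U : Y.Opens} {x y : Γ(M, U)} (h : value ι x = value ι y) : x = y := by
    have h1 := congrArg (q.app U) (show ι.app U x = ι.app U y from h)
    have h3 (x : Γ(M, U)) : q.app U (ι.app U x) = x :=
      ConcreteCategory.congr_hom congr(($hι).app U) x
    rwa [h3, h3] at h1
  have tι {U : Y.Opens} (x : Γ(M, U)) : t.app U (ι.app U x) = 0 :=
    ConcreteCategory.congr_hom congr(($(kernel.condition t)).app U) x
  have mem {U : Y.Opens} (x : Γ(pushforwardStructureSheaf f, U)) (hx : t.app U x = 0) :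
      ∃ y : Γ(M, U), ι.app U y = x := by
    refine ⟨q.app U x, ?_⟩
    have h1 : q ≫ ι = 𝟙 _ - t ≫ unitHom f := kernel.lift_ι _ _ _
    have h3 : ι.app U (q.app U x) = x - (unitHom f).app U (t.app U x) :=
      ConcreteCategory.congr_hom congr(($h1).app U) x
    rw [h3, hx, map_zero, sub_zero]
  -- over the preimage of `U`, functions in `M` are the multiples of a special function
  have mem_special {U : Y.Opens} {s : Γ(X, f ⁻¹ᵁ U)} (hs : IsSpecial f s) :
      ∃ y : Γ(M, U), value ι y = s := mem s (by
    have := ht U s hs 0 1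
    rw [map_zero, map_one, one_mul, zero_add] at this
    exact this)
  have gen {U : Y.Opens} {s : Γ(X, f ⁻¹ᵁ U)} (hs : IsSpecial f s) (y : Γ(M, U)) :
      ∃ b : Γ(Y, U), value ι y = f.app U b * s := by
    obtain ⟨a, b, hab⟩ := hs.exists_eq (value ι y)
    have h1 := ht U s hs a b
    rw [← hab] at h1
    have h3 : a = 0 := h1.symm.trans (tι y)
    exact ⟨b, by rw [hab, h3, map_zero, zero_add]⟩
  have isGen {U : Y.Opens} {s : Γ(M, U)} (hs : IsSpecial f (value ι s)) : IsGen s := by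
    intro V hV
    have hs' := hs.restrict hV
    rw [← value_rs] at hs'
    refine ⟨fun a b hab => ?_, fun y => ?_⟩
    · have h1 := congrArg (value ι) hab
      simp only [value_smul] at h1
      exact (hs'.inj (a := 0) (a' := 0) (by rw [h1])).2
    · obtain ⟨b, hb⟩ := gen hs' y
      refine ⟨b, inj ?_⟩
      simp only [value_smul, hb]
  have hM : IsLineBundle M := isLineBundle_of_isGen fun x => by
    obtain ⟨V, -, hxV, s, hs⟩ := hP ⊤ x trivial
    obtain ⟨y, rfl⟩ := mem_special hs
    exact ⟨V, hxV, y, isGen hs⟩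
  let β (U : Y.Opens) : Γ(M, U) →ₗ[Γ(Y, U)] Γ(M, U) →ₗ[Γ(Y, U)] Γ(structureSheaf Y, U) :=
    LinearMap.mk₂ _ (fun x y => t.app U (value ι x * value ι y : Γ(X, f ⁻¹ᵁ U)))
      (fun x x' y => by
        rw [value_add, add_mul]
        exact map_add (t.app U).hom _ _)
      (fun c x y => by
        rw [value_smul, mul_assoc]
        exact t.app_smul c (value ι x * value ι y : Γ(X, f ⁻¹ᵁ U)))
      (fun x y y' => by
        rw [value_add, mul_add]
        exact map_add (t.app U).hom _ _)
      (fun c x y => by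
        rw [value_smul, mul_left_comm]
        exact t.app_smul c (value ι x * value ι y : Γ(X, f ⁻¹ᵁ U)))
  have hβ (U : Y.Opens) (x y : Γ(M, U)) :
      β U x y = t.app U (value ι x * value ι y : Γ(X, f ⁻¹ᵁ U)) := rfl
  have βrs (U V : Y.Opens) (h : V ≤ U) (x y : Γ(M, U)) :
      β V (rs M h x) (rs M h y) = rs _ h (β U x y) := by
    have h1 : value ι (rs M h x) * value ι (rs M h y) =
        ro X (f.preimage_mono h) (value ι x * value ι y) := by
      rw [value_rs, value_rs, map_mul]
    exact (congrArg (t.app V) h1).trans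
      (app_rs t h (value ι x * value ι y : Γ(X, f ⁻¹ᵁ U)))
  have mul {U : Y.Opens} {s : Γ(X, f ⁻¹ᵁ U)} (hs : IsSpecial f s) (x y : Γ(M, U)) :
      value ι x * value ι y = f.app U (toRing (β U x y)) := by
    obtain ⟨a, ha⟩ := gen hs x
    obtain ⟨b, hb⟩ := gen hs y
    obtain ⟨d, -, hd⟩ := hs.sq
    have h1 : value ι x * value ι y = f.app U (a * b * d) + f.app U 0 * s := by
      rw [ha, hb, map_zero, zero_mul, add_zero, map_mul, map_mul, ← hd]
      ring
    rw [hβ, h1, ht U s hs, map_zero, zero_mul, add_zero]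
  obtain ⟨i, hi⟩ := TorsionBundle.exists_of_pairing hM β βrs (fun U x hx => by
    refine isUnit_of_locally fun y hy => ?_
    obtain ⟨V, hV, hyV, s, hs⟩ := hP U y hy
    refine ⟨V, hV, hyV, ?_⟩
    rw [← toRing_rs, ← βrs]
    obtain ⟨r, rfl⟩ := mem_special hs
    obtain ⟨c, hc, hxc⟩ := (isGen hs).exists_unit (hx.rs hV)
    obtain ⟨d, hd, hsd⟩ := hs.sq
    rw [mul hs] at hsd
    rw [hxc]
    simp only [map_smul, LinearMap.smul_apply, toRing_smul]
    rw [hs.app_injective hsd]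
    exact hc.mul (hc.mul hd))
  refine ⟨⟨M, hM, i⟩, ι, IsTwistedSum.of_basis hP ?_ ?_⟩
  · rintro U ⟨s, hs⟩ x y
    rw [hi]
    exact mul hs x y
  · rintro U ⟨s, hs⟩
    refine ⟨fun p p' h => ?_, fun z => ?_⟩
    · obtain ⟨b, hb⟩ := gen hs p.2
      obtain ⟨b', hb'⟩ := gen hs p'.2
      have h1 : f.app U p.1 + f.app U b * s = f.app U p'.1 + f.app U b' * s := by
        rw [← hb, ← hb']
        exact h
      obtain ⟨h3, h4⟩ := hs.inj h1
      exact Prod.ext h3 (inj (by rw [hb, hb', h4]))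
    · obtain ⟨a, b, rfl⟩ := hs.exists_eq z
      obtain ⟨y, rfl⟩ := mem_special hs
      exact ⟨(a, b • y), by simp only [value_smul]⟩

end Special

/-! ### Quadratic algebras -/

section Algebra

/-- A pair `e₀, e₁` that becomes a basis after inverting `a`, formulated without localizations. -/
structure IsBasisAway {A B : Type*} [CommRing A] [CommRing B] [Algebra A B] (a : A) (e₀ e₁ : B) :
    Prop where
  span : ∀ b : B, ∃ (n : ℕ) (x y : A), a ^ n • b = x • e₀ + y • e₁
  indep : ∀ x y : A, x • e₀ + y • e₁ = 0 → ∃ n : ℕ, a ^ n * x = 0 ∧ a ^ n * y = 0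

lemma IsBasisAway.bijective {A B A' B' : Type*} [CommRing A] [CommRing B] [Algebra A B]
    [CommRing A'] [CommRing B'] [Algebra A A'] [Algebra B B'] {a : A} {e₀ e₁ : B}
    (h : IsBasisAway a e₀ e₁) [IsLocalization.Away a A']
    [IsLocalization.Away (algebraMap A B a) B'] (φ : A' →+* B')
    (hφ : ∀ x, φ (algebraMap A A' x) = algebraMap B B' (algebraMap A B x)) :
    Function.Bijective fun p : A' × A' =>
      φ p.1 * algebraMap B B' e₀ + φ p.2 * algebraMap B B' e₁ := by
  have hu (n : ℕ) : IsUnit (algebraMap A A' a ^ n) :=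
    (IsLocalization.Away.algebraMap_isUnit a).pow n
  have hu' (n : ℕ) : IsUnit (algebraMap B B' (algebraMap A B a) ^ n) :=
    (IsLocalization.Away.algebraMap_isUnit (algebraMap A B a)).pow n
  let ψ : A' × A' →+ B' :=
    { toFun := fun p => φ p.1 * algebraMap B B' e₀ + φ p.2 * algebraMap B B' e₁
      map_zero' := by simp
      map_add' := fun p q => by simp only [Prod.fst_add, Prod.snd_add, map_add]; ring }
  change Function.Bijective ψ
  constructor
  · refine (injective_iff_map_eq_zero ψ).mpr ?_
    rintro ⟨p, q⟩ hpq
    change φ p * algebraMap B B' e₀ + φ q * algebraMap B B' e₁ = 0 at hpq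
    obtain ⟨n, x, hx⟩ := IsLocalization.Away.surj a p
    obtain ⟨m, y, hy⟩ := IsLocalization.Away.surj a q
    have h1 : algebraMap B B' ((a ^ m * x) • e₀ + (a ^ n * y) • e₁) = algebraMap B B' 0 := by
      simp only [Algebra.smul_def, map_add, map_mul, map_pow, ← hφ, ← hx, ← hy, map_zero]
      linear_combination (φ (algebraMap A A' a) ^ n * φ (algebraMap A A' a) ^ m) * hpq
    obtain ⟨k, hk⟩ := IsLocalization.Away.exists_of_eq (algebraMap A B a) h1
    obtain ⟨l, hl, hl'⟩ := h.indep (a ^ k * (a ^ m * x)) (a ^ k * (a ^ n * y)) (by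
      rw [mul_smul, mul_smul (a ^ k), ← smul_add, Algebra.smul_def, map_pow, hk, mul_zero])
    have hp : algebraMap A A' a ^ (l + k + m + n) * p = 0 := by
      have := congrArg (algebraMap A A') hl
      simp only [map_mul, map_pow, map_zero, ← hx] at this
      rw [← this]; ring
    have hq : algebraMap A A' a ^ (l + k + n + m) * q = 0 := by
      have := congrArg (algebraMap A A') hl'
      simp only [map_mul, map_pow, map_zero, ← hy] at this
      rw [← this]; ring
    rw [(hu _).mul_right_eq_zero] at hp hq
    rw [hp, hq]; rfl
  · intro z
    obtain ⟨n, b, hb⟩ := IsLocalization.Away.surj (algebraMap A B a) z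
    obtain ⟨m, x, y, hxy⟩ := h.span b
    obtain ⟨c, hc⟩ := (hu (n + m)).exists_left_inv
    refine ⟨(c * algebraMap A A' x, c * algebraMap A A' y), ?_⟩
    change φ (c * algebraMap A A' x) * algebraMap B B' e₀ +
      φ (c * algebraMap A A' y) * algebraMap B B' e₁ = z
    have h1 := congrArg (algebraMap B B') hxy
    simp only [Algebra.smul_def, map_add, map_mul, map_pow, ← hφ] at h1
    have h2 := congrArg φ hc
    simp only [map_mul, map_pow, map_one] at h2
    rw [map_mul, map_mul]
    rw [← hφ] at hb
    linear_combination (-φ c) * h1 - φ c * φ (algebraMap A A' a) ^ m * hb + z * h2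

/-- A finite flat algebra of rank two has local bases. -/
lemma exists_isBasisAway {A B : Type*} [CommRing A] [CommRing B] [Algebra A B] [Module.Finite A B]
    [Module.Flat A B] (h : ∀ p : PrimeSpectrum A, Module.rankAtStalk B p = 2) (p : Ideal A)
    [p.IsPrime] : ∃ a ∉ p, ∃ e₀ e₁ : B, IsBasisAway a e₀ e₁ := by
  obtain ⟨a, ha, hfree⟩ := Module.Free.away_of_finite_of_flat_of_rankAtStalk_constant B p
    (fun m _ => by rw [h, h])
  refine ⟨a, ha, ?_⟩
  let A' := Localization.Away a
  let B' := LocalizedModule.Away a B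
  have : Nontrivial A' := by
    refine ⟨0, 1, fun h01 => ?_⟩
    obtain ⟨n, hn⟩ := IsLocalization.Away.exists_of_eq (S := A') (a := 0) (b := 1) a
      (by rw [map_zero, map_one, h01])
    rw [mul_zero, mul_one] at hn
    exact ha (Ideal.IsPrime.mem_of_pow_mem ‹_› n (hn ▸ p.zero_mem))
  have : Module.Finite A' B' := Module.Finite.of_isLocalizedModule (Submonoid.powers a)
    (LocalizedModule.mkLinearMap (Submonoid.powers a) B)
  have hrank : Module.finrank A' B' = 2 := by
    obtain ⟨q⟩ := (inferInstance : Nonempty (PrimeSpectrum A'))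
    have h1 := Module.rankAtStalk_isBaseChange (S := A')
      (LocalizedModule.isBaseChange (Submonoid.powers a) B) q
    rw [h, Module.rankAtStalk_eq_finrank_of_free] at h1
    exact h1
  let b : Module.Basis (Fin 2) A' B' := Module.finBasisOfFinrankEq A' B' hrank
  let g : B →ₗ[A] B' := LocalizedModule.mkLinearMap (Submonoid.powers a) B
  have hsurj (i : Fin 2) : ∃ (e : B) (n : ℕ), a ^ n • b i = g e := by
    obtain ⟨⟨e, ⟨_, n, rfl⟩⟩, he⟩ := IsLocalizedModule.surj (Submonoid.powers a) g (b i)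
    exact ⟨e, n, he⟩
  choose e n hn using hsurj
  have hu (n : ℕ) : IsUnit (algebraMap A A' a ^ n) :=
    (IsLocalization.Away.algebraMap_isUnit a).pow n
  have hg0 (x : B) (hx : g x = 0) : ∃ n : ℕ, a ^ n • x = 0 := by
    obtain ⟨⟨_, n, rfl⟩, hc⟩ := (IsLocalizedModule.eq_zero_iff (Submonoid.powers a) g).mp hx
    exact ⟨n, hc⟩
  have hsm (x : A) (m : B') : algebraMap A A' x • m = x • m := algebraMap_smul A' x m
  refine ⟨e 0, e 1, fun z => ?_, fun x y hxy => ?_⟩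
  · have h1 := b.sum_repr (g z)
    rw [Fin.sum_univ_two] at h1
    obtain ⟨k, x, hx⟩ := IsLocalization.Away.surj a (b.repr (g z) 0)
    obtain ⟨l, y, hy⟩ := IsLocalization.Away.surj a (b.repr (g z) 1)
    generalize b.repr (g z) 0 = r at h1 hx
    generalize b.repr (g z) 1 = s at h1 hy
    have hx' (m : B') : r • a ^ k • m = x • m := by
      rw [← hsm, ← hsm x, smul_smul, map_pow, hx]
    have hy' (m : B') : s • a ^ l • m = y • m := by
      rw [← hsm, ← hsm y, smul_smul, map_pow, hy]
    have h3 : g (a ^ (k + l + n 0 + n 1) • z) =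
        g ((a ^ (l + n 1) * x) • e 0 + (a ^ (k + n 0) * y) • e 1) := by
      rw [map_smul, ← h1, map_add, map_smul, map_smul, ← hn, ← hn, mul_smul, mul_smul, smul_add,
        smul_comm x, smul_comm y, ← hx', ← hy']
      simp only [← hsm, smul_smul, map_pow]
      congr 2 <;> ring
    obtain ⟨c, hc⟩ := hg0 (a ^ (k + l + n 0 + n 1) • z -
      ((a ^ (l + n 1) * x) • e 0 + (a ^ (k + n 0) * y) • e 1)) (by
        rw [map_sub, sub_eq_zero]; exact h3)
    refine ⟨c + (k + l + n 0 + n 1), a ^ c * (a ^ (l + n 1) * x), a ^ c * (a ^ (k + n 0) * y), ?_⟩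
    rw [smul_sub, sub_eq_zero] at hc
    rw [pow_add, mul_smul, hc, smul_add, smul_smul, smul_smul]
  · have h1 := congrArg g hxy
    rw [map_add, map_smul, map_smul, ← hn, ← hn, map_zero g] at h1
    have h3 : ∑ i, ![algebraMap A A' (x * a ^ n 0), algebraMap A A' (y * a ^ n 1)] i • b i = 0 := by
      rw [Fin.sum_univ_two]
      change algebraMap A A' (x * a ^ n 0) • b 0 + algebraMap A A' (y * a ^ n 1) • b 1 = 0
      rw [hsm, hsm, mul_smul, mul_smul, h1]
    have h4 := Fintype.linearIndependent_iff.mp b.linearIndependent _ h3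
    have h5 (z : A) (n : ℕ) (hz : algebraMap A A' (z * a ^ n) = 0) : ∃ m : ℕ, a ^ m * z = 0 := by
      rw [map_mul, map_pow, (hu n).mul_left_eq_zero, ← map_zero (algebraMap A A')] at hz
      obtain ⟨m, hm⟩ := IsLocalization.Away.exists_of_eq a hz
      exact ⟨m, by rw [hm, mul_zero]⟩
    obtain ⟨k, hk⟩ := h5 _ _ (h4 0)
    obtain ⟨l, hl⟩ := h5 _ _ (h4 1)
    exact ⟨k + l, by rw [pow_add, mul_right_comm, hk, zero_mul],
      by rw [pow_add, mul_assoc, hl, mul_zero]⟩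

/-- If `e₀, e₁` is a basis and `1 = x e₀ + y e₁`, then `1, e₁` is a basis after inverting `x`. -/
lemma isBasisAway_one {A B : Type*} [CommRing A] [CommRing B] [Algebra A B] {e₀ e₁ : B}
    (h : Function.Bijective fun p : A × A => p.1 • e₀ + p.2 • e₁) {x y : A}
    (h1 : 1 = x • e₀ + y • e₁) : IsBasisAway x 1 e₁ where
  span b := by
    obtain ⟨⟨u, v⟩, rfl⟩ := h.2 b
    refine ⟨1, u, x * v - y * u, ?_⟩
    rw [h1]
    simp only [Algebra.smul_def, map_sub, map_mul, pow_one]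
    ring
  indep u v huv := by
    have h2 := h.1 (a₁ := (u * x, u * y + v)) (a₂ := (0, 0)) (by
      simp only [zero_smul, add_zero]
      rw [← huv, h1]
      simp only [Algebra.smul_def, map_add, map_mul]
      ring)
    obtain ⟨h3, h4⟩ := Prod.mk.inj h2
    exact ⟨1, by linear_combination h3, by linear_combination x * h4 - y * h3⟩

/-- One of the coordinates of `1` in a basis avoids a given prime. -/
lemma notMem_or_notMem_of_one_eq {A B : Type*} [CommRing A] [CommRing B] [Algebra A B] {e₀ e₁ : B}
    (h : Function.Bijective fun p : A × A => p.1 • e₀ + p.2 • e₁) {x y : A}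
    (h1 : 1 = x • e₀ + y • e₁) (p : Ideal A) [hp : p.IsPrime] : x ∉ p ∨ y ∉ p := by
  by_contra! hxy
  obtain ⟨⟨u, v⟩, huv⟩ := h.2 (e₀ * e₀)
  obtain ⟨⟨u', v'⟩, huv'⟩ := h.2 (e₁ * e₀)
  have h2 := h.1 (a₁ := (1, 0)) (a₂ := (x * u + y * u', x * v + y * v')) (by
    have h3 : e₀ = x • (e₀ * e₀) + y • (e₁ * e₀) := by
      conv_lhs => rw [← one_mul e₀, h1]
      simp only [Algebra.smul_def]
      ring
    simp only [one_smul, zero_smul, add_zero]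
    conv_lhs => rw [h3, ← huv, ← huv']
    simp only [Algebra.smul_def, map_add, map_mul]
    ring)
  obtain ⟨h3, -⟩ := Prod.mk.inj h2
  refine hp.ne_top ((Ideal.eq_top_iff_one p).mpr ?_)
  rw [h3]
  exact p.add_mem (p.mul_mem_right _ hxy.1) (p.mul_mem_right _ hxy.2)

/-- An unramified algebra `A[s]`, `s² = d`, has invertible `d`: otherwise `s` would be nilpotent
in the fibre over a maximal ideal containing `d`. -/
lemma isUnit_of_formallyUnramified {A B : Type*} [CommRing A] [CommRing B] [Algebra A B]
    [Algebra.EssFiniteType A B] [Algebra.FormallyUnramified A B] {s : B} {d : A}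
    (h : Function.Bijective fun p : A × A => p.1 • (1 : B) + p.2 • s)
    (hs : s * s = algebraMap A B d) : IsUnit d := by
  by_contra hd
  obtain ⟨m, hm, hdm⟩ := exists_max_ideal_of_mem_nonunits hd
  have h1 : s ∈ m.map (algebraMap A B) := by
    refine Algebra.FormallyUnramified.isRadical_map_isMaximal A B m ⟨2, ?_⟩
    rw [sq, hs]
    exact Ideal.mem_map_of_mem _ hdm
  let E : (A × A) ≃ₗ[A] B := LinearEquiv.ofBijective
    { toFun := fun p => p.1 • (1 : B) + p.2 • s
      map_add' := fun p q => by simp only [Prod.fst_add, Prod.snd_add, add_smul]; abel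
      map_smul' := fun c p => by simp [mul_smul] } h
  let c : B →ₗ[A] A := LinearMap.snd A A A ∘ₗ E.symm.toLinearMap
  have hc : c s = 1 := by
    have : E (0, 1) = s := by
      change (0 : A) • (1 : B) + (1 : A) • s = s
      rw [zero_smul, zero_add, one_smul]
    change (E.symm s).2 = 1
    rw [← this, E.symm_apply_apply]
  have h2 : s ∈ m • (⊤ : Submodule A B) := by
    rw [Ideal.smul_top_eq_map]
    exact h1
  have h3 : c s ∈ m := by
    refine Submodule.smul_induction_on (p := fun x => c x ∈ m) h2 (fun r hr x _ => ?_)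
      (fun x y hx hy => ?_)
    · rw [map_smul]
      exact m.mul_mem_right _ hr
    · rw [map_add]
      exact m.add_mem hx hy
  exact hm.ne_top ((Ideal.eq_top_iff_one m).mpr (hc ▸ h3))

end Algebra

/-! ### Finite étale double covers are locally generated by square roots of units -/

section LocalStructure

variable {X Y : Scheme.{u}}

/-- Over an affine open set `U`, the affine morphism `f` is `Spec` of `𝒪_Y(U) → 𝒪_X(f⁻¹ U)`. -/
lemma isPullback_fromSpec (f : X ⟶ Y) [IsAffineHom f] {U : Y.Opens} (hU : IsAffineOpen U) :
    IsPullback (hU.preimage f).fromSpec (Spec.map (f.app U)) f hU.fromSpec := by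
  refine (IsOpenImmersion.isPullback _ _ _ _ ?_ ?_).flip
  · rw [Scheme.Hom.app_eq_appLE, hU.SpecMap_appLE_fromSpec f (hU.preimage f)]
  · rw [hU.opensRange_fromSpec, (hU.preimage f).opensRange_fromSpec]

/-- The degree of `f` is the rank of the module `𝒪_X(f⁻¹ U)` over `𝒪_Y(U)`. -/
lemma rankAtStalk_eq (f : X ⟶ Y) [IsFinite f] [Flat f] {n : ℕ} (hf : ∀ y, f.finrank y = n)
    {U : Y.Opens} (hU : IsAffineOpen U) :
    letI := (f.app U).hom.toAlgebra
    ∀ p : PrimeSpectrum Γ(Y, U), Module.rankAtStalk Γ(X, f ⁻¹ᵁ U) p = n := by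
  let := (f.app U).hom.toAlgebra
  intro p
  have : Module.Finite Γ(Y, U) Γ(X, f ⁻¹ᵁ U) := f.finite_app U hU
  have hflat := f.flat_appLE hU (hU.preimage f) le_rfl
  rw [← Scheme.Hom.app_eq_appLE] at hflat
  have : Module.Flat Γ(Y, U) Γ(X, f ⁻¹ᵁ U) := hflat
  have h1 := Scheme.Hom.finrank_SpecMap_algebraMap Γ(Y, U) Γ(X, f ⁻¹ᵁ U) p
  rw [← h1]
  exact (Scheme.Hom.finrank_of_isPullback _ _ _ _ (isPullback_fromSpec f hU) p).trans (hf _)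

/-- Bases after inverting `a` give bases over the basic open set of `a`. -/
lemma bijective_basicOpen (f : X ⟶ Y) [IsAffineHom f] {U : Y.Opens} (hU : IsAffineOpen U)
    (a : Γ(Y, U)) {e₀ e₁ : Γ(X, f ⁻¹ᵁ U)}
    (h : letI := (f.app U).hom.toAlgebra; IsBasisAway a e₀ e₁) {V : Y.Opens} (hV : V ≤ U)
    (hVa : V = Y.basicOpen a) : Function.Bijective fun p : Γ(Y, V) × Γ(Y, V) =>
      f.app V p.1 * ro X (f.preimage_mono hV) e₀ + f.app V p.2 * ro X (f.preimage_mono hV) e₁ := by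
  let := (f.app U).hom.toAlgebra
  let := (Y.presheaf.map (homOfLE hV).op).hom.toAlgebra
  let := (X.presheaf.map (homOfLE (f.preimage_mono hV)).op).hom.toAlgebra
  have : IsLocalization.Away a Γ(Y, V) := hU.isLocalization_of_eq_basicOpen a (homOfLE hV) hVa
  have : IsLocalization.Away (algebraMap Γ(Y, U) Γ(X, f ⁻¹ᵁ U) a) Γ(X, f ⁻¹ᵁ V) :=
    (hU.preimage f).isLocalization_of_eq_basicOpen (f.app U a) (homOfLE (f.preimage_mono hV)) (by
      rw [hVa, Scheme.preimage_basicOpen])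
  exact h.bijective (A' := Γ(Y, V)) (B' := Γ(X, f ⁻¹ᵁ V)) (f.app V).hom fun x => app_ro f hV x

/-- Sections of a biproduct of sheaves are pairs of sections. -/
lemma biprod_bijective (M N : Y.Modules) (U : Y.Opens) :
    Function.Bijective fun z : Γ(M ⊞ N, U) =>
      (((biprod.fst : M ⊞ N ⟶ M).app U z, (biprod.snd : M ⊞ N ⟶ N).app U z) :
        Γ(M, U) × Γ(N, U)) := by
  have total (z : Γ(M ⊞ N, U)) : (biprod.inl : M ⟶ M ⊞ N).app U ((biprod.fst : M ⊞ N ⟶ M).app U z) +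
      (biprod.inr : N ⟶ M ⊞ N).app U ((biprod.snd : M ⊞ N ⟶ N).app U z) = z :=
    ConcreteCategory.congr_hom congr(($(biprod.total (X := M) (Y := N))).app U) z
  have h1 (x : Γ(M, U)) : (biprod.fst : M ⊞ N ⟶ M).app U ((biprod.inl : M ⟶ M ⊞ N).app U x) = x :=
    ConcreteCategory.congr_hom congr(($(biprod.inl_fst (X := M) (Y := N))).app U) x
  have h2 (x : Γ(M, U)) : (biprod.snd : M ⊞ N ⟶ N).app U ((biprod.inl : M ⟶ M ⊞ N).app U x) = 0 :=
    ConcreteCategory.congr_hom congr(($(biprod.inl_snd (X := M) (Y := N))).app U) x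
  have h3 (x : Γ(N, U)) : (biprod.fst : M ⊞ N ⟶ M).app U ((biprod.inr : N ⟶ M ⊞ N).app U x) = 0 :=
    ConcreteCategory.congr_hom congr(($(biprod.inr_fst (X := M) (Y := N))).app U) x
  have h4 (x : Γ(N, U)) : (biprod.snd : M ⊞ N ⟶ N).app U ((biprod.inr : N ⟶ M ⊞ N).app U x) = x :=
    ConcreteCategory.congr_hom congr(($(biprod.inr_snd (X := M) (Y := N))).app U) x
  refine ⟨fun z z' h => ?_, fun p => ⟨(biprod.inl : M ⟶ M ⊞ N).app U p.1 +
    (biprod.inr : N ⟶ M ⊞ N).app U p.2, ?_⟩⟩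
  · obtain ⟨h5, h6⟩ := Prod.mk.inj h
    rw [← total z, ← total z', h5, h6]
  · refine Prod.ext ?_ ?_
    · exact (map_add _ _ _).trans ((congrArg₂ (· + ·) (h1 _) (h3 _)).trans (add_zero _))
    · exact (map_add _ _ _).trans ((congrArg₂ (· + ·) (h2 _) (h4 _)).trans (zero_add _))

/-- Whether `1` and `s` form a basis can be checked locally. -/
lemma bijective_of_locally (f : X ⟶ Y) {U : Y.Opens} {s : Γ(X, f ⁻¹ᵁ U)} {P : Y.Opens → Prop}
    (hP : ∀ x ∈ U, ∀ W : Y.Opens, x ∈ W → ∃ V ≤ W, x ∈ V ∧ V ≤ U ∧ P V)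
    (hb : ∀ (V : Y.Opens) (hV : V ≤ U), P V →
      Function.Bijective fun p : Γ(Y, V) × Γ(Y, V) =>
        f.app V p.1 + f.app V p.2 * ro X (f.preimage_mono hV) s)
    (V : Y.Opens) (hV : V ≤ U) : Function.Bijective fun p : Γ(Y, V) × Γ(Y, V) =>
      f.app V p.1 + f.app V p.2 * ro X (f.preimage_mono hV) s := by
  let O := structureSheaf Y
  let φ (V : Y.Opens) (hV : V ≤ U) (z : Γ(O ⊞ O, V)) : Γ(pushforwardStructureSheaf f, V) :=
    (f.app V (toRing ((biprod.fst : O ⊞ O ⟶ O).app V z)) +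
      f.app V (toRing ((biprod.snd : O ⊞ O ⟶ O).app V z)) * ro X (f.preimage_mono hV) s :
        Γ(X, f ⁻¹ᵁ V))
  have key : Function.Bijective (φ V hV) := by
    refine bijective_of_basis hP φ (fun V W hV hW z => ?_)
      (fun V hV pV => (hb V hV pV).comp (biprod_bijective O O V)) V hV
    change _ = ro X (f.preimage_mono hW) (_ + _ * _)
    rw [map_add, map_mul, ro_ro, ← app_ro, ← app_ro, ← toRing_rs, ← toRing_rs, ← app_rs, ← app_rs]
  exact (Function.Bijective.of_comp_iff _ (biprod_bijective O O V)).mp key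

/-- A basis over an affine open set is a basis over all smaller open sets. -/
lemma bijective_of_le (f : X ⟶ Y) [IsAffineHom f] {U : Y.Opens} (hU : IsAffineOpen U)
    {s : Γ(X, f ⁻¹ᵁ U)}
    (h : Function.Bijective fun p : Γ(Y, U) × Γ(Y, U) => f.app U p.1 + f.app U p.2 * s)
    (V : Y.Opens) (hV : V ≤ U) : Function.Bijective fun p : Γ(Y, V) × Γ(Y, V) =>
      f.app V p.1 + f.app V p.2 * ro X (f.preimage_mono hV) s := by
  refine bijective_of_locally f (U := U) (P := fun V => ∃ a : Γ(Y, U), V = Y.basicOpen a)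
    (fun x hx W hW => ?_) (fun V hV ⟨a, ha⟩ => ?_) V hV
  · obtain ⟨a, ha, hxa⟩ := hU.exists_basicOpen_le ⟨x, hW⟩ hx
    exact ⟨_, ha, hxa, Y.basicOpen_le a, a, rfl⟩
  · have hb := bijective_basicOpen f hU a (e₀ := 1) (e₁ := s) (V := V) (by
      let := (f.app U).hom.toAlgebra
      have hsm (a : Γ(Y, U)) (x : Γ(X, f ⁻¹ᵁ U)) : a • x = f.app U a * x := Algebra.smul_def a x
      refine ⟨fun b => ?_, fun x y hxy => ⟨0, ?_⟩⟩
      · obtain ⟨⟨x, y⟩, rfl⟩ := h.2 b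
        exact ⟨0, x, y, by simp [hsm]⟩
      · have := h.1 (a₁ := (x, y)) (a₂ := (0, 0)) (by simpa [hsm] using hxy)
        simpa using this) hV ha
    simpa only [map_one, mul_one] using hb

/-- The functions that vanish at a point form a prime ideal. -/
lemma exists_prime_of_mem {U : Y.Opens} {y : Y} (hy : y ∈ U) :
    ∃ p : Ideal Γ(Y, U), p.IsPrime ∧ ∀ a, a ∉ p ↔ y ∈ Y.basicOpen a := by
  refine ⟨(IsLocalRing.maximalIdeal (Y.presheaf.stalk y)).comap (Y.presheaf.germ U y hy).hom,
    inferInstance, fun a => ?_⟩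
  rw [Ideal.mem_comap, IsLocalRing.notMem_maximalIdeal]
  exact (Y.mem_basicOpen a y hy).symm

/-- Finite étale covers of degree two of schemes on which `2` is invertible are locally generated
by square roots of units, by completing the square. -/
lemma isBasisOf_isSpecial (h2 : IsUnit (2 : Γ(Y, ⊤))) (f : X ⟶ Y) [IsFinite f] [Etale f]
    (hf : ∀ y, f.finrank y = 2) :
    IsBasisOf fun U : Y.Opens => ∃ s : Γ(X, f ⁻¹ᵁ U), IsSpecial f s := by
  intro W y hy
  obtain ⟨_, ⟨U, hU, rfl⟩, hyU, hUW⟩ := Y.isBasis_affineOpens.exists_subset_of_mem_open hy W.2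
  -- a basis `e₀, e₁` on a smaller open set
  obtain ⟨V, hV, hyV, hVaff, e₀, e₁, he⟩ : ∃ V ≤ U, y ∈ V ∧ IsAffineOpen V ∧
      ∃ e₀ e₁ : Γ(X, f ⁻¹ᵁ V), Function.Bijective fun p : Γ(Y, V) × Γ(Y, V) =>
        f.app V p.1 * e₀ + f.app V p.2 * e₁ := by
    let := (f.app U).hom.toAlgebra
    have : Module.Finite Γ(Y, U) Γ(X, f ⁻¹ᵁ U) := f.finite_app U hU
    have hflat := f.flat_appLE hU (hU.preimage f) le_rfl
    rw [← Scheme.Hom.app_eq_appLE] at hflat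
    have : Module.Flat Γ(Y, U) Γ(X, f ⁻¹ᵁ U) := hflat
    obtain ⟨p, hp, hpa⟩ := exists_prime_of_mem hyU
    obtain ⟨a, ha, e₀, e₁, he⟩ := exists_isBasisAway (rankAtStalk_eq f hf hU) p
    exact ⟨Y.basicOpen a, Y.basicOpen_le a, (hpa a).mp ha, hU.basicOpen a, _, _,
      bijective_basicOpen f hU a he (Y.basicOpen_le a) rfl⟩
  -- a basis `1, e` on a smaller open set
  obtain ⟨W', hW', hyW', hWaff, e, hb⟩ : ∃ W' ≤ V, y ∈ W' ∧ IsAffineOpen W' ∧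
      ∃ e : Γ(X, f ⁻¹ᵁ W'), Function.Bijective fun p : Γ(Y, W') × Γ(Y, W') =>
        f.app W' p.1 + f.app W' p.2 * e := by
    let := (f.app V).hom.toAlgebra
    have hsm (a : Γ(Y, V)) (x : Γ(X, f ⁻¹ᵁ V)) : a • x = f.app V a * x := Algebra.smul_def a x
    have one {e₀ e₁ : Γ(X, f ⁻¹ᵁ V)} {x y' : Γ(Y, V)}
        (he : Function.Bijective fun p : Γ(Y, V) × Γ(Y, V) => p.1 • e₀ + p.2 • e₁)
        (h1 : 1 = x • e₀ + y' • e₁) (hx : y ∈ Y.basicOpen x) : ∃ W' ≤ V, y ∈ W' ∧ IsAffineOpen W' ∧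
        ∃ e : Γ(X, f ⁻¹ᵁ W'), Function.Bijective fun p : Γ(Y, W') × Γ(Y, W') =>
          f.app W' p.1 + f.app W' p.2 * e := by
      have := bijective_basicOpen f hVaff x (isBasisAway_one he h1) (Y.basicOpen_le x) rfl
      simp only [map_one, mul_one] at this
      exact ⟨Y.basicOpen x, Y.basicOpen_le x, hx, hVaff.basicOpen x, _, this⟩
    simp only [← hsm] at he
    obtain ⟨⟨x, y'⟩, h1⟩ := he.2 1
    obtain ⟨p, hp, hpa⟩ := exists_prime_of_mem hyV
    rcases notMem_or_notMem_of_one_eq he h1.symm p with hx | hx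
    · exact one he h1.symm ((hpa x).mp hx)
    · refine one (e₀ := e₁) (e₁ := e₀) (y' := x) ?_ (h1.symm.trans (add_comm _ _)) ((hpa y').mp hx)
      have h3 : (fun p : Γ(Y, V) × Γ(Y, V) => p.1 • e₁ + p.2 • e₀) =
          (fun p : Γ(Y, V) × Γ(Y, V) => p.1 • e₀ + p.2 • e₁) ∘ Prod.swap :=
        funext fun p => add_comm _ _
      rw [h3]
      exact he.comp Prod.swap_bijective
  -- completing the square, with `c = 1/2`: `e² = u + v e` gives `(e - v/2)² = u + (v/2)²`
  obtain ⟨⟨u, v⟩, huv⟩ := hb.2 (e * e)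
  obtain ⟨c, hc⟩ := (isUnit_two h2 W').exists_left_inv
  have hc' : f.app W' c * 2 = 1 := by
    have := congrArg (f.app W') hc
    rwa [map_mul, map_one, map_ofNat] at this
  let s : Γ(X, f ⁻¹ᵁ W') := e - f.app W' (c * v)
  have hs : s * s = f.app W' (u + c * v * (c * v)) := by
    change f.app W' u + f.app W' v * e = e * e at huv
    simp only [s, map_add, map_mul]
    linear_combination -huv - f.app W' v * e * hc'
  have hbs : Function.Bijective fun p : Γ(Y, W') × Γ(Y, W') => f.app W' p.1 + f.app W' p.2 * s := by
    have h3 : (fun p : Γ(Y, W') × Γ(Y, W') => f.app W' p.1 + f.app W' p.2 * s) =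
        (fun p : Γ(Y, W') × Γ(Y, W') => f.app W' p.1 + f.app W' p.2 * e) ∘
          fun p => (p.1 - p.2 * (c * v), p.2) := by
      funext p
      simp only [s, Function.comp, map_sub, map_mul]
      ring
    rw [h3]
    refine hb.comp ⟨fun p q hpq => ?_, fun p => ⟨(p.1 + p.2 * (c * v), p.2), ?_⟩⟩
    · obtain ⟨h4, h5⟩ := Prod.mk.inj hpq
      rw [h5] at h4
      exact Prod.ext (sub_left_injective h4) h5
    · exact Prod.ext (add_sub_cancel_right _ _) rfl
  refine ⟨W', hW'.trans (hV.trans hUW), hyW', s, ⟨⟨_, ?_, hs⟩, bijective_of_le f hWaff hbs⟩⟩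
  let := (f.app W').hom.toAlgebra
  have : Module.Finite Γ(Y, W') Γ(X, f ⁻¹ᵁ W') := f.finite_app W' hWaff
  have het := f.etale_appLE hWaff (hWaff.preimage f) le_rfl
  rw [← Scheme.Hom.app_eq_appLE] at het
  have : Algebra.Etale Γ(Y, W') Γ(X, f ⁻¹ᵁ W') := het
  refine isUnit_of_formallyUnramified (B := Γ(X, f ⁻¹ᵁ W')) (s := s) ?_ hs
  have hsm (a : Γ(Y, W')) (x : Γ(X, f ⁻¹ᵁ W')) : a • x = f.app W' a * x := Algebra.smul_def a x
  simpa only [hsm, mul_one] using hbs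

end LocalStructure

/-! ### The relative spectrum of `𝒪 ⊕ L` is a Galois cover -/

section Quadratic

/-- In `A[s]` with `s² = d` and `2d` invertible, `2s · ds = 0` forces the differentials to
vanish. -/
lemma formallyUnramified_of_sq {A B : Type u} [CommRing A] [CommRing B] [Algebra A B]
    {s : B} {d : A}
    (h : Function.Surjective fun p : A × A => p.1 • (1 : B) + p.2 • s)
    (hs : s * s = algebraMap A B d) (hd : IsUnit d) (h2 : IsUnit (2 : A)) :
    Algebra.FormallyUnramified A B := by
  constructor
  have hsu : IsUnit (2 * s) := by
    have h3 : IsUnit (s * s) := hs ▸ hd.map (algebraMap A B)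
    have h4 : IsUnit (2 : B) := by
      have := h2.map (algebraMap A B)
      rwa [map_ofNat] at this
    exact h4.mul (isUnit_of_mul_isUnit_left h3)
  have hDs : KaehlerDifferential.D A B s = 0 := by
    have h3 := congrArg (KaehlerDifferential.D A B) hs
    rw [Derivation.leibniz, Derivation.map_algebraMap, ← add_smul, ← two_mul] at h3
    exact (hsu.smul_eq_zero).mp h3
  have hD (b : B) : KaehlerDifferential.D A B b = 0 := by
    obtain ⟨p, rfl⟩ := h b
    simp only [map_add, Derivation.map_smul, hDs, Derivation.map_one_eq_zero, smul_zero, add_zero]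
  have htop := KaehlerDifferential.span_range_derivation A B
  have : Set.range (KaehlerDifferential.D A B) ⊆ {0} := by
    rintro _ ⟨b, rfl⟩
    exact hD b
  rw [← Submodule.subsingleton_iff B, ← subsingleton_iff_bot_eq_top, ← htop, eq_comm]
  exact Submodule.span_eq_bot.mpr fun x hx => this hx

/-- The linear equivalence `A × A ≃ B` given by a basis. -/
def basisEquiv {A B : Type*} [CommRing A] [CommRing B] [Algebra A B] {e₀ e₁ : B}
    (h : Function.Bijective fun p : A × A => p.1 • e₀ + p.2 • e₁) : (A × A) ≃ₗ[A] B :=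
  LinearEquiv.ofBijective
    { toFun := fun p => p.1 • e₀ + p.2 • e₁
      map_add' := fun p q => by simp only [Prod.fst_add, Prod.snd_add, add_smul]; abel
      map_smul' := fun c p => by simp [mul_smul] } h

end Quadratic

section Galois

variable {X Y : Scheme.{u}} {f : X ⟶ Y} {L : TorsionBundle Y}
  {lam : L.L ⟶ pushforwardStructureSheaf f}

/-- Properties of affine morphisms that are local on the base may be checked on rings. -/
lemma of_SpecMap_app {P : MorphismProperty Scheme.{u}} (_ : IsZariskiLocalAtTarget P)
    (_ : P.IsStableUnderBaseChange) [IsAffineHom f]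
    (h : ∀ y : Y, ∃ U : Y.Opens, y ∈ U ∧ IsAffineOpen U ∧ P (Spec.map (f.app U))) : P f := by
  choose U hyU hU hP using h
  refine IsZariskiLocalAtTarget.of_iSup_eq_top U
    (top_unique fun y _ => TopologicalSpace.Opens.mem_iSup.mpr ⟨y, hyU y⟩) fun y => ?_
  have t := isPullback_fromSpec f (hU y)
  have hι : (hU y).isoSpec.hom ≫ (hU y).fromSpec = (U y).ι := (hU y).isoSpec_hom_fromSpec
  have w : (f ⁻¹ᵁ U y).ι ≫ f = (f ∣_ U y ≫ (hU y).isoSpec.hom) ≫ (hU y).fromSpec := by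
    rw [Category.assoc, hι, morphismRestrict_ι]
  refine P.of_isPullback (IsPullback.of_right (h₁₁ := t.lift _ _ w) (h₂₁ := (hU y).isoSpec.hom)
    ?_ (t.lift_snd _ _ w) t) (hP y)
  rw [t.lift_fst, hι]
  exact (isPullback_morphismRestrict f (U y)).flip

/-- Local description of the relative spectrum of `𝒪 ⊕ L`. -/
lemma IsTwistedSum.exists_quadratic (hl : IsTwistedSum lam) (y : Y) :
    ∃ U : Y.Opens, y ∈ U ∧ IsAffineOpen U ∧ ∃ (s : Γ(X, f ⁻¹ᵁ U)) (d : Γ(Y, U)),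
      letI := (f.app U).hom.toAlgebra
      IsUnit d ∧ s * s = algebraMap Γ(Y, U) Γ(X, f ⁻¹ᵁ U) d ∧
        Function.Bijective fun p : Γ(Y, U) × Γ(Y, U) => p.1 • (1 : Γ(X, f ⁻¹ᵁ U)) + p.2 • s := by
  obtain ⟨U, s, -, hU, hy, hs⟩ := exists_affine_isGen L y ⊤ trivial
  have h := hl.isSpecial hs
  obtain ⟨d, hd, hsd⟩ := h.sq
  refine ⟨U, hy, hU, value lam s, d, hd, hsd, ?_⟩
  let := (f.app U).hom.toAlgebra
  have hsm (a : Γ(Y, U)) (x : Γ(X, f ⁻¹ᵁ U)) : a • x = f.app U a * x := Algebra.smul_def a x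
  have := h.bij U le_rfl
  simpa only [hsm, mul_one, ro_self] using this

lemma IsTwistedSum.isFinite [IsAffineHom f] (hl : IsTwistedSum lam) : IsFinite f := by
  -- finite morphisms are the proper affine ones
  refine IsFinite.iff_isProper_and_isAffineHom.mpr ⟨?_, inferInstance⟩
  refine of_SpecMap_app (P := @IsProper) inferInstance inferInstance fun y => ?_
  obtain ⟨U, hy, hU, s, d, -, -, h⟩ := hl.exists_quadratic y
  let := (f.app U).hom.toAlgebra
  have : Module.Finite Γ(Y, U) Γ(X, f ⁻¹ᵁ U) := Module.Finite.equiv (basisEquiv h)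
  have : IsFinite (Spec.map (f.app U)) := (IsFinite.SpecMap_iff _).mpr this
  exact ⟨U, hy, hU, inferInstanceAs (IsProper (Spec.map (f.app U)))⟩

lemma IsTwistedSum.flat [IsAffineHom f] (hl : IsTwistedSum lam) : Flat f := by
  refine of_SpecMap_app (HasRingHomProperty.instIsZariskiLocalAtTarget (@Flat)
    (Q := RingHom.Flat)) inferInstance fun y => ?_
  obtain ⟨U, hy, hU, s, d, -, -, h⟩ := hl.exists_quadratic y
  let := (f.app U).hom.toAlgebra
  refine ⟨U, hy, hU, Flat.SpecMap_iff.mpr ?_⟩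
  have : Module.Flat Γ(Y, U) Γ(X, f ⁻¹ᵁ U) := Module.Flat.of_linearEquiv (basisEquiv h).symm
  exact this

lemma IsTwistedSum.etale [IsAffineHom f] (hl : IsTwistedSum lam) (h2 : IsUnit (2 : Γ(Y, ⊤))) :
    Etale f := by
  refine of_SpecMap_app (HasRingHomProperty.instIsZariskiLocalAtTarget (@Etale)
    (Q := RingHom.Etale)) inferInstance fun y => ?_
  obtain ⟨U, hy, hU, s, d, hd, hs, h⟩ := hl.exists_quadratic y
  let := (f.app U).hom.toAlgebra
  refine ⟨U, hy, hU, (HasRingHomProperty.Spec_iff (P := @Etale)).mpr ?_⟩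
  have : Module.Flat Γ(Y, U) Γ(X, f ⁻¹ᵁ U) := Module.Flat.of_linearEquiv (basisEquiv h).symm
  have : Module.Free Γ(Y, U) Γ(X, f ⁻¹ᵁ U) := Module.Free.of_equiv (basisEquiv h)
  have : Module.Finite Γ(Y, U) Γ(X, f ⁻¹ᵁ U) := Module.Finite.equiv (basisEquiv h)
  have : Module.FinitePresentation Γ(Y, U) Γ(X, f ⁻¹ᵁ U) :=
    Module.finitePresentation_of_projective _ _
  have : Algebra.FinitePresentation Γ(Y, U) Γ(X, f ⁻¹ᵁ U) := inferInstance
  have : Algebra.FormallyUnramified Γ(Y, U) Γ(X, f ⁻¹ᵁ U) :=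
    formallyUnramified_of_sq h.2 hs hd (isUnit_two h2 U)
  have : Algebra.Etale Γ(Y, U) Γ(X, f ⁻¹ᵁ U) := .of_formallyUnramified_of_flat
  exact this

lemma IsTwistedSum.finrank_eq [IsAffineHom f] (hl : IsTwistedSum lam) (y : Y) :
    f.finrank y = 2 := by
  have := hl.isFinite
  have := hl.flat
  obtain ⟨U, hy, hU, s, d, hd, hs, h⟩ := hl.exists_quadratic y
  let := (f.app U).hom.toAlgebra
  obtain ⟨q, rfl⟩ : ∃ q, hU.fromSpec q = y := by
    have : y ∈ hU.fromSpec.opensRange := by rwa [hU.opensRange_fromSpec]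
    exact this
  refine (Scheme.Hom.finrank_of_isPullback _ _ _ _ (isPullback_fromSpec f hU) q).symm.trans ?_
  have : Module.Finite Γ(Y, U) Γ(X, f ⁻¹ᵁ U) := Module.Finite.equiv (basisEquiv h)
  have : Module.Free Γ(Y, U) Γ(X, f ⁻¹ᵁ U) := Module.Free.of_equiv (basisEquiv h)
  refine (Scheme.Hom.finrank_SpecMap_algebraMap Γ(Y, U) Γ(X, f ⁻¹ᵁ U) q).trans ?_
  have : Nontrivial Γ(Y, U) := PrimeSpectrum.nontrivial q
  rw [Module.rankAtStalk_eq_finrank_of_free]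
  have := (basisEquiv h).finrank_eq
  rw [Module.finrank_prod, Module.finrank_self] at this
  exact this.symm

/-- Two points of the relative spectrum of `𝒪 ⊕ L` with values in a field and the same image in
`Y` agree up to the involution, as the values of a generator have the same square. -/
lemma IsTwistedSum.eq_or_eq [IsAffineHom f] (hl : IsTwistedSum lam) {σ : X ⟶ X} (hσ : σ ≫ f = f)
    (hσl : ∀ (U : Y.Opens) (_ : IsAffineOpen U) (s : Γ(L.L, U)),
      σ.appLE (f ⁻¹ᵁ U) (f ⁻¹ᵁ U) (le_preimage hσ U) (value lam s) = -value lam s)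
    {T : Scheme.{u}} [IsIntegral T] [Subsingleton T] (v w : T ⟶ X) (h : v ≫ f = w ≫ f) :
    w = v ∨ w = v ≫ σ := by
  obtain ⟨z⟩ := (inferInstance : Nonempty T)
  obtain ⟨U, s, -, hU, hz, hs⟩ := exists_affine_isGen L ((v ≫ f) z) ⊤ trivial
  let W := (v ≫ f) ⁻¹ᵁ U
  have : Nonempty W := ⟨⟨z, hz⟩⟩
  have hv := le_preimage (k := v) (f := f) rfl U
  have hw := le_preimage h.symm U
  have hvσ : (v ≫ σ) ≫ f = v ≫ f := by rw [Category.assoc, hσ]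
  let a : Γ(T, W) := v.appLE (f ⁻¹ᵁ U) W hv (value lam s)
  let b : Γ(T, W) := w.appLE (f ⁻¹ᵁ U) W hw (value lam s)
  have hab : b * b = a * a := by
    have h1 := hl.mul U s s
    simp only [a, b]
    rw [← map_mul, ← map_mul, h1, appLE_app (f := f) h.symm, appLE_app (f := f) rfl]
  have hx (x : T) : (v ≫ f) x ∈ U := by
    rwa [Subsingleton.elim x z]
  rcases mul_self_eq_mul_self_iff.mp hab with hb | hb
  · exact Or.inl (hl.hom_ext h.symm rfl fun x => ⟨U, s, hU, hx x, hs, hb⟩)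
  · refine Or.inr (hl.hom_ext h.symm hvσ fun x => ⟨U, s, hU, hx x, hs, ?_⟩)
    rw [appLE_comp_apply v σ (V := f ⁻¹ᵁ U) hv (le_preimage hσ U), hσl U hU, map_neg]
    exact hb

/-- The involution has no fixed points with values in a field. -/
lemma IsTwistedSum.comp_involution_ne (hl : IsTwistedSum lam) (h2 : IsUnit (2 : Γ(Y, ⊤)))
    {σ : X ⟶ X} (hσ : σ ≫ f = f)
    (hσl : ∀ (U : Y.Opens) (_ : IsAffineOpen U) (s : Γ(L.L, U)),
      σ.appLE (f ⁻¹ᵁ U) (f ⁻¹ᵁ U) (le_preimage hσ U) (value lam s) = -value lam s)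
    {T : Scheme.{u}} [Nonempty T] (v : T ⟶ X) : v ≫ σ ≠ v := by
  intro h
  obtain ⟨z⟩ := (inferInstance : Nonempty T)
  obtain ⟨U, s, -, hU, hz, hs⟩ := exists_affine_isGen L ((v ≫ f) z) ⊤ trivial
  let W := (v ≫ f) ⁻¹ᵁ U
  have : Nonempty W := ⟨⟨z, hz⟩⟩
  have hv := le_preimage (k := v) (f := f) rfl U
  have hvσ := le_preimage (k := v ≫ σ) (f := f) (g := v ≫ f) (by rw [Category.assoc, hσ]) U
  let φ := (v.appLE (f ⁻¹ᵁ U) W hv).hom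
  have h1 : φ (value lam s) = -φ (value lam s) := by
    have h3 := appLE_comp_apply v σ (V := f ⁻¹ᵁ U) hv (le_preimage hσ U) hvσ (value lam s)
    rw [hσl U hU, map_neg] at h3
    simp only [h] at h3
    exact h3
  have h3 : 2 * φ (value lam s) = 0 := by linear_combination h1
  have h4 : IsUnit (2 * φ (value lam s)) := by
    obtain ⟨d, hd, hsd⟩ := (hl.isSpecial hs).sq
    have h5 : IsUnit (value lam s * value lam s) := hsd ▸ hd.map (f.app U).hom
    have h6 := ((isUnit_two h2 U).map (f.app U).hom).map φ
    rw [map_ofNat, map_ofNat] at h6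
    exact h6.mul ((isUnit_of_mul_isUnit_left h5).map φ)
  rw [h3] at h4
  exact not_isUnit_zero h4

/-- The self-product of the relative spectrum of `𝒪 ⊕ L` is the disjoint union of the diagonal and
of the graph of the involution. -/
lemma IsTwistedSum.isTrivialCover [IsAffineHom f] (hl : IsTwistedSum lam)
    (h2 : IsUnit (2 : Γ(Y, ⊤))) : IsTrivialCover (pullback.fst f f) := by
  have := hl.etale h2
  obtain ⟨σ, hσ, hσl⟩ := hl.exists_involution
  let τ : Fin 2 → (X ⟶ X) := ![𝟙 X, σ]
  have hτ (i : Fin 2) : τ i ≫ f = f := by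
    fin_cases i
    · exact Category.id_comp f
    · exact hσ
  let k (i : Fin 2) : X ⟶ pullback f f :=
    pullback.lift (𝟙 X) (τ i) (by rw [Category.id_comp, hτ])
  have hk (i : Fin 2) : k i ≫ pullback.fst f f = 𝟙 X := pullback.lift_fst _ _ _
  have hk' (i : Fin 2) : k i ≫ pullback.snd f f = τ i := pullback.lift_snd _ _ _
  -- sections of an étale morphism are open immersions
  have (i : Fin 2) : IsOpenImmersion (k i) := by
    have : Etale (k i ≫ pullback.fst f f) := by rw [hk]; infer_instance
    have : Etale (k i) := MorphismProperty.of_postcomp @Etale (k i) (pullback.fst f f)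
      (W' := @Etale) inferInstance this
    have : Mono (k i) := by
      have : Mono (k i ≫ pullback.fst f f) := by rw [hk]; infer_instance
      exact mono_of_mono (k i) (pullback.fst f f)
    exact IsOpenImmersion.of_flat_of_mono _
  have lift (i : Fin 2) (z : ↑(pullback f f)) (hz : z ∈ (k i).opensRange) :
      ∃ w, w ≫ k i = (pullback f f).fromSpecResidueField z := by
    refine ⟨IsOpenImmersion.lift (k i) _ ?_, IsOpenImmersion.lift_fac _ _ _⟩
    rw [Scheme.range_fromSpecResidueField]
    exact Set.singleton_subset_iff.mpr hz
  have hcov : ⨆ i, (k i).opensRange = ⊤ := by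
    refine top_unique fun z _ => TopologicalSpace.Opens.mem_iSup.mpr ?_
    let ζ := (pullback f f).fromSpecResidueField z
    have hζ : z ∈ Set.range ζ := by
      rw [Scheme.range_fromSpecResidueField]
      rfl
    have key (i : Fin 2) (h : ζ ≫ pullback.snd f f = (ζ ≫ pullback.fst f f) ≫ τ i) :
        z ∈ (k i).opensRange := by
      have h3 : ζ = (ζ ≫ pullback.fst f f) ≫ k i := by
        apply pullback.hom_ext
        · rw [Category.assoc _ (k i), hk, Category.comp_id]
        · rw [Category.assoc _ (k i), hk', h]
      obtain ⟨x, hx⟩ := hζ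
      rw [h3] at hx
      exact ⟨_, hx⟩
    have : Subsingleton (Spec ((pullback f f).residueField z)) :=
      inferInstanceAs (Subsingleton (PrimeSpectrum ((pullback f f).residueField z)))
    rcases hl.eq_or_eq hσ hσl (ζ ≫ pullback.fst f f) (ζ ≫ pullback.snd f f) (by
      rw [Category.assoc, Category.assoc, pullback.condition]) with h | h
    · exact ⟨0, key 0 (h.trans (Category.comp_id _).symm)⟩
    · exact ⟨1, key 1 h⟩
  have hdisj : _root_.Pairwise (Function.onFun Disjoint fun i => (k i).opensRange) := by
    have key (z : ↑(pullback f f)) (h0 : z ∈ (k 0).opensRange) (h1 : z ∈ (k 1).opensRange) :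
        False := by
      obtain ⟨v, hv⟩ := lift 0 z h0
      obtain ⟨w, hw⟩ := lift 1 z h1
      have h3 : v = w := by
        have := congr($(hv.trans hw.symm) ≫ pullback.fst f f)
        simpa only [Category.assoc, hk, Category.comp_id] using this
      have h4 : v = w ≫ σ := by
        have := congr($(hv.trans hw.symm) ≫ pullback.snd f f)
        rw [Category.assoc, Category.assoc, hk', hk'] at this
        exact (Category.comp_id v).symm.trans this
      have : Nonempty (Spec ((pullback f f).residueField z)) :=
        inferInstanceAs (Nonempty (PrimeSpectrum ((pullback f f).residueField z)))
      exact hl.comp_involution_ne h2 hσ hσl w (h4.symm.trans h3)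
    intro i j hij
    rw [Function.onFun, disjoint_iff]
    refine bot_unique fun z hz => (?_ : False)
    obtain ⟨hi, hj⟩ := hz
    fin_cases i <;> fin_cases j
    · exact hij rfl
    · exact key z hi hj
    · exact key z hj hi
    · exact hij rfl
  obtain ⟨hc⟩ := nonempty_isColimit_cofanMk_of k hcov hdisj
  refine ⟨2, hc.coconePointUniqueUpToIso (coproductIsCoproduct _), ?_⟩
  refine Cofan.IsColimit.hom_ext hc _ _ fun i => ?_
  have h1 : k i ≫ (hc.coconePointUniqueUpToIso
      (coproductIsCoproduct (fun _ : Fin 2 => X))).hom = Sigma.ι (fun _ : Fin 2 => X) i :=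
    hc.comp_coconePointUniqueUpToIso_hom _ ⟨i⟩
  change k i ≫ _ ≫ _ = k i ≫ _
  rw [reassoc_of% h1, Sigma.ι_desc, hk]

lemma IsTwistedSum.isGaloisCover [IsAffineHom f] (hl : IsTwistedSum lam)
    (h2 : IsUnit (2 : Γ(Y, ⊤))) : IsGaloisCover f where
  isFinite := hl.isFinite
  etale := hl.etale h2
  surjective := by
    have := hl.isFinite
    have := hl.flat
    rw [← Scheme.Hom.one_le_finrank_iff_surjective]
    intro y
    rw [hl.finrank_eq]
    exact one_le_two
  splits := hl.isTrivialCover h2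

end Galois

/-! ### Sections of locally free sheaves over basic open sets -/

section Localization

variable {X : Scheme.{u}} {L : X.Modules}

lemma IsBasisOf.exists_finset {P : X.Opens → Prop} (hP : IsBasisOf P) {U : X.Opens}
    (hU : IsCompact (U : Set X)) :
    ∃ t : Finset X.Opens, (∀ V ∈ t, V ≤ U ∧ P V) ∧ ∀ x ∈ U, ∃ V ∈ t, x ∈ V := by
  classical
  choose V hV hxV pV using fun x : U => hP U x.1 x.2
  obtain ⟨t, ht⟩ := hU.elim_nhds_subcover' (fun x hx => (V ⟨x, hx⟩ : Set X))
    (fun x hx => (V ⟨x, hx⟩).isOpen.mem_nhds (hxV ⟨x, hx⟩))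
  refine ⟨t.image V, ?_, fun x hx => ?_⟩
  · intro W hW
    obtain ⟨x, -, rfl⟩ := Finset.mem_image.mp hW
    exact ⟨hV x, pV x⟩
  · obtain ⟨y, hy, hxy⟩ := Set.mem_iUnion₂.mp (ht hx)
    exact ⟨V y, Finset.mem_image_of_mem V hy, hxy⟩

/-- The affine open sets over which `L` has a generator. -/
def IsTrivializing (L : X.Modules) (U : X.Opens) : Prop :=
  IsAffineOpen U ∧ ∃ s : Γ(L, U), IsGen s

lemma IsLineBundle.isBasisOf_isTrivializing (hL : IsLineBundle L) :
    IsBasisOf (IsTrivializing L) := fun U x hx => by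
  obtain ⟨V, hVU, hxV, s, hs⟩ := hL.isBasisOf U x hx
  obtain ⟨_, ⟨W, hW, rfl⟩, hxW, hWV⟩ := X.isBasis_affineOpens.exists_subset_of_mem_open hxV V.2
  exact ⟨W, le_trans hWV hVU, hxW, hW, rs L hWV s, hs.rs hWV⟩

lemma basicOpen_ro {U V : X.Opens} (h : V ≤ U) (r : Γ(X, U)) :
    X.basicOpen (ro X h r) = V ⊓ X.basicOpen r :=
  X.basicOpen_res r (homOfLE h).op

/-- A section over a quasi-compact open set that vanishes where `r` does not is killed by a power
of `r`. -/
lemma exists_pow_smul_eq_zero (hL : IsLineBundle L) {U V : X.Opens} (r : Γ(X, U)) (h : V ≤ U)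
    (hV : IsCompact (V : Set X)) (s : Γ(L, V))
    (hs : rs L (inf_le_left : V ⊓ X.basicOpen r ≤ V) s = 0) :
    ∃ n : ℕ, ro X h r ^ n • s = 0 := by
  obtain ⟨t, ht, hcov⟩ := hL.isBasisOf_isTrivializing.exists_finset hV
  have hloc (W : X.Opens) (hW : W ∈ t) :
      ∃ n : ℕ, ro X ((ht W hW).1.trans h) r ^ n • rs L (ht W hW).1 s = 0 := by
    have hWV := (ht W hW).1
    obtain ⟨hWa, g, hg⟩ := (ht W hW).2
    obtain ⟨a, ha⟩ := hg.exists_eq (rs L hWV s)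
    have hle : X.basicOpen (ro X (hWV.trans h) r) ≤ W := X.basicOpen_le _
    have hle' : X.basicOpen (ro X (hWV.trans h) r) ≤ V ⊓ X.basicOpen r := by
      rw [basicOpen_ro]
      exact inf_le_inf_right _ hWV
    have h0 : ro X hle a = 0 := by
      apply (hg.rs hle).inj
      rw [zero_smul, ← rs_smul, ← ha, rs_rs, ← rs_rs L inf_le_left hle', hs, map_zero]
    obtain ⟨n, hn⟩ := exists_pow_mul_eq_zero_of_res_basicOpen_eq_zero_of_isCompact X
      hWa.isCompact a _ h0
    exact ⟨n, by rw [ha, smul_smul, hn, zero_smul]⟩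
  choose n hn using hloc
  let N := t.attach.sup fun W => n W.1 W.2
  refine ⟨N, section_ext fun x hx => ?_⟩
  obtain ⟨W, hW, hxW⟩ := hcov x hx
  refine ⟨W, (ht W hW).1, hxW, ?_⟩
  have hle : n W hW ≤ N :=
    Finset.le_sup (f := fun W : t => n W.1 W.2) (Finset.mem_attach t ⟨W, hW⟩)
  rw [rs_smul, map_pow, ro_ro, map_zero, ← Nat.sub_add_cancel hle, pow_add, mul_smul, hn,
    smul_zero]

/-- Every section over the locus where `r` is invertible extends to `U` after multiplication by
a power of `r`. -/
lemma exists_rs_eq_pow_smul (hL : IsLineBundle L) {U : X.Opens} (hU : IsAffineOpen U)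
    (r : Γ(X, U)) (s : Γ(L, X.basicOpen r)) :
    ∃ (n : ℕ) (t : Γ(L, U)), rs L (X.basicOpen_le r) t = ro X (X.basicOpen_le r) r ^ n • s := by
  obtain ⟨t, ht, hcov⟩ := hL.isBasisOf_isTrivializing.exists_finset hU.isCompact
  -- over each of finitely many trivializing open sets, this is the extension of functions
  have hloc (W : X.Opens) (hW : W ∈ t) : ∃ (n : ℕ) (y : Γ(L, W)),
      rs L (inf_le_left : W ⊓ X.basicOpen r ≤ W) y =
        rs L (inf_le_right : W ⊓ X.basicOpen r ≤ _) (ro X (X.basicOpen_le r) r ^ n • s) := by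
    have hWU := (ht W hW).1
    obtain ⟨hWa, g, hg⟩ := (ht W hW).2
    obtain ⟨a, ha⟩ := (hg.rs inf_le_left).exists_eq
      (rs L (inf_le_right : W ⊓ X.basicOpen r ≤ _) s)
    have e : X.basicOpen (ro X hWU r) = W ⊓ X.basicOpen r := basicOpen_ro hWU r
    obtain ⟨n, b, hb⟩ := exists_eq_pow_mul_of_isAffineOpen X W hWa (ro X hWU r)
      (ro X e.le a)
    have hb : ro X (X.basicOpen_le _) b = ro X (X.basicOpen_le _) (ro X hWU r) ^ n *
      ro X e.le a := hb
    have hb' := congrArg (ro X e.ge) hb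
    rw [map_mul, map_pow, ro_ro, ro_ro, ro_ro, ro_ro, ro_self] at hb'
    refine ⟨n, b • g, ?_⟩
    rw [rs_smul, rs_smul, hb', mul_smul, ← ha, map_pow, ro_ro]
  choose n y hy using hloc
  obtain ⟨N, hN⟩ : ∃ N, ∀ W hW, n W hW ≤ N := ⟨t.attach.sup fun W => n W.1 W.2, fun W hW =>
    Finset.le_sup (f := fun W : t => n W.1 W.2) (Finset.mem_attach t ⟨W, hW⟩)⟩
  have hloc' (W : X.Opens) (hW : W ∈ t) : ∃ (z : Γ(L, W)),
      rs L (inf_le_left : W ⊓ X.basicOpen r ≤ W) z =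
        rs L (inf_le_right : W ⊓ X.basicOpen r ≤ _) (ro X (X.basicOpen_le r) r ^ N • s) := by
    obtain ⟨k, hk⟩ := Nat.exists_eq_add_of_le' (hN W hW)
    refine ⟨ro X (ht W hW).1 r ^ k • y W hW, ?_⟩
    rw [rs_smul, hy, hk, pow_add, mul_smul, rs_smul _ _ (_ ^ k), map_pow, map_pow, ro_ro, ro_ro]
  choose z hz using hloc'
  -- the local extensions agree after multiplication by a further power of `r`
  have hag (W W' : t) : ∃ m : ℕ,
      ro X ((inf_le_left : W.1 ⊓ W'.1 ≤ W.1).trans (ht W W.2).1) r ^ m •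
        (rs L (inf_le_left : W.1 ⊓ W'.1 ≤ W.1) (z W W.2) -
        rs L (inf_le_right : W.1 ⊓ W'.1 ≤ W'.1) (z W' W'.2)) = 0 := by
    have hc : IsCompact ((W.1 ⊓ W'.1 : X.Opens) : Set X) :=
      hU.isQuasiSeparated W.1 W'.1 (ht W W.2).1 W.1.2 (ht W W.2).2.1.isCompact
        (ht W' W'.2).1 W'.1.2 (ht W' W'.2).2.1.isCompact
    refine exists_pow_smul_eq_zero hL r (inf_le_left.trans (ht W W.2).1) hc _ ?_
    rw [map_sub, rs_rs, rs_rs,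
      ← rs_rs L (inf_le_left : W.1 ⊓ X.basicOpen r ≤ W.1) (inf_le_inf_right _ inf_le_left), hz,
      ← rs_rs L (inf_le_left : W'.1 ⊓ X.basicOpen r ≤ W'.1) (inf_le_inf_right _ inf_le_right), hz,
      rs_rs, rs_rs, sub_self]
  choose m hm using hag
  let M := Finset.univ.sup fun p : t × t => m p.1 p.2
  have hag' (W W' : t) :
      rs L (inf_le_left : W.1 ⊓ W'.1 ≤ W.1) (ro X (ht W W.2).1 r ^ M • z W W.2) =
        rs L (inf_le_right : W.1 ⊓ W'.1 ≤ W'.1) (ro X (ht W' W'.2).1 r ^ M • z W' W'.2) := by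
    have hle : m W W' ≤ M :=
      Finset.le_sup (f := fun p : t × t => m p.1 p.2) (Finset.mem_univ (W, W'))
    rw [rs_smul, rs_smul, map_pow, map_pow, ro_ro, ro_ro, ← sub_eq_zero, ← smul_sub,
      ← Nat.sub_add_cancel hle, pow_add, mul_smul, hm, smul_zero]
  obtain ⟨x, hx⟩ := section_glue (M := L) (U := U) (P := fun V => ∃ W : t, V ≤ W.1)
    (fun x hx W hxW => by
      obtain ⟨V, hV, hxV⟩ := hcov x hx
      exact ⟨W ⊓ V, inf_le_left, ⟨hxW, hxV⟩, inf_le_right.trans (ht V hV).1, ⟨V, hV⟩,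
        inf_le_right⟩)
    (fun V _ pV => rs L pV.choose_spec
      (ro X (ht _ pV.choose.2).1 r ^ M • z pV.choose pV.choose.2))
    (fun V W hV hW pV pW h => by
      rw [rs_rs, ← rs_rs L inf_le_left (le_inf (h.trans pV.choose_spec) pW.choose_spec), hag',
        rs_rs])
  refine ⟨M + N, x, section_ext fun p hp => ?_⟩
  obtain ⟨W, hW, hpW⟩ := hcov p (X.basicOpen_le r hp)
  refine ⟨W ⊓ X.basicOpen r, inf_le_right, ⟨hpW, hp⟩, ?_⟩
  have pW : ∃ V : t, W ≤ V.1 := ⟨⟨W, hW⟩, le_rfl⟩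
  have h1 := hx W (ht W hW).1 pW
  rw [rs_rs, ← rs_rs L (ht W hW).1 inf_le_left, h1, rs_rs,
    ← rs_rs L (inf_le_left : pW.choose.1 ⊓ X.basicOpen r ≤ _)
      (inf_le_inf_right _ pW.choose_spec), rs_smul _ inf_le_left, hz, pow_add, mul_smul,
      map_pow, ro_ro, rs_smul, rs_rs, map_pow, ro_ro, rs_smul _ _ (_ ^ M), map_pow, ro_ro]

end Localization

/-! ### The double cover defined by a `2`-torsion line bundle -/

section TwistedRing

variable {Y : Scheme.{u}} (L : TorsionBundle Y)

/-- The ring of sections over `U` of the algebra `𝒪_Y ⊕ L`. -/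
@[ext]
structure TwistedRing (U : Y.Opens) where
  /-- the component in `𝒪_Y` -/
  fst : Γ(Y, U)
  /-- the component in `L` -/
  snd : Γ(L.L, U)

namespace TwistedRing

variable {L} {U : Y.Opens}

instance : Add (TwistedRing L U) := ⟨fun x y => ⟨x.fst + y.fst, x.snd + y.snd⟩⟩
instance : Zero (TwistedRing L U) := ⟨⟨0, 0⟩⟩
instance : Neg (TwistedRing L U) := ⟨fun x => ⟨-x.fst, -x.snd⟩⟩
instance : One (TwistedRing L U) := ⟨⟨1, 0⟩⟩
instance : Mul (TwistedRing L U) :=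
  ⟨fun x y => ⟨x.fst * y.fst + L.pair x.snd y.snd, x.fst • y.snd + y.fst • x.snd⟩⟩

@[simp] lemma fst_add (x y : TwistedRing L U) : (x + y).fst = x.fst + y.fst := rfl
@[simp] lemma snd_add (x y : TwistedRing L U) : (x + y).snd = x.snd + y.snd := rfl
@[simp] lemma fst_zero : (0 : TwistedRing L U).fst = 0 := rfl
@[simp] lemma snd_zero : (0 : TwistedRing L U).snd = 0 := rfl
@[simp] lemma fst_neg (x : TwistedRing L U) : (-x).fst = -x.fst := rfl
@[simp] lemma snd_neg (x : TwistedRing L U) : (-x).snd = -x.snd := rfl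
@[simp] lemma fst_one : (1 : TwistedRing L U).fst = 1 := rfl
@[simp] lemma snd_one : (1 : TwistedRing L U).snd = 0 := rfl
@[simp] lemma fst_mul (x y : TwistedRing L U) :
    (x * y).fst = x.fst * y.fst + L.pair x.snd y.snd := rfl
@[simp] lemma snd_mul (x y : TwistedRing L U) :
    (x * y).snd = x.fst • y.snd + y.fst • x.snd := rfl

lemma pair_zero_left (s : Γ(L.L, U)) : L.pair 0 s = 0 := by
  simpa using L.pair_smul_left 0 0 s

lemma pair_zero_right (s : Γ(L.L, U)) : L.pair s 0 = 0 := by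
  simpa using L.pair_smul_right 0 s 0

instance : CommRing (TwistedRing L U) where
  add_assoc x y z := by ext <;> simp [add_assoc]
  zero_add x := by ext <;> simp
  add_zero x := by ext <;> simp
  add_comm x y := by ext <;> simp [add_comm]
  neg_add_cancel x := by ext <;> simp
  nsmul := nsmulRec
  zsmul := zsmulRec
  left_distrib x y z := by
    ext
    · simp [mul_add, L.pair_add_right]; abel
    · simp [smul_add, add_smul]; abel
  right_distrib x y z := by
    ext
    · simp [add_mul, L.pair_add_left]; abel
    · simp [smul_add, add_smul]; abel
  zero_mul x := by ext <;> simp [pair_zero_left]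
  mul_zero x := by ext <;> simp [pair_zero_right]
  one_mul x := by ext <;> simp [pair_zero_left]
  mul_one x := by ext <;> simp [pair_zero_right]
  mul_comm x y := by
    ext
    · simp [mul_comm, L.pair_comm]
    · simp [add_comm]
  mul_assoc x y z := by
    ext
    · simp only [fst_mul, snd_mul, L.pair_add_right, L.pair_add_left, L.pair_smul_right,
        L.pair_smul_left]
      ring
    · simp only [fst_mul, snd_mul, smul_add, add_smul, smul_smul]
      rw [L.pair_smul_comm x.snd y.snd z.snd, mul_comm z.fst, mul_comm z.fst]
      abel

/-- The structure map `𝒪_Y(U) → (𝒪_Y ⊕ L)(U)`. -/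
def algebraMap (L : TorsionBundle Y) (U : Y.Opens) : Γ(Y, U) →+* TwistedRing L U where
  toFun a := ⟨a, 0⟩
  map_one' := rfl
  map_zero' := rfl
  map_add' a b := by ext <;> simp
  map_mul' a b := by ext <;> simp [pair_zero_left]

/-- Restriction of sections of `𝒪_Y ⊕ L`. -/
def restrict (L : TorsionBundle Y) {U V : Y.Opens} (h : V ≤ U) :
    TwistedRing L U →+* TwistedRing L V where
  toFun x := ⟨ro Y h x.fst, rs L.L h x.snd⟩
  map_one' := by ext <;> simp
  map_zero' := by ext <;> simp
  map_add' a b := by ext <;> simp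
  map_mul' a b := by ext <;> simp [L.pair_rs]

lemma algebraMap_pow_mul (a : Γ(Y, U)) (n : ℕ) (x : TwistedRing L U) :
    algebraMap L U a ^ n * x = ⟨a ^ n * x.fst, a ^ n • x.snd⟩ := by
  rw [← map_pow]
  ext <;> simp [algebraMap, pair_zero_left]

lemma restrict_eq_iff {V : Y.Opens} (h : V ≤ U) (x y : TwistedRing L U) :
    restrict L h x = restrict L h y ↔
      ro Y h x.fst = ro Y h y.fst ∧ rs L.L h x.snd = rs L.L h y.snd :=
  TwistedRing.ext_iff

/-- The algebra `𝒪_Y ⊕ L` is quasi-coherent. -/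
lemma isLocalizationAway_restrict (hU : IsAffineOpen U) (r : Γ(Y, U)) :
    letI := (restrict L (Y.basicOpen_le r)).toAlgebra
    IsLocalization.Away (algebraMap L U r) (TwistedRing L (Y.basicOpen r)) := by
  let := (restrict L (Y.basicOpen_le r)).toAlgebra
  have hr (n : ℕ) : restrict L (Y.basicOpen_le r) (algebraMap L U r) ^ n =
      algebraMap L _ (ro Y (Y.basicOpen_le r) r) ^ n := by
    congr 1
    ext <;> simp [restrict, algebraMap]
  refine IsLocalization.Away.mk _ ?_ ?_ ?_
  · have h := hr 1
    rw [pow_one, pow_one] at h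
    rw [RingHom.algebraMap_toAlgebra, h]
    exact (Y.toRingedSpace.isUnit_res_basicOpen r).map _
  · intro s
    obtain ⟨n, a, ha⟩ := exists_eq_pow_mul_of_isAffineOpen Y U hU r s.fst
    obtain ⟨m, t, ht⟩ := exists_rs_eq_pow_smul L.isLineBundle hU r s.snd
    have ha : ro Y (Y.basicOpen_le r) a = ro Y (Y.basicOpen_le r) r ^ n * s.fst := ha
    refine ⟨n + m, ⟨r ^ m * a, r ^ n • t⟩, ?_⟩
    rw [RingHom.algebraMap_toAlgebra, hr, mul_comm, algebraMap_pow_mul]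
    ext
    · simp only [restrict, RingHom.coe_mk, MonoidHom.coe_mk, OneHom.coe_mk, map_mul, map_pow, ha]
      ring
    · simp only [restrict, RingHom.coe_mk, MonoidHom.coe_mk, OneHom.coe_mk, rs_smul, map_pow, ht,
        smul_smul, pow_add]
  · intro a b hab
    obtain ⟨h1, h2⟩ := (restrict_eq_iff (Y.basicOpen_le r) a b).mp hab
    obtain ⟨n, hn⟩ := exists_pow_mul_eq_zero_of_res_basicOpen_eq_zero_of_isCompact Y
      hU.isCompact (a.fst - b.fst) r (by
        change ro Y (Y.basicOpen_le r) (a.fst - b.fst) = 0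
        rw [map_sub, h1, sub_self])
    obtain ⟨m, hm⟩ := exists_pow_smul_eq_zero L.isLineBundle r le_rfl hU.isCompact (a.snd - b.snd)
      (by
        rw [map_sub, sub_eq_zero]
        have := congrArg (rs L.L (inf_le_right : U ⊓ Y.basicOpen r ≤ _)) h2
        rwa [rs_rs, rs_rs] at this)
    rw [ro_self, smul_sub, sub_eq_zero] at hm
    rw [mul_sub, sub_eq_zero] at hn
    refine ⟨n + m, ?_⟩
    rw [algebraMap_pow_mul, algebraMap_pow_mul]
    ext
    · simp only [pow_add, mul_right_comm _ (r ^ m), hn]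
    · simp only [pow_add, mul_smul, hm]

end TwistedRing

open Scheme AffineZariskiSite

/-- The presheaf of rings `𝒪_Y ⊕ L` on the affine open sets. -/
def twistedPresheaf : Y.AffineZariskiSiteᵒᵖ ⥤ CommRingCat.{u} where
  obj U := .of (TwistedRing L U.unop.1)
  map i := CommRingCat.ofHom (TwistedRing.restrict L (toOpens_mono i.unop.le))
  map_id U := by
    refine CommRingCat.hom_ext (RingHom.ext fun (x : TwistedRing L U.unop.1) => ?_)
    exact TwistedRing.ext (ro_self le_rfl x.fst) (rs_self L.L le_rfl x.snd)
  map_comp i j := by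
    refine CommRingCat.hom_ext (RingHom.ext fun (x : TwistedRing L _) => ?_)
    exact TwistedRing.ext (ro_ro _ _ x.fst).symm (rs_rs L.L _ _ x.snd).symm

/-- The structure map `𝒪_Y ⟶ 𝒪_Y ⊕ L`. -/
def twistedPresheafMap : (toOpensFunctor Y).op ⋙ Y.presheaf ⟶ twistedPresheaf L where
  app U := CommRingCat.ofHom (TwistedRing.algebraMap L U.unop.1)
  naturality U V i := by
    ext a
    exact TwistedRing.ext rfl (map_zero (rs L.L (toOpens_mono i.unop.le))).symm

lemma coequifibered_twistedPresheafMap : (twistedPresheafMap L).Coequifibered :=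
  coequifibered_iff_forall_isLocalizationAway.mpr fun U r =>
    TwistedRing.isLocalizationAway_restrict U.2 r

/-- The gluing data of the affine schemes `Spec (𝒪_Y ⊕ L)(U)`. -/
def twistedGluingData := relativeGluingData (coequifibered_twistedPresheafMap L)

end TwistedRing

/-- For a chart `j : Spec R ⟶ X` over `U`, the composite `𝒪_Y(U) → 𝒪_X(f⁻¹ U) → R` is the given
ring homomorphism `α`. -/
lemma app_appLE_ΓSpecIso {X Y : Scheme.{u}} {f : X ⟶ Y} {U : Y.Opens} (hU : IsAffineOpen U)
    {R : CommRingCat.{u}} (α : Γ(Y, U) ⟶ R) {j : Spec R ⟶ X}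
    (h : j ≫ f = Spec.map α ≫ hU.fromSpec) (e : ⊤ ≤ j ⁻¹ᵁ f ⁻¹ᵁ U) :
    f.app U ≫ j.appLE (f ⁻¹ᵁ U) ⊤ e ≫ (Scheme.ΓSpecIso R).hom = α := by
  have h0 : (⊤ : (Spec Γ(Y, U)).Opens) ≤ hU.fromSpec ⁻¹ᵁ U := hU.fromSpec_preimage_self.ge
  have h1 : hU.fromSpec.appLE U ⊤ h0 = (Scheme.ΓSpecIso _).inv := by
    rw [Scheme.Hom.appLE, hU.fromSpec_app_self, Category.assoc, ← Functor.map_comp]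
    exact (congrArg _ ((Spec Γ(Y, U)).presheaf.map_id _)).trans (Category.comp_id _)
  have h3 : ⊤ ≤ (Spec.map α ≫ hU.fromSpec) ⁻¹ᵁ U := by
    rw [← h]
    exact e
  have h2 : f.app U ≫ j.appLE (f ⁻¹ᵁ U) ⊤ e = (Spec.map α ≫ hU.fromSpec).appLE U ⊤ h3 := by
    have h5 : ⊤ ≤ (j ≫ f) ⁻¹ᵁ U := by
      rw [h]
      exact h3
    refine (Scheme.Hom.comp_appLE j f U ⊤ h5).symm.trans ?_
    simp only [h]
  rw [reassoc_of% h2, ← Scheme.Hom.appLE_comp_appLE _ _ _ _ _ h0 le_top, h1, Category.assoc]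
  have h4 : (Spec.map α).appLE ⊤ ⊤ le_top = (Spec.map α).appTop := Scheme.Hom.appLE_eq_app _
  rw [h4, Scheme.ΓSpecIso_naturality, Iso.inv_hom_id_assoc]

/-- Reading functions on `X` in the charts `j` and `j'` commutes with restriction, which becomes the
transition map `ρ`. -/
lemma map_appLE_ΓSpecIso {X : Scheme.{u}} {U V : X.Opens} {R S : CommRingCat.{u}} (ρ : R ⟶ S)
    {j : Spec R ⟶ X} {j' : Spec S ⟶ X} (h : Spec.map ρ ≫ j = j') (hVU : V ≤ U)
    (e : ⊤ ≤ j ⁻¹ᵁ U) (e' : ⊤ ≤ j' ⁻¹ᵁ V) :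
    X.presheaf.map (homOfLE hVU).op ≫ j'.appLE V ⊤ e' ≫ (Scheme.ΓSpecIso S).hom =
      (j.appLE U ⊤ e ≫ (Scheme.ΓSpecIso R).hom) ≫ ρ := by
  subst h
  have h4 : (Spec.map ρ).appLE ⊤ ⊤ le_top = (Spec.map ρ).appTop := Scheme.Hom.appLE_eq_app _
  rw [Scheme.Hom.map_appLE_assoc, ← Scheme.Hom.appLE_comp_appLE _ _ _ _ _ e le_top, h4,
    Category.assoc, Scheme.ΓSpecIso_naturality, Category.assoc]

section Cover

open Scheme AffineZariskiSite

variable {Y : Scheme.{u}} (L : TorsionBundle Y)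

instance : ((twistedGluingData L).functor ⋙ Scheme.forget).IsLocallyDirected :=
  Cover.RelativeGluingData.instIsLocallyDirectedI₀CompFunctorForgetOfIsThin ..

/-- The double cover of `Y` defined by `L`, glued from the schemes `Spec (𝒪_Y ⊕ L)(U)` for
affine open sets `U`. -/
def twistedCover : Scheme.{u} := (twistedGluingData L).glued

/-- The structure morphism of the double cover. -/
def twistedCoverMap : twistedCover L ⟶ Y := (twistedGluingData L).toBase

/-- The chart of the double cover over an affine open set. -/
def chart (U : Y.AffineZariskiSite) : Spec (.of (TwistedRing L U.1)) ⟶ twistedCover L :=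
  (twistedGluingData L).cover.f U

instance (U : Y.AffineZariskiSite) : IsOpenImmersion (chart L U) :=
  (twistedGluingData L).cover.map_prop U

lemma chart_comp (U : Y.AffineZariskiSite) :
    chart L U ≫ twistedCoverMap L =
      Spec.map (CommRingCat.ofHom (TwistedRing.algebraMap L U.1)) ≫ U.2.fromSpec :=
  colimit.ι_desc _ _

/-- The charts are compatible with restriction along the basic open inclusions that are the
morphisms of the affine Zariski site. -/
lemma restrict_chart {U V : Y.AffineZariskiSite} (i : V ⟶ U) :
    Spec.map (CommRingCat.ofHom (TwistedRing.restrict L (toOpens_mono i.le))) ≫ chart L U =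
      chart L V :=
  colimit.w (twistedGluingData L).functor i

lemma range_chart (U : Y.AffineZariskiSite) :
    twistedCoverMap L ⁻¹ᵁ U.1 = (chart L U).opensRange := by
  simpa using! (twistedGluingData L).toBase_preimage_eq_opensRange_ι U

instance : IsAffineHom (twistedCoverMap L) where
  isAffine_preimage U hU := by
    have h := isAffineOpen_opensRange (chart L (show Y.AffineZariskiSite from ⟨U, hU⟩))
    rwa [← range_chart] at h

lemma chart_le (U : Y.AffineZariskiSite) : ⊤ ≤ chart L U ⁻¹ᵁ twistedCoverMap L ⁻¹ᵁ U.1 := by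
  rw [range_chart, Scheme.Hom.preimage_opensRange]

/-- Functions over the preimage of an affine open set `U` as elements of `(𝒪_Y ⊕ L)(U)`. -/
def chartRing (U : Y.AffineZariskiSite) :
    Γ(twistedCover L, twistedCoverMap L ⁻¹ᵁ U.1) →+* TwistedRing L U.1 :=
  ((chart L U).appLE (twistedCoverMap L ⁻¹ᵁ U.1) ⊤ (chart_le L U) ≫
    (Scheme.ΓSpecIso (.of (TwistedRing L U.1))).hom).hom

lemma chartRing_bijective (U : Y.AffineZariskiSite) : Function.Bijective (chartRing L U) := by
  have : IsIso ((chart L U).appLE (twistedCoverMap L ⁻¹ᵁ U.1) ⊤ (chart_le L U)) := by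
    have h1 : IsIso ((chart L U).app (twistedCoverMap L ⁻¹ᵁ U.1)) :=
      (chart L U).isIso_app _ (range_chart L U).le
    rw [Scheme.Hom.appLE]
    have e : (⊤ : (Spec (.of (TwistedRing L U.1))).Opens) =
      chart L U ⁻¹ᵁ twistedCoverMap L ⁻¹ᵁ U.1 := top_unique (chart_le L U) |>.symm
    have : IsIso (homOfLE (chart_le L U)) := (homOfLE_isIso_of_eq _ e)
    infer_instance
  have : IsIso ((chart L U).appLE (twistedCoverMap L ⁻¹ᵁ U.1) ⊤ (chart_le L U) ≫
    (Scheme.ΓSpecIso (.of (TwistedRing L U.1))).hom) := inferInstance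
  exact ConcreteCategory.bijective_of_isIso _

lemma chartRing_app (U : Y.AffineZariskiSite) (a : Γ(Y, U.1)) :
    chartRing L U ((twistedCoverMap L).app U.1 a) = TwistedRing.algebraMap L U.1 a :=
  ConcreteCategory.congr_hom (app_appLE_ΓSpecIso U.2
    (CommRingCat.ofHom (TwistedRing.algebraMap L U.1)) (chart_comp L U) (chart_le L U)) a

lemma chartRing_ro {U V : Y.AffineZariskiSite} (i : V ⟶ U)
    (h : V.1 ≤ U.1) (x : Γ(twistedCover L, twistedCoverMap L ⁻¹ᵁ U.1)) :
    chartRing L V (ro _ ((twistedCoverMap L).preimage_mono h) x) =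
      TwistedRing.restrict L h (chartRing L U x) :=
  ConcreteCategory.congr_hom (map_appLE_ΓSpecIso _ (restrict_chart L i)
    ((twistedCoverMap L).preimage_mono h) (chart_le L U) (chart_le L V)) x

lemma isBasisOf_isAffineOpen : IsBasisOf fun U : Y.Opens => IsAffineOpen U := fun U x hx => by
  obtain ⟨_, ⟨W, hW, rfl⟩, hxW, hWU⟩ := Y.isBasis_affineOpens.exists_subset_of_mem_open hx U.2
  exact ⟨W, hWU, hxW, hW⟩

/-- The double cover glued from the rings `(𝒪_Y ⊕ L)(U)` is a relative spectrum of
`𝒪_Y ⊕ L`. -/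
lemma exists_isTwistedSum_twistedCoverMap :
    ∃ lam : L.L ⟶ pushforwardStructureSheaf (twistedCoverMap L), IsTwistedSum lam := by
  let f := twistedCoverMap L
  let c (U : Y.Opens) (hU : IsAffineOpen U) : Γ(twistedCover L, f ⁻¹ᵁ U) →+* TwistedRing L U :=
    chartRing L ⟨U, hU⟩
  have hc (U : Y.Opens) (hU : IsAffineOpen U) : Function.Bijective (c U hU) :=
    chartRing_bijective L ⟨U, hU⟩
  have happ (U : Y.Opens) (hU : IsAffineOpen U) (a : Γ(Y, U)) :
      c U hU (f.app U a) = ⟨a, 0⟩ := chartRing_app L ⟨U, hU⟩ a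
  have hro (U V : Y.Opens) (hU : IsAffineOpen U) (hV : IsAffineOpen V) (r : Γ(Y, U))
      (e : V = Y.basicOpen r) (h : V ≤ U) (x : Γ(twistedCover L, f ⁻¹ᵁ U)) :
      c V hV (ro _ (f.preimage_mono h) x) = TwistedRing.restrict L h (c U hU x) :=
    chartRing_ro L (U := ⟨U, hU⟩) (V := ⟨V, hV⟩) (homOfLE ⟨r, e.symm⟩) h x
  choose φ hφ using fun (U : Y.Opens) (hU : IsAffineOpen U) (s : Γ(L.L, U)) => (hc U hU).2 ⟨0, s⟩
  -- restriction to arbitrary affine open subsets reduces to common basic open subsets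
  have hrs (U V : Y.Opens) (hU : IsAffineOpen U) (hV : IsAffineOpen V) (h : V ≤ U)
      (s : Γ(L.L, U)) : φ V hV (rs L.L h s) = ro _ (f.preimage_mono h) (φ U hU s) := by
    refine function_ext fun x hx => ?_
    obtain ⟨r, r', e, hxr⟩ := exists_basicOpen_le_affine_inter hU hV (f x) ⟨h hx, hx⟩
    refine ⟨f ⁻¹ᵁ Y.basicOpen r', f.preimage_mono (Y.basicOpen_le r'), by rw [← e]; exact hxr, ?_⟩
    have hW := hV.basicOpen r'
    apply (hc _ hW).1
    rw [ro_ro, hro V _ hV hW r' rfl (Y.basicOpen_le r'),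
      hro U _ hU hW r e.symm ((Y.basicOpen_le r').trans h), hφ, hφ]
    ext
    · simp [TwistedRing.restrict]
    · exact rs_rs L.L h (Y.basicOpen_le r') s
  obtain ⟨lam, hlam⟩ := exists_value (M := L.L) isBasisOf_isAffineOpen f φ
    (fun U hU s t => (hc U hU).1 (by rw [map_add, hφ, hφ, hφ]; ext <;> simp))
    (fun U hU a s => (hc U hU).1 (by
      rw [map_mul, happ, hφ, hφ]
      ext <;> simp [TwistedRing.pair_zero_left]))
    hrs
  refine ⟨lam, IsTwistedSum.of_basis isBasisOf_isAffineOpen (fun U hU s t => (hc U hU).1 ?_)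
    fun U hU => ?_⟩
  · rw [hlam U hU, hlam U hU, map_mul, hφ, hφ, happ]
    ext <;> simp
  · have h (p : Γ(Y, U) × Γ(L.L, U)) :
        c U hU (f.app U p.1 + value lam p.2) = ⟨p.1, p.2⟩ := by
      rw [map_add, happ, hlam U hU, hφ]
      ext <;> simp
    constructor
    · intro p q hpq
      have := congrArg (c U hU) hpq
      rw [h, h] at this
      exact Prod.ext congr(($this).fst) congr(($this).snd)
    · intro x
      refine ⟨((c U hU x).fst, (c U hU x).snd), (hc U hU).1 (h _)⟩

end Cover

/-! ### Base change of special functions -/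

section SpecialBaseChange

/-- If `1, s` is a basis of `B` over `A`, its image is a basis of `C ⊗_A B` over `C`. -/
lemma bijective_of_isPushout {A B C D : CommRingCat.{u}} {α : A ⟶ B} {β : A ⟶ C} {γ : B ⟶ D}
    {δ : C ⟶ D} (h : IsPushout α β γ δ) {s : B}
    (hs : Function.Bijective fun p : A × A => α.hom p.1 + α.hom p.2 * s) :
    Function.Bijective fun p : C × C => δ.hom p.1 + δ.hom p.2 * γ.hom s := by
  algebraize [α.hom, β.hom, γ.hom, δ.hom, γ.hom.comp α.hom]
  have : IsScalarTower A C D := .of_algebraMap_eq' congr(($(h.w)).hom)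
  have hp : Algebra.IsPushout A C B D := (CommRingCat.isPushout_iff_isPushout ..).mp h.flip
  have hs' : Function.Bijective fun p : A × A => p.1 • (1 : B) + p.2 • s := by
    simpa only [Algebra.smul_def, mul_one] using! hs
  let b : Module.Basis (Fin 2) A B := (Module.Basis.finTwoProd A).map (basisEquiv hs')
  let c : Module.Basis (Fin 2) C D := hp.out.basis b
  have e : (fun p : C × C => δ.hom p.1 + δ.hom p.2 * γ.hom s) =
      c.equivFun.symm ∘ (LinearEquiv.finTwoArrow C C).symm := by
    have hb0 : b 0 = 1 := by simp [b, basisEquiv]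
    have hb1 : b 1 = s := by simp [b, basisEquiv]
    have h0 : c 0 = 1 := (hp.out.basis_apply b 0).trans (by
      rw [hb0]; exact map_one (algebraMap B D))
    have h1 : c 1 = γ.hom s := (hp.out.basis_apply b 1).trans (by rw [hb1]; rfl)
    funext p
    simp [Module.Basis.equivFun_symm_apply, h0, h1, Algebra.smul_def,
      RingHom.algebraMap_toAlgebra]
  rw [e]
  exact c.equivFun.symm.bijective.comp (LinearEquiv.finTwoArrow C C).symm.bijective

variable {X Y X' Y' : Scheme.{u}} {f : X ⟶ Y} {g : Y' ⟶ Y} {f' : X' ⟶ Y'} {k : X' ⟶ X}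

/-- Functions on the base change of `f⁻¹ U` over an affine open set `W`. -/
lemma isPushout_of_isPullback [IsAffineHom f] (h : IsPullback k f' f g) {U : Y.Opens}
    (hU : IsAffineOpen U) {W : Y'.Opens} (hW : IsAffineOpen W) (e : W ≤ g ⁻¹ᵁ U)
    (e' : f' ⁻¹ᵁ W ≤ k ⁻¹ᵁ f ⁻¹ᵁ U) :
    IsPushout (f.app U) (g.appLE U W e) (k.appLE (f ⁻¹ᵁ U) (f' ⁻¹ᵁ W) e') (f'.app W) := by
  have : IsAffineHom f' := MorphismProperty.of_isPullback h inferInstance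
  have h1 := (isPullback_fromSpec f' hW).flip.paste_vert h.flip
  have w : f.app U ≫ k.appLE (f ⁻¹ᵁ U) (f' ⁻¹ᵁ W) e' = g.appLE U W e ≫ f'.app W := by
    rw [Scheme.Hom.app_eq_appLE f, Scheme.Hom.app_eq_appLE f', Scheme.Hom.appLE_comp_appLE,
      Scheme.Hom.appLE_comp_appLE]
    simp only [h.w]
  have h2 : IsPullback (Spec.map (k.appLE (f ⁻¹ᵁ U) (f' ⁻¹ᵁ W) e')) (Spec.map (f'.app W))
      (Spec.map (f.app U)) (Spec.map (g.appLE U W e)) := by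
    refine IsPullback.of_right (h₁₂ := (hU.preimage f).fromSpec) (h₂₂ := hU.fromSpec) (v₁₃ := f)
      ?_ ?_ (isPullback_fromSpec f hU)
    · rw [hU.SpecMap_appLE_fromSpec g hW, (hU.preimage f).SpecMap_appLE_fromSpec k (hW.preimage f')]
      exact h1.flip
    · rw [← Spec.map_comp, ← Spec.map_comp, w]
  exact (IsPullback.of_map Scheme.Spec (congrArg Quiver.Hom.op w) h2).unop.flip

/-- The pullback along `k` of a function on `f⁻¹ U`. -/
def pullFun (w : k ≫ f = f' ≫ g) {U : Y.Opens} :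
    Γ(X, f ⁻¹ᵁ U) →+* Γ(X', f' ⁻¹ᵁ g ⁻¹ᵁ U) :=
  (k.appLE (f ⁻¹ᵁ U) (f' ⁻¹ᵁ g ⁻¹ᵁ U) (le_preimage w U)).hom

lemma pullFun_app (w : k ≫ f = f' ≫ g) {U : Y.Opens} (a : Γ(Y, U)) :
    pullFun w (f.app U a) = f'.app (g ⁻¹ᵁ U) (g.app U a) :=
  appLE_app w (le_preimage w U) a

lemma ro_appLE (k : X' ⟶ X) {U V : X.Opens} {U' V' : X'.Opens} (h : V ≤ U) (h' : V' ≤ U')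
    (e : U' ≤ k ⁻¹ᵁ U) (e' : V' ≤ k ⁻¹ᵁ V) (x : Γ(X, U)) :
    k.appLE V V' e' (ro X h x) = ro X' h' (k.appLE U U' e x) := by
  have h1 : X.presheaf.map (homOfLE h).op ≫ k.appLE V V' e' =
      k.appLE U U' e ≫ X'.presheaf.map (homOfLE h').op := by
    rw [Scheme.Hom.map_appLE, Scheme.Hom.appLE_map]
  exact ConcreteCategory.congr_hom h1 x

lemma pullFun_ro (w : k ≫ f = f' ≫ g) {U V : Y.Opens} (h : V ≤ U) (x : Γ(X, f ⁻¹ᵁ U)) :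
    pullFun w (ro X (f.preimage_mono h) x) =
      ro X' (f'.preimage_mono (g.preimage_mono h)) (pullFun w x) :=
  ro_appLE k _ _ _ _ x

/-- Special functions are stable under base change. Being a basis is checked on affine open sets
that lie over affine open sets of `Y`, where base change is a pushout of rings. -/
lemma IsSpecial.pullFun [IsAffineHom f] (h : IsPullback k f' f g) {U : Y.Opens}
    {s : Γ(X, f ⁻¹ᵁ U)} (hs : IsSpecial f s) : IsSpecial f' (pullFun h.w s) where
  sq := by
    obtain ⟨d, hd, hsd⟩ := hs.sq
    exact ⟨g.app U d, hd.map (g.app U).hom, by rw [← map_mul, hsd, pullFun_app]⟩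
  bij := by
    refine bijective_of_locally f' (P := fun W => IsAffineOpen W ∧
      ∃ V : Y.Opens, V ≤ U ∧ IsAffineOpen V ∧ W ≤ g ⁻¹ᵁ V) (fun x hx W hxW => ?_)
      fun W hWU ⟨hW, V, hVU, hV, hWV⟩ => ?_
    · obtain ⟨V, hVU, hxV, hV⟩ := isBasisOf_isAffineOpen U (g x) hx
      obtain ⟨W', hW', hxW', hW'a⟩ := isBasisOf_isAffineOpen (W ⊓ g ⁻¹ᵁ V) x ⟨hxW, hxV⟩
      exact ⟨W', hW'.trans inf_le_left, hxW',
        (hW'.trans inf_le_right).trans (g.preimage_mono hVU), hW'a, V, hVU, hV,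
        hW'.trans inf_le_right⟩
    · have e' : f' ⁻¹ᵁ W ≤ k ⁻¹ᵁ f ⁻¹ᵁ V := (f'.preimage_mono hWV).trans (le_preimage h.w V)
      have h1 := bijective_of_isPushout (isPushout_of_isPullback h hV hW hWV e')
        (hs.bij V hVU)
      have h2 : k.appLE (f ⁻¹ᵁ V) (f' ⁻¹ᵁ W) e' (ro X (f.preimage_mono hVU) s) =
          ro X' (f'.preimage_mono hWU) (DoubleCover.pullFun h.w s) := ro_appLE k _ _ _ _ s
      rw [← h2]
      exact h1

end SpecialBaseChange

/-! ### Base change of `2`-torsion line bundles -/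

section BaseChange

variable {Y Y' : Scheme.{u}} {g : Y' ⟶ Y}

lemma pullbackSection_smul {M : Y.Modules} {U : Y.Opens} (a : Γ(Y, U)) (s : Γ(M, U)) :
    TorsionBundle.pullbackSection g (a • s) =
      g.app U a • TorsionBundle.pullbackSection g s :=
  Scheme.Modules.Hom.app_smul ((Scheme.Modules.pullbackPushforwardAdjunction g).unit.app M) a s

lemma pullbackSection_rs {M : Y.Modules} {U V : Y.Opens} (h : V ≤ U) (s : Γ(M, U)) :
    TorsionBundle.pullbackSection g (rs M h s) =
      rs _ (g.preimage_mono h) (TorsionBundle.pullbackSection g s) :=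
  app_rs ((Scheme.Modules.pullbackPushforwardAdjunction g).unit.app M) h s

/-- The value of a morphism `M ⟶ g_* N` on a section of `M`, as a section of `N`. -/
def pushApp {M : Y.Modules} {N : Y'.Modules} (ν : M ⟶ (Scheme.Modules.pushforward g).obj N)
    {U : Y.Opens} (s : Γ(M, U)) : Γ(N, g ⁻¹ᵁ U) := ν.app U s

lemma pushApp_smul {M : Y.Modules} {N : Y'.Modules}
    (ν : M ⟶ (Scheme.Modules.pushforward g).obj N) {U : Y.Opens} (a : Γ(Y, U)) (s : Γ(M, U)) :
    pushApp ν (a • s) = g.app U a • pushApp ν s :=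
  Scheme.Modules.Hom.app_smul ν a s

lemma pushApp_rs {M : Y.Modules} {N : Y'.Modules}
    (ν : M ⟶ (Scheme.Modules.pushforward g).obj N) {U V : Y.Opens} (h : V ≤ U) (s : Γ(M, U)) :
    pushApp ν (rs M h s) = rs N (g.preimage_mono h) (pushApp ν s) :=
  app_rs ν h s

/-- Morphisms out of `g^* M` are determined by their values on pullbacks of sections. -/
lemma pullback_hom_ext {M : Y.Modules} {N : Y'.Modules}
    {φ ψ : (Scheme.Modules.pullback g).obj M ⟶ N}
    (h : ∀ (U : Y.Opens) (s : Γ(M, U)), φ.app (g ⁻¹ᵁ U) (TorsionBundle.pullbackSection g s) =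
      ψ.app (g ⁻¹ᵁ U) (TorsionBundle.pullbackSection g s)) : φ = ψ := by
  apply ((Scheme.Modules.pullbackPushforwardAdjunction g).homEquiv M N).injective
  rw [Adjunction.homEquiv_unit, Adjunction.homEquiv_unit]
  exact modules_hom_ext h

/-- The adjunction of `g^*` and `g_*` on local sections. -/
lemma exists_pullback_hom {M : Y.Modules} {N : Y'.Modules}
    (ν : M ⟶ (Scheme.Modules.pushforward g).obj N) :
    ∃ φ : (Scheme.Modules.pullback g).obj M ⟶ N, ∀ (U : Y.Opens) (s : Γ(M, U)),
      φ.app (g ⁻¹ᵁ U) (TorsionBundle.pullbackSection g s) = pushApp ν s := by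
  let A := Scheme.Modules.pullbackPushforwardAdjunction g
  refine ⟨(A.homEquiv M N).symm ν, fun U s => ?_⟩
  have h := A.homEquiv_unit (f := (A.homEquiv M N).symm ν)
  rw [Equiv.apply_symm_apply] at h
  exact ConcreteCategory.congr_hom (congr(($h).app U)).symm s

lemma IsGen.exists_linearMap {X : Scheme.{u}} {L M : X.Modules} {U : X.Opens} {s : Γ(L, U)}
    (hs : IsGen s) (m : Γ(M, U)) : ∃ θ : Γ(L, U) →ₗ[Γ(X, U)] Γ(M, U), θ s = m := by
  have hb : Function.Bijective (LinearMap.toSpanSingleton Γ(X, U) Γ(L, U) s) := by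
    simpa using! hs U le_rfl
  let e := LinearEquiv.ofBijective _ hb
  refine ⟨(LinearMap.toSpanSingleton Γ(X, U) Γ(M, U) m).comp e.symm.toLinearMap, ?_⟩
  have he : e.symm s = 1 := by
    rw [LinearEquiv.symm_apply_eq]
    simp [e]
  simp [he]

/-- A morphism `M ⟶ g_* N` that takes local generators to local generators makes `N` the
pullback of `M`: the inverse of `g^* M ⟶ N` is given by `a • ν(s) ↦ a • g^* s`, where `s` is a
local generator of `M`. -/
lemma exists_pullback_iso {M : Y.Modules} {N : Y'.Modules} (hM : IsLineBundle M)
    (ν : M ⟶ (Scheme.Modules.pushforward g).obj N)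
    (hν : ∀ (U : Y.Opens) (s : Γ(M, U)), IsGen s → IsGen (pushApp ν s)) :
    ∃ e : (Scheme.Modules.pullback g).obj M ≅ N, ∀ (U : Y.Opens) (s : Γ(M, U)),
      e.hom.app (g ⁻¹ᵁ U) (TorsionBundle.pullbackSection g s) = pushApp ν s := by
  obtain ⟨φ, hφ⟩ := exists_pullback_hom ν
  let G := (Scheme.Modules.pullback g).obj M
  let P (W : Y'.Opens) : Prop := ∃ (U : Y.Opens) (s : Γ(M, U)), IsGen s ∧ W ≤ g ⁻¹ᵁ U
  have hP : IsBasisOf P := fun W x hx => by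
    obtain ⟨U, -, hxU, s, hs⟩ := hM.isBasisOf ⊤ (g x) trivial
    exact ⟨W ⊓ g ⁻¹ᵁ U, inf_le_left, ⟨hx, hxU⟩, U, s, hs, inf_le_right⟩
  have hθ (W : Y'.Opens) (pW : P W) : ∃ θ : Γ(N, W) →ₗ[Γ(Y', W)] Γ(G, W),
      ∀ (U : Y.Opens) (hU : W ≤ g ⁻¹ᵁ U) (s : Γ(M, U)), θ (rs N hU (pushApp ν s)) =
        rs G hU (TorsionBundle.pullbackSection g s) := by
    obtain ⟨U₀, s₀, hs₀, hW⟩ := pW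
    obtain ⟨θ, h0⟩ := ((hν U₀ s₀ hs₀).rs hW).exists_linearMap
      (rs G hW (TorsionBundle.pullbackSection g s₀))
    refine ⟨θ, fun U hU s => ?_⟩
    obtain ⟨c, hc⟩ := (hs₀.rs (inf_le_left : U₀ ⊓ U ≤ U₀)).exists_eq
      (rs M (inf_le_right : U₀ ⊓ U ≤ U) s)
    have hle : W ≤ g ⁻¹ᵁ (U₀ ⊓ U) := le_inf hW hU
    have h1 := congrArg (fun t => rs N hle (pushApp ν t)) hc
    have h2 := congrArg (fun t => rs G hle (TorsionBundle.pullbackSection g t)) hc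
    simp only [pushApp_smul, pushApp_rs, rs_smul, rs_rs] at h1
    simp only [pullbackSection_smul, pullbackSection_rs, rs_smul, rs_rs, G] at h2
    rw [h1, map_smul, h0]
    exact h2.symm
  choose θ hθ using hθ
  have hgen (W : Y'.Opens) (pW : P W) (n : Γ(N, W)) : ∃ (U : Y.Opens) (s : Γ(M, U))
      (hW : W ≤ g ⁻¹ᵁ U) (a : Γ(Y', W)), n = a • rs N hW (pushApp ν s) := by
    obtain ⟨U, s, hs, hW⟩ := pW
    obtain ⟨a, ha⟩ := ((hν U s hs).rs hW).exists_eq n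
    exact ⟨U, s, hW, a, ha⟩
  obtain ⟨ψ, hψ⟩ := exists_hom_of_basis hP θ (fun W V pW pV h n => by
    obtain ⟨U, s, hW, a, rfl⟩ := hgen W pW n
    rw [rs_smul, map_smul, map_smul, rs_rs, hθ, hθ, rs_smul, rs_rs])
  have hψs (U : Y.Opens) (s : Γ(M, U)) : ψ.app (g ⁻¹ᵁ U) (pushApp ν s) =
      TorsionBundle.pullbackSection g s := by
    refine section_ext fun x hx => ?_
    obtain ⟨W, hWU, hxW, pW⟩ := hP (g ⁻¹ᵁ U) x hx
    exact ⟨W, hWU, hxW, by rw [← app_rs, hψ W pW, hθ]⟩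
  refine ⟨⟨φ, ψ, ?_, ?_⟩, hφ⟩
  · refine pullback_hom_ext fun U s => ?_
    exact (congrArg (ψ.app (g ⁻¹ᵁ U)) (hφ U s)).trans (hψs U s)
  · refine modules_hom_ext fun W n => section_ext fun x hx => ?_
    obtain ⟨V, hVW, hxV, pV⟩ := hP W x hx
    refine ⟨V, hVW, hxV, ?_⟩
    rw [← app_rs, ← app_rs]
    obtain ⟨U, s, hV, a, ha⟩ := hgen V pV (rs N hVW n)
    rw [ha]
    have h1 : φ.app V (ψ.app V (a • rs N hV (pushApp ν s))) = a • rs N hV (pushApp ν s) := by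
      rw [Scheme.Modules.Hom.app_smul, app_rs, hψs, Scheme.Modules.Hom.app_smul, app_rs, hφ]
    exact h1

end BaseChange

section TorsionBaseChange

variable {Y Y' : Scheme.{u}} {g : Y' ⟶ Y}

lemma pullbackSection_map {M N : Y.Modules} (ι : M ⟶ N) {U : Y.Opens} (s : Γ(M, U)) :
    ((Scheme.Modules.pullback g).map ι).app (g ⁻¹ᵁ U) (TorsionBundle.pullbackSection g s) =
      TorsionBundle.pullbackSection g (ι.app U s) :=
  (ConcreteCategory.congr_hom congr(($((Scheme.Modules.pullbackPushforwardAdjunction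
    g).unit.naturality ι)).app U) s).symm

namespace TorsionBundle

variable {L L₁ : TorsionBundle Y} {L' L'' : TorsionBundle Y'}

/-- Locally, the pullback of some section of `L` generates a base change of `L`. -/
lemma exists_isGen_pullbackSection (e : (Scheme.Modules.pullback g).obj L.L ≅ L'.L)
    (he : ∀ (U : Y.Opens) (s t : Γ(L.L, U)),
      L'.pair (e.hom.app (g ⁻¹ᵁ U) (pullbackSection g s))
        (e.hom.app (g ⁻¹ᵁ U) (pullbackSection g t)) = g.app U (L.pair s t))
    (x : Y') : ∃ (U : Y.Opens) (s : Γ(L.L, U)), x ∈ g ⁻¹ᵁ U ∧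
      IsGen (e.hom.app (g ⁻¹ᵁ U) (pullbackSection g s)) := by
  obtain ⟨U, -, hxU, s, hs⟩ := L.exists_isGen (g x) ⊤ trivial
  refine ⟨U, s, hxU, L'.isGen_of_isUnit_pair ?_⟩
  rw [he]
  exact (L.isUnit_pair hs).map (g.app U).hom

/-- The base change is unique up to isomorphism. -/
lemma IsBaseChange.isIsomorphic (h : L.IsBaseChange g L') (h' : L.IsBaseChange g L'') :
    L'.IsIsomorphic L'' := by
  obtain ⟨e, he⟩ := h
  obtain ⟨e', he'⟩ := h'
  have hι (U : Y.Opens) (s : Γ(L.L, U)) : (e.symm ≪≫ e').hom.app (g ⁻¹ᵁ U)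
      (e.hom.app (g ⁻¹ᵁ U) (pullbackSection g s)) =
        e'.hom.app (g ⁻¹ᵁ U) (pullbackSection g s) :=
    ConcreteCategory.congr_hom congr(($(e.hom_inv_id_assoc e'.hom)).app (g ⁻¹ᵁ U)) _
  refine isIsomorphic_of_pair (e.symm ≪≫ e') fun V s t => function_ext fun x hx => ?_
  obtain ⟨U, r, hxU, hr⟩ := exists_isGen_pullbackSection e he x
  refine ⟨V ⊓ g ⁻¹ᵁ U, inf_le_left, ⟨hx, hxU⟩, ?_⟩
  obtain ⟨a, ha⟩ := (hr.rs (inf_le_right : V ⊓ g ⁻¹ᵁ U ≤ _)).exists_eq (rs L'.L inf_le_left s)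
  obtain ⟨b, hb⟩ := (hr.rs (inf_le_right : V ⊓ g ⁻¹ᵁ U ≤ _)).exists_eq (rs L'.L inf_le_left t)
  rw [← pair_rs, ← pair_rs, ← app_rs, ← app_rs, ha, hb, Scheme.Modules.Hom.app_smul,
    Scheme.Modules.Hom.app_smul, app_rs, hι, pair_smul_left, pair_smul_left, pair_smul_right,
    pair_smul_right, pair_rs, pair_rs, he, he']

lemma IsBaseChange.trans_isIsomorphic (h : L.IsBaseChange g L') (h' : L'.IsIsomorphic L'') :
    L.IsBaseChange g L'' := by
  obtain ⟨e, he⟩ := h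
  obtain ⟨ι, hι⟩ := h'.exists_pair
  exact ⟨e ≪≫ ι, fun U s t => (hι _ _ _).trans (he U s t)⟩

lemma IsIsomorphic.trans_isBaseChange (h : L₁.IsIsomorphic L) (h' : L.IsBaseChange g L') :
    L₁.IsBaseChange g L' := by
  obtain ⟨e, he⟩ := h'
  obtain ⟨ι, hι⟩ := h.exists_pair
  refine ⟨(Scheme.Modules.pullback g).mapIso ι ≪≫ e, fun U s t => ?_⟩
  have h1 (s : Γ(L₁.L, U)) : ((Scheme.Modules.pullback g).mapIso ι ≪≫ e).hom.app (g ⁻¹ᵁ U)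
      (pullbackSection g s) = e.hom.app (g ⁻¹ᵁ U) (pullbackSection g (ι.hom.app U s)) :=
    congrArg (e.hom.app (g ⁻¹ᵁ U)) (pullbackSection_map ι.hom s)
  rw [h1, h1, he, hι]

end TorsionBundle

variable {X X' : Scheme.{u}} {f : X ⟶ Y} {f' : X' ⟶ Y'} {k : X' ⟶ X}
  {L : TorsionBundle Y} {L' : TorsionBundle Y'} {lam : L.L ⟶ pushforwardStructureSheaf f}
  {lam' : L'.L ⟶ pushforwardStructureSheaf f'}

/-- Special functions over arbitrary open sets lie in the image of `L`, by gluing. -/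
lemma IsTwistedSum.exists_value_eq_of_isSpecial (hl : IsTwistedSum lam)
    (h2 : IsUnit (2 : Γ(Y, ⊤))) {U : Y.Opens} {r : Γ(X, f ⁻¹ᵁ U)} (hr : IsSpecial f r) :
    ∃ t : Γ(L.L, U), value lam t = r := by
  have h (V : Y.Opens) (hV : V ≤ U) (pV : ∃ s : Γ(L.L, V), IsGen s) :
      ∃ t : Γ(L.L, V), value lam t = ro X (f.preimage_mono hV) r := by
    obtain ⟨s, hs⟩ := pV
    exact hl.exists_value_eq (isUnit_two h2 V) (hr.restrict hV) hs
  choose t ht using h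
  obtain ⟨t₀, ht₀⟩ := section_glue (L.isLineBundle.isBasisOf.le U) t
    (fun V W hV hW pV pW h => hl.value_injective (by rw [value_rs, ht, ht, ro_ro]))
  refine ⟨t₀, function_ext fun x hx => ?_⟩
  obtain ⟨V, hV, hxV, pV⟩ := L.isLineBundle.isBasisOf U (f x) hx
  exact ⟨f ⁻¹ᵁ V, f.preimage_mono hV, hxV, by rw [← value_rs lam hV, ht₀ V hV pV, ht]⟩

/-- Pullback of functions along a base change of double covers restricts to a morphism between the
`2`-torsion line bundles. -/
lemma exists_pushApp (h2 : IsUnit (2 : Γ(Y', ⊤))) [IsAffineHom f] (h : IsPullback k f' f g)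
    (hl : IsTwistedSum lam) (hl' : IsTwistedSum lam') :
    ∃ ν : L.L ⟶ (Scheme.Modules.pushforward g).obj L'.L, ∀ (U : Y.Opens) (s : Γ(L.L, U)),
      value lam' (pushApp ν s) = pullFun h.w (value lam s) := by
  have key (U : Y.Opens) (hU : ∃ s : Γ(L.L, U), IsGen s) (s : Γ(L.L, U)) :
      ∃ t : Γ(L'.L, g ⁻¹ᵁ U), value lam' t = pullFun h.w (value lam s) := by
    obtain ⟨r, hr⟩ := hU
    obtain ⟨t, ht⟩ := hl'.exists_value_eq_of_isSpecial h2 ((hl.isSpecial hr).pullFun h)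
    obtain ⟨a, rfl⟩ := hr.exists_eq s
    exact ⟨g.app U a • t, by rw [value_smul, value_smul, ht, map_mul, pullFun_app]⟩
  choose φ hφ using key
  obtain ⟨ν, hν⟩ := exists_hom_of_basis (M := L.L) (N := (Scheme.Modules.pushforward g).obj L'.L)
    L.isLineBundle.isBasisOf (fun U hU =>
    { toFun := φ U hU
      map_add' := fun s t => hl'.value_injective (by
        refine (hφ U hU _).trans ?_
        refine Eq.trans ?_ (value_add lam' _ _).symm
        rw [hφ, hφ, value_add, map_add])
      map_smul' := fun a s => hl'.value_injective (by
        refine (hφ U hU _).trans ?_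
        refine Eq.trans ?_ (value_smul lam' (g.app U a) _).symm
        rw [hφ, value_smul, map_mul, pullFun_app]) })
    (fun U V hU hV hVU s => hl'.value_injective (by
      refine (hφ V hV _).trans ?_
      refine Eq.trans ?_ (value_rs lam' (g.preimage_mono hVU) _).symm
      refine Eq.trans ?_ (congrArg _ (hφ U hU s).symm)
      rw [value_rs lam hVU, pullFun_ro h.w hVU]))
  refine ⟨ν, fun U s => function_ext fun x hx => ?_⟩
  obtain ⟨V, hV, hxV, pV⟩ := L.isLineBundle.isBasisOf U (g (f' x)) hx
  refine ⟨f' ⁻¹ᵁ g ⁻¹ᵁ V, f'.preimage_mono (g.preimage_mono hV), hxV, ?_⟩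
  rw [← pullFun_ro h.w hV, ← value_rs lam hV, ← value_rs lam' (g.preimage_mono hV),
    ← pushApp_rs ν hV, ← hφ V pV]
  exact congrArg (value lam') (hν V pV _)

/-- If the double cover defined by `L'` is the base change of the double cover defined by `L`,
then `L'` is the base change of `L`. -/
lemma isBaseChange_of_isPullback (h2 : IsUnit (2 : Γ(Y', ⊤))) [IsAffineHom f]
    (h : IsPullback k f' f g) (hl : IsTwistedSum lam) (hl' : IsTwistedSum lam') :
    L.IsBaseChange g L' := by
  obtain ⟨ν, hν⟩ := exists_pushApp h2 h hl hl'
  obtain ⟨e, he⟩ := exists_pullback_iso L.isLineBundle ν fun U s hs =>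
    hl'.isGen_of_isSpecial (by rw [hν]; exact (hl.isSpecial hs).pullFun h)
  refine ⟨e, fun U s t => hl'.app_injective ?_⟩
  rw [he, he, ← hl'.mul, hν, hν, ← map_mul, hl.mul, pullFun_app]

/-- The `2`-torsion line bundle is determined by its relative spectrum. -/
lemma isIsomorphic_of_isTwistedSum (h2 : IsUnit (2 : Γ(Y, ⊤))) [IsAffineHom f]
    {L₁ : TorsionBundle Y} {lam₁ : L₁.L ⟶ pushforwardStructureSheaf f} (hl : IsTwistedSum lam)
    (hl₁ : IsTwistedSum lam₁) : L.IsIsomorphic L₁ :=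
  (isBaseChange_of_isPullback h2 (IsPullback.id_horiz f) hl hl).isIsomorphic
    (isBaseChange_of_isPullback h2 (IsPullback.id_horiz f) hl hl₁)

end TorsionBaseChange

/-! ### The correspondence -/

section Correspondence

variable {Y Y' : Scheme.{u}}

/-- The relative spectrum of `𝒪_Y ⊕ L` is a Galois cover of degree `2`. -/
lemma exists_cover (h2 : IsUnit (2 : Γ(Y, ⊤))) (L : TorsionBundle Y) :
    ∃ X : GaloisDoubleCover Y, IsRelSpec L X.f := by
  obtain ⟨lam, hl⟩ := exists_isTwistedSum_twistedCoverMap L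
  exact ⟨⟨twistedCover L, twistedCoverMap L, hl.isGaloisCover h2, hl.finrank_eq⟩,
    isRelSpec_iff.mpr ⟨inferInstance, lam, hl⟩⟩

/-- Every Galois cover of degree `2` is the relative spectrum of `𝒪_Y ⊕ L` for some `L`. Being
finite étale of degree `2` is enough: the self-product then splits automatically. -/
lemma exists_torsionBundle (h2 : IsUnit (2 : Γ(Y, ⊤))) (X : GaloisDoubleCover Y) :
    ∃ L : TorsionBundle Y, IsRelSpec L X.f := by
  have := X.isGalois.isFinite
  have := X.isGalois.etale
  obtain ⟨L, lam, hl⟩ := exists_isTwistedSum h2 (isBasisOf_isSpecial h2 X.f X.degree_eq)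
  exact ⟨L, isRelSpec_iff.mpr ⟨inferInstance, lam, hl⟩⟩

lemma IsRelSpec.of_isIsomorphic {L L' : TorsionBundle Y} {X : Scheme.{u}} {f : X ⟶ Y}
    (h : IsRelSpec L f) (hL : L.IsIsomorphic L') : IsRelSpec L' f := by
  obtain ⟨hf, lam, hl⟩ := isRelSpec_iff.mp h
  obtain ⟨ι, hι⟩ := (TorsionBundle.isIsomorphic_equivalence.symm hL).exists_pair
  refine isRelSpec_iff.mpr ⟨hf, ι.hom ≫ lam, ⟨fun U s t => ?_, fun U => ?_⟩⟩
  · rw [value_comp, value_comp, hl.mul, hι]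
  · exact (hl.bij U).comp (Function.bijective_id.prodMap (bijective_of_isIso ι.hom U))

/-- Base changes of corresponding line bundles and covers correspond. -/
lemma IsRelSpec.baseChange {g : Y' ⟶ Y} (h2 : IsUnit (2 : Γ(Y', ⊤))) {L : TorsionBundle Y}
    {L' : TorsionBundle Y'} {X : Scheme.{u}} {f : X ⟶ Y} (X' : GaloisDoubleCover Y')
    {k : X'.X ⟶ X} (hX : IsPullback k X'.f f g) (h : IsRelSpec L f) (hL : L.IsBaseChange g L') :
    IsRelSpec L' X'.f := by
  obtain ⟨hf, lam, hl⟩ := isRelSpec_iff.mp h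
  obtain ⟨L'', h''⟩ := exists_torsionBundle h2 X'
  obtain ⟨hf', lam', hl'⟩ := isRelSpec_iff.mp h''
  exact h''.of_isIsomorphic ((isBaseChange_of_isPullback h2 hX hl hl').isIsomorphic hL)

lemma isUnit_two_of_hom (h2 : IsUnit (2 : Γ(Y, ⊤))) (g : Y' ⟶ Y) : IsUnit (2 : Γ(Y', ⊤)) := by
  have := h2.map g.appTop.hom
  rwa [map_ofNat] at this

/-- The base change of `L` is read off from the base change of its double cover; this provides
the trivialization of the square of `g^* L`. -/
lemma TorsionBundle.exists_isBaseChange (h2 : IsUnit (2 : Γ(Y, ⊤))) (g : Y' ⟶ Y)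
    (L : TorsionBundle Y) : ∃ L' : TorsionBundle Y', L.IsBaseChange g L' := by
  have h2' := isUnit_two_of_hom h2 g
  obtain ⟨X, hX⟩ := exists_cover h2 L
  obtain ⟨hf, lam, hl⟩ := isRelSpec_iff.mp hX
  obtain ⟨L', h'⟩ := exists_torsionBundle h2' (X.baseChange g)
  obtain ⟨hf', lam', hl'⟩ := isRelSpec_iff.mp h'
  exact ⟨L', isBaseChange_of_isPullback h2' (IsPullback.of_hasPullback X.f g) hl hl'⟩

/-- A relation between two types that is total on both sides and compatible with equivalence
relations induces a bijection of quotients. -/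
lemma exists_quotient_equiv {α β : Type*} [Setoid α] [Setoid β] (R : α → β → Prop)
    (h₁ : ∀ a, ∃ b, R a b) (h₂ : ∀ b, ∃ a, R a b)
    (hα : ∀ {a a' b}, R a b → R a' b → a ≈ a') (hβ : ∀ {a b b'}, R a b → R a b' → b ≈ b')
    (hα' : ∀ {a a' b}, R a b → a ≈ a' → R a' b) (hβ' : ∀ {a b b'}, R a b → b ≈ b' → R a b') :
    ∃ Φ : Quotient ‹Setoid α› ≃ Quotient ‹Setoid β›, ∀ a b, Φ ⟦a⟧ = ⟦b⟧ ↔ R a b := by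
  choose F hF using h₁
  let φ : Quotient ‹Setoid α› → Quotient ‹Setoid β› :=
    Quotient.map F fun a a' h => hβ (hα' (hF a) h) (hF a')
  have hφ (a b) : φ ⟦a⟧ = ⟦b⟧ ↔ R a b :=
    ⟨fun h => hβ' (hF a) (Quotient.exact h), fun h => Quotient.sound (hβ (hF a) h)⟩
  refine ⟨Equiv.ofBijective φ ⟨fun x y => ?_, fun y => ?_⟩, hφ⟩
  · induction x, y using Quotient.inductionOn₂ with
    | h a a' => exact fun h => Quotient.sound (hα ((hφ a _).mp h) (hF a'))
  · induction y using Quotient.inductionOn with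
    | h b =>
      obtain ⟨a, ha⟩ := h₂ b
      exact ⟨⟦a⟧, (hφ a b).mpr ha⟩

/-- The relation "`X` is the relative spectrum of `𝒪_Y ⊕ L`" is a bijection on isomorphism
classes. -/
lemma exists_correspondence (h2 : IsUnit (2 : Γ(Y, ⊤))) :
    ∃ Φ : TorsionBundle.IsoClass Y ≃ GaloisDoubleCover.IsoClass Y,
      ∀ (L : TorsionBundle Y) (X : GaloisDoubleCover Y), Φ ⟦L⟧ = ⟦X⟧ ↔ IsRelSpec L X.f := by
  refine exists_quotient_equiv
    (fun (L : TorsionBundle Y) (X : GaloisDoubleCover Y) => IsRelSpec L X.f) (exists_cover h2)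
    (exists_torsionBundle h2) (fun h h' => ?_) (fun h h' => ?_)
    (fun h hL => h.of_isIsomorphic hL) fun {L X X'} h hX => ?_
  · obtain ⟨hf, lam, hl⟩ := isRelSpec_iff.mp h
    obtain ⟨-, lam', hl'⟩ := isRelSpec_iff.mp h'
    exact isIsomorphic_of_isTwistedSum h2 hl hl'
  · obtain ⟨hf, lam, hl⟩ := isRelSpec_iff.mp h
    obtain ⟨hf', lam', hl'⟩ := isRelSpec_iff.mp h'
    exact exists_iso_of_isTwistedSum hl hl'
  · -- an isomorphism of covers is a base change along the identity of `Y`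
    obtain ⟨e, he⟩ := hX
    obtain ⟨hf, lam, hl⟩ := isRelSpec_iff.mp h
    have hsq : IsPullback e.inv X'.f X.f (𝟙 Y) :=
      IsPullback.of_horiz_isIso ⟨by rw [Category.comp_id, ← he, e.inv_hom_id_assoc]⟩
    exact h.baseChange h2 X' hsq (isBaseChange_of_isPullback h2 (IsPullback.id_horiz X.f) hl hl)

/-- Base change of `2`-torsion line bundles is well defined on isomorphism classes. -/
lemma TorsionBundle.exists_classBaseChange (h2 : IsUnit (2 : Γ(Y, ⊤))) (g : Y' ⟶ Y) :
    ∃ gPull : TorsionBundle.IsoClass Y → TorsionBundle.IsoClass Y',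
      ∀ (L : TorsionBundle Y) (L' : TorsionBundle Y'), gPull ⟦L⟧ = ⟦L'⟧ ↔ L.IsBaseChange g L' := by
  choose F hF using TorsionBundle.exists_isBaseChange h2 g
  refine ⟨Quotient.map F fun L L₁ h =>
    (hF L).isIsomorphic (IsIsomorphic.trans_isBaseChange h (hF L₁)),
    fun L L' => ⟨fun h => ?_, fun h => ?_⟩⟩
  · exact (hF L).trans_isIsomorphic (Quotient.exact h)
  · exact Quotient.sound ((hF L).isIsomorphic h)

end Correspondence

end DoubleCover

end

theorem lemma3p7 :
    ∃ Φ : ∀ (Y : Scheme.{u}) [ConnectedSpace Y], IsUnit (2 : Γ(Y, ⊤)) →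
        (DoubleCover.TorsionBundle.IsoClass Y ≃ DoubleCover.GaloisDoubleCover.IsoClass Y),
      -- the cover corresponding to `L` is the relative spectrum of `𝒪_Y ⊕ L`
      (∀ (Y : Scheme.{u}) [ConnectedSpace Y] (h2 : IsUnit (2 : Γ(Y, ⊤)))
        (L : DoubleCover.TorsionBundle Y) (X : DoubleCover.GaloisDoubleCover Y),
        Φ Y h2 ⟦L⟧ = ⟦X⟧ ↔ DoubleCover.IsRelSpec L X.f) ∧
      -- compatibility with base change
      (∀ (Y Y' : Scheme.{u}) [ConnectedSpace Y] (h2 : IsUnit (2 : Γ(Y, ⊤))) (g : Y' ⟶ Y),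
        ∃ gPull : DoubleCover.TorsionBundle.IsoClass Y → DoubleCover.TorsionBundle.IsoClass Y',
          -- `gPull` is the base change `g^*` of `2`-torsion line bundles
          (∀ (L : DoubleCover.TorsionBundle Y) (L' : DoubleCover.TorsionBundle Y'),
            gPull ⟦L⟧ = ⟦L'⟧ ↔ L.IsBaseChange g L') ∧
          -- the square of correspondences commutes if `Y'` is connected
          (∀ [ConnectedSpace Y'] (h2' : IsUnit (2 : Γ(Y', ⊤)))
            (c : DoubleCover.TorsionBundle.IsoClass Y),
            Φ Y' h2' (gPull c) = DoubleCover.GaloisDoubleCover.classBaseChange g (Φ Y h2 c)) ∧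
          -- for arbitrary `Y'`, base changes of corresponding objects correspond
          (∀ (L : DoubleCover.TorsionBundle Y) (L' : DoubleCover.TorsionBundle Y')
            (X : DoubleCover.GaloisDoubleCover Y),
            Φ Y h2 ⟦L⟧ = ⟦X⟧ → gPull ⟦L⟧ = ⟦L'⟧ →
              DoubleCover.IsRelSpec L' (X.baseChange g).f)) := by
  choose Φ hΦ using fun (Y : Scheme.{u}) (h2 : IsUnit (2 : Γ(Y, ⊤))) =>
    DoubleCover.exists_correspondence h2
  refine ⟨fun Y _ h2 => Φ Y h2, fun Y _ h2 => hΦ Y h2, fun Y Y' _ h2 g => ?_⟩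
  obtain ⟨gPull, hg⟩ := DoubleCover.TorsionBundle.exists_classBaseChange h2 g
  have h2' : IsUnit (2 : Γ(Y', ⊤)) := DoubleCover.isUnit_two_of_hom h2 g
  have key (L : DoubleCover.TorsionBundle Y) (L' : DoubleCover.TorsionBundle Y')
      (X : DoubleCover.GaloisDoubleCover Y) (h : Φ Y h2 ⟦L⟧ = ⟦X⟧) (h' : gPull ⟦L⟧ = ⟦L'⟧) :
      DoubleCover.IsRelSpec L' (X.baseChange g).f :=
    ((hΦ Y h2 L X).mp h).baseChange h2' (X.baseChange g) (IsPullback.of_hasPullback X.f g)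
      ((hg L L').mp h')
  refine ⟨gPull, hg, fun _ c => ?_, key⟩
  obtain ⟨L, rfl⟩ := Quotient.exists_rep c
  obtain ⟨X, hX⟩ := Quotient.exists_rep (Φ Y h2 ⟦L⟧)
  obtain ⟨L', hL'⟩ := Quotient.exists_rep (gPull ⟦L⟧)
  rw [← hX, ← hL']
  exact (hΦ Y' h2' L' _).mpr (key L L' X hX.symm hL'.symm)
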